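/- **Weighted trace theorem.** Write $\langle a\rangle=(1+a^2)^{1/2}$ and $w^\pm=x_1\pm t$. For every $\mu,\nu\in\mathbb R$, $L\ge 0$ and $\delta>0$ there is a constant $C=C(\mu,\nu,L,\delta)>0$ with the following property. Let $t\in\mathbb R$, let $f:\mathbb R\to\mathbb R$ be Lipschitz with constant $L$, and let $\Omega\subset\mathbb R^2$ be a domain (open, connected) whose boundary is the graph $\Gamma_f=\{x_2=f(x_1)\}$, or whose boundary is $\Gamma_f\cup\{x_2=b\}$ for some $b\in\mathbb R$ with $|f(x_1)-b|\ge\delta$ for all $x_1$. Let $g:\Omega\to\mathbb R$ have weak first derivatives $\partial_1g,\partial_2g$ in $\Omega$ such that $\langle w^+\rangle^\mu\langle w^-\rangle^\nu\,\partial^\alpha g\in L^2(\Omega)$ for all $|\alpha|\le 1$. Then $g$ has a trace $\underline g(x_1)$ on $\Gamma_f$, that is, a function with $$\lim_{r\to0^+}\frac1{|B_r\cap\Omega|}\int_{B_r\cap\Omega}|g(y)-\underline g(x_1)|\,dy=0,\qquad B_r=B_r\big((x_1,f(x_1))\big),\quad\text{for a.e. }x_1\in\mathbb R,$$ the tempered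 distribution $\langle\partial_1\rangle^{1/2}\underline g=(1-\partial_1^2)^{1/4}\underline g$ on $\mathbb R$ is a function, and $$\big\|\langle w^+\rangle^{\mu}\langle w^-\rangle^{\nu}\langle\partial_1\rangle^{1/2}\underline g\big\|_{L^2(\mathbb R)}\le C\sum_{|\alpha|\le1}\big\|\langle w^+\rangle^{\mu}\langle w^-\rangle^{\nu}\,\partial^\alpha g\big\|_{L^2(\Omega)}.$$ In particular $C$ does not depend on $t$. -/

import Mathlib

open MeasureTheory Set Filter Topology
open scoped NNReal ENNReal ContDiff SchwartzMap

noncomputable section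

/-- The Japanese bracket `⟨a⟩ = (1 + a²)^{1/2}`. -/
def japaneseBracket (a : ℝ) : ℝ := Real.sqrt (1 + a ^ 2)

/-- The weight `⟨w⁺⟩^μ ⟨w⁻⟩^ν` at time `t`, where `w^± = x₁ ± t`. -/
def weight (μ ν t x₁ : ℝ) : ℝ :=
  japaneseBracket (x₁ + t) ^ μ * japaneseBracket (x₁ - t) ^ ν

/-- The curve `{x₂ = f(x₁)}` in the plane. -/
def graphCurve (f : ℝ → ℝ) : Set (ℝ × ℝ) := {x | x.2 = f x.1}

/-- `Ω` is a domain (open and connected) whose boundary is the graph of `f`, so that `Ω` is one of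
the two sides of the graph, or whose boundary consists of the graph of `f` and one horizontal line
`x₂ = b` (a fixed bottom or top) that stays at vertical distance at least `δ` from the graph. -/
def IsGraphDomain (f : ℝ → ℝ) (δ : ℝ) (Ω : Set (ℝ × ℝ)) : Prop :=
  IsOpen Ω ∧ IsConnected Ω ∧
    (frontier Ω = graphCurve f ∨
      ∃ b : ℝ, (∀ x₁, δ ≤ |f x₁ - b|) ∧ frontier Ω = graphCurve f ∪ {x | x.2 = b})

/-- `g'` is the weak derivative of `g` on the open set `Ω` in the direction `v`. -/
def HasWeakDirDeriv (Ω : Set (ℝ × ℝ)) (v : ℝ × ℝ) (g g' : ℝ × ℝ → ℝ) : Prop :=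
  LocallyIntegrableOn g Ω ∧ LocallyIntegrableOn g' Ω ∧
    ∀ φ : ℝ × ℝ → ℝ, ContDiff ℝ ∞ φ → HasCompactSupport φ → tsupport φ ⊆ Ω →
      ∫ x in Ω, g x * fderiv ℝ φ x v = -∫ x in Ω, g' x * φ x

/-- `T` is the trace of `g : Ω → ℝ` on the boundary curve `x₂ = f(x₁)`, as a function of `x₁`:
at almost every `x₁`, the mean of `|g - T(x₁)|` over the part in `Ω` of the ball of radius `r`
centred at `(x₁, f(x₁))` tends to `0` as `r → 0`. -/
def IsTrace (Ω : Set (ℝ × ℝ)) (f : ℝ → ℝ) (g : ℝ × ℝ → ℝ) (T : ℝ → ℝ) : Prop :=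
  ∀ᵐ x₁ : ℝ, Tendsto
    (fun r : ℝ => ⨍⁻ y in Metric.ball (x₁, f x₁) r ∩ Ω, ‖g y - T x₁‖ₑ ∂volume) (𝓝[>] 0) (𝓝 0)

/-- The operator `⟨∂₁⟩^s = (1 - ∂₁²)^{s/2}` on tempered distributions on the line. In the
normalization `𝓕 φ ξ = ∫ e^{-2πixξ} φ(x) dx` its symbol is `(1 + (2πξ)²)^{s/2}`. -/
def fracDeriv (s : ℝ) : 𝓢'(ℝ, ℂ) →L[ℂ] 𝓢'(ℝ, ℂ) :=
  TemperedDistribution.fourierMultiplierCLM ℂ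
    (fun ξ : ℝ => (((1 + (2 * Real.pi * ξ) ^ 2) ^ (s / 2) : ℝ) : ℂ))

/-- The tempered distribution `U` is given by the function `h`. -/
def IsGivenBy (U : 𝓢'(ℝ, ℂ)) (h : ℝ → ℂ) : Prop :=
  ∀ φ : 𝓢(ℝ, ℂ), Integrable (fun x => φ x * h x) ∧ U φ = ∫ x, φ x * h x

/-- `h = ⟨∂₁⟩^s T` for functions `T`, `h` on the line, in the sense of tempered distributions. -/
def IsFracDeriv (s : ℝ) (T h : ℝ → ℂ) : Prop :=
  ∃ U : 𝓢'(ℝ, ℂ), IsGivenBy U T ∧ IsGivenBy (fracDeriv s U) h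

end

/-! Write `w` for the weight `⟨w⁺⟩^μ ⟨w⁻⟩^ν`. Near the graph, `Ω` is flattened by the shear `(x, y)
↦ (x, f x + σ y)` with `σ = ±1`, and `g` is cut off. The result is a function `G` on the strip `0 <
y < δ` with weak derivatives `G₁`, `G₂` and boundary value `T(x) = -∫₀^δ G₂(x, τ) dτ`
(`exists_isStripSobolev`). One-dimensional Lebesgue differentiation shows that `T` is the trace
(`isTrace_stripTrace`), and traces are unique almost everywhere. By duality and the Riesz
representation theorem (`exists_isFracDeriv`), it suffices to bound `∫ T (1 - ∂²)^(1/4)(w v)` by the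
`L²` norm of `v`, for Schwartz `v`. Put `P_y = exp(-y²(1 - ∂²))` and `ψ = w v`. The subordination
formula `c (1 - ∂²)^(1/4) = ∫₀^∞ y^(1/2) P_y (1 - ∂²) dy` with `c = Γ(3/4)/2` reduces the pairing to
those of `T` with `P_y ψ`, a lower order term, and with `∂² P_y ψ`. In the latter, the trace is
decomposed at the height `y` of the heat flow itself, `T = G(·, y) - ∫₀^y G₂(·, τ) dτ`. Integration
by parts in `x` leaves `G₁(·, y)` against `∂P_y ψ` and `∫₀^y G₂` against `∂²P_y ψ`. Cauchy-Schwarz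
in `y`, Hardy's inequality for the `G₂` term, and the square function bounds `∫ y^(2j-1) ‖w⁻¹
∂ʲP_y(w v)‖² dy ≤ C ‖v‖²` for `j = 1, 2` conclude (`exists_enorm_integral_mul_quarter_le`). Without
weight these bounds are Plancherel's theorem. With weight, the error `w⁻¹ ∂ʲP_y w - ∂ʲP_y` has a
kernel carrying an additional factor `|x - z|`, which is of size `y`, and this gain makes its
contribution integrable in `y`. The weight enters only through the constants of `IsTemperedWeight`.
These are invariant under translation, hence independent of `t`. -/

/-! ### The `L²` norm of functions with values in `[0, ∞]` -/

/-- The `L²` norm of a `[0, ∞]`-valued function. -/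
noncomputable def l2norm {α : Type*} [MeasurableSpace α] (μ : Measure α) (f : α → ℝ≥0∞) : ℝ≥0∞ :=
  (∫⁻ x, f x ^ 2 ∂μ) ^ (1 / 2 : ℝ)

section L2norm

variable {α : Type*} [MeasurableSpace α] {μ : Measure α}

theorem l2norm_sq (f : α → ℝ≥0∞) : l2norm μ f ^ 2 = ∫⁻ x, f x ^ 2 ∂μ := by
  rw [l2norm, ← ENNReal.rpow_natCast, ← ENNReal.rpow_mul]
  norm_num

theorem l2norm_le_of_sq_le {a : ℝ≥0∞} {f : α → ℝ≥0∞} (h : ∫⁻ x, f x ^ 2 ∂μ ≤ a ^ 2) :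
    l2norm μ f ≤ a := by
  rw [← l2norm_sq] at h
  exact (ENNReal.pow_le_pow_left_iff two_ne_zero).1 h

theorem lintegral_mul_le_l2norm {f g : α → ℝ≥0∞} (hf : AEMeasurable f μ) (hg : AEMeasurable g μ) :
    ∫⁻ x, f x * g x ∂μ ≤ l2norm μ f * l2norm μ g := by
  have h := ENNReal.lintegral_mul_le_Lp_mul_Lq μ Real.HolderConjugate.two_two hf hg
  simpa [l2norm] using h

theorem l2norm_add_le {f g : α → ℝ≥0∞} (hf : AEMeasurable f μ) (hg : AEMeasurable g μ) :
    l2norm μ (fun x => f x + g x) ≤ l2norm μ f + l2norm μ g := by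
  have h := ENNReal.lintegral_Lp_add_le hf hg (p := 2) (by norm_num)
  simpa [l2norm] using h

theorem l2norm_mono_ae {f g : α → ℝ≥0∞} (h : ∀ᵐ x ∂μ, f x ≤ g x) : l2norm μ f ≤ l2norm μ g := by
  unfold l2norm
  gcongr ?_ ^ _
  apply lintegral_mono_ae
  filter_upwards [h] with x hx
  gcongr

theorem l2norm_const_mul {c : ℝ≥0∞} {f : α → ℝ≥0∞} (hf : AEMeasurable f μ) :
    l2norm μ (fun x => c * f x) = c * l2norm μ f := by
  unfold l2norm
  simp_rw [mul_pow]
  rw [lintegral_const_mul'' _ (hf.pow_const 2), ENNReal.mul_rpow_of_nonneg _ _ (by norm_num),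
    ← ENNReal.rpow_natCast, ← ENNReal.rpow_mul]
  norm_num

theorem eLpNorm_two_eq_l2norm {E : Type*} [NormedAddCommGroup E] (f : α → E) :
    eLpNorm f 2 μ = l2norm μ (fun x => ‖f x‖ₑ) := by
  rw [eLpNorm_eq_lintegral_rpow_enorm_toReal (by norm_num) (by norm_num)]
  simp [l2norm]

theorem lintegral_mul_sq_le {f g : α → ℝ≥0∞} (hf : AEMeasurable f μ) (hg : AEMeasurable g μ) :
    (∫⁻ x, f x * g x ∂μ) ^ 2 ≤ (∫⁻ x, f x ^ 2 ∂μ) * ∫⁻ x, g x ^ 2 ∂μ := by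
  rw [← l2norm_sq, ← l2norm_sq, ← mul_pow]
  gcongr
  exact lintegral_mul_le_l2norm hf hg

/-- Cauchy-Schwarz with a weight. -/
theorem lintegral_mul_sq_le_weighted {f k : α → ℝ≥0∞} (hf : AEMeasurable f μ)
    (hk : AEMeasurable k μ) :
    (∫⁻ x, k x * f x ∂μ) ^ 2 ≤ (∫⁻ x, k x ∂μ) * ∫⁻ x, k x * f x ^ 2 ∂μ := by
  have e : ∀ x, (k x ^ (1 / 2 : ℝ)) ^ 2 = k x := by
    intro x
    rw [← ENNReal.rpow_natCast, ← ENNReal.rpow_mul]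
    norm_num
  have h := lintegral_mul_sq_le (μ := μ) (f := fun x => k x ^ (1 / 2 : ℝ))
    (g := fun x => k x ^ (1 / 2 : ℝ) * f x) (hk.pow_const _) ((hk.pow_const _).mul hf)
  simp_rw [mul_pow, e, ← mul_assoc, ← sq, e] at h
  exact h

/-- Young's inequality `L¹ * L² ⊆ L²`. -/
theorem l2norm_convolution_le {K V : ℝ → ℝ≥0∞} (hK : Measurable K) (hV : Measurable V) :
    l2norm volume (fun x => ∫⁻ z, K (x - z) * V z) ≤ (∫⁻ x, K x) * l2norm volume V := by
  apply l2norm_le_of_sq_le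
  rw [mul_pow, l2norm_sq]
  calc ∫⁻ x, (∫⁻ z, K (x - z) * V z) ^ 2
      ≤ ∫⁻ x, (∫⁻ z, K z) * ∫⁻ z, K (x - z) * V z ^ 2 := by
        apply lintegral_mono
        intro x
        refine (lintegral_mul_sq_le_weighted hV.aemeasurable (by fun_prop)).trans ?_
        rw [lintegral_sub_left_eq_self (fun z => K z) x]
    _ = (∫⁻ z, K z) * ∫⁻ x, ∫⁻ z, K (x - z) * V z ^ 2 := by
        rw [lintegral_const_mul]
        exact Measurable.lintegral_prod_right'
          (f := fun p : ℝ × ℝ => K (p.1 - p.2) * V p.2 ^ 2) (by fun_prop)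
    _ = (∫⁻ z, K z) * ∫⁻ z, ∫⁻ x, K (x - z) * V z ^ 2 := by
        rw [lintegral_lintegral_swap]
        exact (by fun_prop : Measurable fun p : ℝ × ℝ => K (p.1 - p.2) * V p.2 ^ 2).aemeasurable
    _ = (∫⁻ x, K x) ^ 2 * ∫⁻ z, V z ^ 2 := by
        have : ∀ z, ∫⁻ x, K (x - z) * V z ^ 2 = (∫⁻ x, K x) * V z ^ 2 := by
          intro z
          rw [lintegral_mul_const _ (by fun_prop), lintegral_sub_right_eq_self (fun x => K x) z]
        simp_rw [this]
        rw [lintegral_const_mul _ (by fun_prop), sq, mul_assoc]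

/-- Hardy's inequality on the half-line, in the `L²` case. -/
theorem hardy_inequality {b : ℝ → ℝ≥0∞} (hb : Measurable b) :
    ∫⁻ y in Ioi (0 : ℝ), ((∫⁻ τ in Ioc 0 y, b τ) * ENNReal.ofReal y⁻¹) ^ 2
      ≤ 4 * ∫⁻ y in Ioi (0 : ℝ), b y ^ 2 := by
  -- Cauchy-Schwarz with the weight `τ^(-1/2)`, whose integral over `(0, y]` is `2 y^(1/2)`. After
  -- Tonelli, `∫_τ^∞ 2 y^(-3/2) dy = 4 τ^(-1/2)` cancels the factor `τ^(1/2)` and leaves the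
  -- constant `4`.
  have key : ∀ y ∈ Ioi (0 : ℝ), ((∫⁻ τ in Ioc 0 y, b τ) * ENNReal.ofReal y⁻¹) ^ 2 ≤
      ∫⁻ τ in Ioi (0 : ℝ), (Ici τ).indicator (fun y => ENNReal.ofReal (2 * y ^ (-3 / 2 : ℝ))) y *
        (ENNReal.ofReal (τ ^ (1 / 2 : ℝ)) * b τ ^ 2) := by
    intro y hy
    have hy : 0 < y := hy
    have h1 : ∫⁻ τ in Ioc 0 y, b τ = ∫⁻ τ in Ioc 0 y, ENNReal.ofReal (τ ^ (-(1 / 2) : ℝ)) *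
        (ENNReal.ofReal (τ ^ (1 / 2 : ℝ)) * b τ) := by
      refine setLIntegral_congr_fun measurableSet_Ioc fun τ hτ => ?_
      rw [← mul_assoc, ← ENNReal.ofReal_mul (Real.rpow_nonneg hτ.1.le _), ← Real.rpow_add hτ.1]
      norm_num
    have h2 : ∫⁻ τ in Ioc 0 y, ENNReal.ofReal (τ ^ (-(1 / 2) : ℝ)) =
        ENNReal.ofReal (2 * y ^ (1 / 2 : ℝ)) := by
      have hi : IntervalIntegrable (fun τ : ℝ => τ ^ (-(1 / 2) : ℝ)) volume 0 y :=
        intervalIntegral.intervalIntegrable_rpow' (by norm_num)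
      rw [intervalIntegrable_iff_integrableOn_Ioc_of_le hy.le] at hi
      rw [← ofReal_integral_eq_lintegral_ofReal hi, ← intervalIntegral.integral_of_le hy.le,
        integral_rpow (by left; norm_num)]
      · congr 1
        norm_num
        ring
      · refine (ae_restrict_mem measurableSet_Ioc).mono fun τ hτ => ?_
        exact Real.rpow_nonneg hτ.1.le _
    rw [mul_pow, h1]
    have h3 := lintegral_mul_sq_le_weighted (μ := volume.restrict (Ioc 0 y))
      (f := fun τ => ENNReal.ofReal (τ ^ (1 / 2 : ℝ)) * b τ)
      (k := fun τ => ENNReal.ofReal (τ ^ (-(1 / 2) : ℝ))) (by fun_prop) (by fun_prop)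
    rw [h2] at h3
    calc _ ≤ (ENNReal.ofReal (2 * y ^ (1 / 2 : ℝ)) * ∫⁻ τ in Ioc 0 y,
          ENNReal.ofReal (τ ^ (-(1 / 2) : ℝ)) * (ENNReal.ofReal (τ ^ (1 / 2 : ℝ)) * b τ) ^ 2) *
          ENNReal.ofReal y⁻¹ ^ 2 := by gcongr
      _ = ENNReal.ofReal (2 * y ^ (-3 / 2 : ℝ)) * ∫⁻ τ in Ioc 0 y,
          ENNReal.ofReal (τ ^ (1 / 2 : ℝ)) * b τ ^ 2 := by
        have h4 : ∫⁻ τ in Ioc 0 y,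
            ENNReal.ofReal (τ ^ (-(1 / 2) : ℝ)) * (ENNReal.ofReal (τ ^ (1 / 2 : ℝ)) * b τ) ^ 2 =
            ∫⁻ τ in Ioc 0 y, ENNReal.ofReal (τ ^ (1 / 2 : ℝ)) * b τ ^ 2 := by
          refine setLIntegral_congr_fun measurableSet_Ioc fun τ hτ => ?_
          rw [mul_pow, ← mul_assoc, sq (ENNReal.ofReal (τ ^ (1 / 2 : ℝ))), ← mul_assoc,
            ← ENNReal.ofReal_mul (Real.rpow_nonneg hτ.1.le _), ← Real.rpow_add hτ.1]
          norm_num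
        rw [h4, mul_right_comm, ← ENNReal.ofReal_pow (by positivity),
          ← ENNReal.ofReal_mul (by positivity)]
        congr 2
        rw [← Real.rpow_neg_one, ← Real.rpow_natCast, ← Real.rpow_mul hy.le, mul_assoc,
          ← Real.rpow_add hy]
        norm_num
      _ = _ := by
        rw [← lintegral_const_mul _ (by fun_prop), ← lintegral_indicator measurableSet_Ioc,
          ← lintegral_indicator measurableSet_Ioi]
        refine lintegral_congr fun τ => ?_
        by_cases h0 : 0 < τ <;> by_cases hy' : τ ≤ y <;> simp [indicator, h0, hy']
  refine (setLIntegral_mono' measurableSet_Ioi key).trans ?_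
  have hm : Measurable fun p : ℝ × ℝ =>
      (Ici p.2).indicator (fun y => ENNReal.ofReal (2 * y ^ (-3 / 2 : ℝ))) p.1 *
        (ENNReal.ofReal (p.2 ^ (1 / 2 : ℝ)) * b p.2 ^ 2) := by
    refine Measurable.mul ?_ (by fun_prop)
    have : (fun p : ℝ × ℝ => (Ici p.2).indicator
        (fun y => ENNReal.ofReal (2 * y ^ (-3 / 2 : ℝ))) p.1) =
        {p : ℝ × ℝ | p.2 ≤ p.1}.indicator (fun p => ENNReal.ofReal (2 * p.1 ^ (-3 / 2 : ℝ))) := by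
      ext p
      simp [indicator]
    rw [this]
    exact Measurable.indicator (by fun_prop) (measurableSet_le measurable_snd measurable_fst)
  rw [lintegral_lintegral_swap hm.aemeasurable, ← lintegral_const_mul _ (by fun_prop)]
  refine setLIntegral_mono' measurableSet_Ioi fun τ hτ => ?_
  have hτ : 0 < τ := hτ
  rw [lintegral_mul_const _ ((by fun_prop : Measurable _).indicator measurableSet_Ici),
    lintegral_indicator measurableSet_Ici, Measure.restrict_restrict measurableSet_Ici]
  have hs : Ici τ ∩ Ioi 0 = Ici τ := inter_eq_left.2 fun y hy => lt_of_lt_of_le hτ hy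
  have h5 : ∫⁻ y in Ici τ, ENNReal.ofReal (2 * y ^ (-3 / 2 : ℝ)) =
      ENNReal.ofReal (4 * τ ^ (-(1 / 2) : ℝ)) := by
    rw [setLIntegral_congr (Ioi_ae_eq_Ici).symm, ← ofReal_integral_eq_lintegral_ofReal]
    · rw [integral_const_mul, integral_Ioi_rpow_of_lt (by norm_num) hτ]
      congr 1
      norm_num
      ring
    · exact (integrableOn_Ioi_rpow_of_lt (by norm_num) hτ).const_mul 2
    · refine (ae_restrict_mem measurableSet_Ioi).mono fun y hy => ?_
      have : 0 < y := hτ.trans hy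
      positivity
  rw [hs, h5, ← mul_assoc, ← ENNReal.ofReal_mul (by positivity), mul_assoc, ← Real.rpow_add hτ]
  norm_num

end L2norm

/-! ### The heat kernel -/

/-- The polynomial factors of the Gaussian `exp (-u² / 4)` and of its first two derivatives. -/
noncomputable def gaussFactor : ℕ → ℝ → ℝ
  | 0, _ => 1
  | 1, u => -u / 2
  | _, u => u ^ 2 / 4 - 1 / 2

/-- The `j`-th derivative (`j ≤ 2`) of the convolution kernel of `exp (-y² (1 - ∂²))`. -/
noncomputable def heatKernel (j : ℕ) (y x : ℝ) : ℝ :=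
  Real.exp (-y ^ 2) * (√(4 * Real.pi))⁻¹ * y⁻¹ ^ (j + 1) * gaussFactor j (x / y) *
    Real.exp (-(x / y) ^ 2 / 4)

/-- The restriction `j ≤ 1` is necessary: `gaussFactor j` no longer changes for `j ≥ 2`, so only the
derivatives of order at most two are correct. -/
theorem hasDerivAt_gaussFactor_mul_exp {j : ℕ} (hj : j ≤ 1) (u : ℝ) :
    HasDerivAt (fun u => gaussFactor j u * Real.exp (-u ^ 2 / 4))
      (gaussFactor (j + 1) u * Real.exp (-u ^ 2 / 4)) u := by
  have h1 : HasDerivAt (fun u : ℝ => Real.exp (-u ^ 2 / 4))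
      (Real.exp (-u ^ 2 / 4) * (-(2 * u) / 4)) u := by
    have := (((hasDerivAt_pow 2 u).neg).div_const 4).exp
    simpa using this
  interval_cases j
  · simp only [gaussFactor, one_mul]
    exact h1.congr_deriv (by ring)
  · have h2 : HasDerivAt (fun u : ℝ => -u / 2) (-1 / 2) u := ((hasDerivAt_id u).neg).div_const 2
    simp only [gaussFactor]
    exact (h2.mul h1).congr_deriv (by ring)

theorem hasDerivAt_heatKernel {j : ℕ} (hj : j ≤ 1) (y x : ℝ) :
    HasDerivAt (heatKernel j y) (heatKernel (j + 1) y x) x := by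
  have h := (hasDerivAt_gaussFactor_mul_exp hj (x / y)).comp x ((hasDerivAt_id x).div_const y)
  have h2 := h.const_mul (Real.exp (-y ^ 2) * (√(4 * Real.pi))⁻¹ * y⁻¹ ^ (j + 1))
  have e : heatKernel j y = fun x => Real.exp (-y ^ 2) * (√(4 * Real.pi))⁻¹ * y⁻¹ ^ (j + 1) *
      ((fun u => gaussFactor j u * Real.exp (-u ^ 2 / 4)) ∘ fun x => id x / y) x := by
    ext z
    rw [heatKernel, Function.comp, id, ← mul_assoc]
  rw [e]
  refine h2.congr_deriv ?_
  rw [heatKernel]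
  ring

theorem measurable_heatKernel (j : ℕ) : Measurable fun p : ℝ × ℝ => heatKernel j p.1 p.2 := by
  have : Measurable (gaussFactor j) := by
    rcases j with _ | _ | j
    · exact measurable_const
    · exact (measurable_id.neg).div_const 2
    · exact ((measurable_id.pow_const 2).div_const 4).sub_const _
  unfold heatKernel
  fun_prop

theorem abs_gaussFactor_le (j : ℕ) (u : ℝ) : |gaussFactor j u| ≤ (1 + |u|) ^ 2 := by
  have h0 := abs_nonneg u
  have hs := sq_abs u
  rcases j with _ | _ | j <;> simp only [gaussFactor]
  · rw [abs_one]; nlinarith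
  · rw [abs_div, abs_neg, abs_two]; nlinarith
  · rw [abs_le]; constructor <;> nlinarith

/-- From `1 + u ≤ exp u` and completing the square in `m u ≤ m²/(4a) + a u²`. It absorbs polynomial
factors into a fraction of a Gaussian. -/
theorem one_add_pow_le_exp (m : ℕ) {a u : ℝ} (ha : 0 < a) (hu : 0 ≤ u) :
    (1 + u) ^ m ≤ Real.exp (m ^ 2 / (4 * a)) * Real.exp (a * u ^ 2) := by
  calc (1 + u) ^ m ≤ Real.exp u ^ m := by
        gcongr
        linarith [Real.add_one_le_exp u]
    _ = Real.exp (m * u) := by rw [← Real.exp_nat_mul]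
    _ ≤ Real.exp (m ^ 2 / (4 * a) + a * u ^ 2) := by
        gcongr
        have h : m ^ 2 / (4 * a) + a * u ^ 2 - m * u = (m - 2 * a * u) ^ 2 / (4 * a) := by
          field_simp
          ring
        have : 0 ≤ (m - 2 * a * u) ^ 2 / (4 * a) := by positivity
        linarith
    _ = _ := Real.exp_add _ _

theorem abs_heatKernel_le (j : ℕ) {y : ℝ} (hy : 0 < y) (x : ℝ) :
    |heatKernel j y x| ≤ Real.exp (-y ^ 2) * y⁻¹ ^ (j + 1) *
      ((1 + |x / y|) ^ 2 * Real.exp (-(x / y) ^ 2 / 4)) := by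
  have h4 : (√(4 * Real.pi))⁻¹ ≤ 1 := by
    apply inv_le_one_of_one_le₀
    rw [Real.one_le_sqrt]
    linarith [Real.pi_gt_three]
  have : |heatKernel j y x| = Real.exp (-y ^ 2) * (√(4 * Real.pi))⁻¹ * y⁻¹ ^ (j + 1) *
      |gaussFactor j (x / y)| * Real.exp (-(x / y) ^ 2 / 4) := by
    unfold heatKernel
    rw [abs_mul, abs_mul, Real.abs_exp, abs_of_nonneg (by positivity)]
  rw [this]
  calc _ ≤ Real.exp (-y ^ 2) * 1 * y⁻¹ ^ (j + 1) *
      (1 + |x / y|) ^ 2 * Real.exp (-(x / y) ^ 2 / 4) := by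
        gcongr
        exact abs_gaussFactor_le j _
    _ = _ := by ring

/-- In the variable `u = x / y` each factor `|x|` is worth one power of `y`. The growth is split as
`(1 + |x|)^N ≤ (1 + y)^N (1 + |u|)^N`: the first factor costs half of `exp(-y²)`, the second half of
`exp(-u²/4)`. -/
theorem lintegral_heatKernel_moment_le (N i : ℕ) : ∃ C : ℝ, 0 < C ∧ ∀ (j : ℕ) (y : ℝ), 0 < y →
    ∫⁻ x, ENNReal.ofReal (|heatKernel j y x| * (|x| ^ i * (1 + |x|) ^ N)) ≤
      ENNReal.ofReal (C * (y ^ i * y⁻¹ ^ j * Real.exp (-y ^ 2 / 2))) := by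
  set A : ℝ := Real.exp (N ^ 2 / (4 * (1 / 2)))
  set B : ℝ := Real.exp (((2 + i + N : ℕ) : ℝ) ^ 2 / (4 * (1 / 8)))
  refine ⟨A * B * √(8 * Real.pi), by positivity, fun j y hy => ?_⟩
  have key : ∀ x, |heatKernel j y x| * (|x| ^ i * (1 + |x|) ^ N) ≤
      A * B * (y ^ i * y⁻¹ ^ (j + 1)) * Real.exp (-y ^ 2 / 2) *
        Real.exp (-(1 / (8 * y ^ 2)) * x ^ 2) := by
    intro x
    obtain ⟨u, rfl⟩ : ∃ u, x = y * u := ⟨x / y, by field_simp⟩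
    have hK := abs_heatKernel_le j hy (y * u)
    rw [mul_div_cancel_left₀ _ hy.ne'] at hK
    have h0 := abs_nonneg u
    have h1 : (1 + |y * u|) ^ N ≤ (1 + y) ^ N * (1 + |u|) ^ N := by
      rw [abs_mul, abs_of_pos hy, ← mul_pow]
      gcongr
      nlinarith
    have h2 : |y * u| ^ i ≤ y ^ i * (1 + |u|) ^ i := by
      rw [abs_mul, abs_of_pos hy, ← mul_pow]
      gcongr
      linarith
    have hA := one_add_pow_le_exp N (a := 1 / 2) (by norm_num) hy.le
    have hB := one_add_pow_le_exp (2 + i + N) (a := 1 / 8) (by norm_num) h0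
    calc _ ≤ (Real.exp (-y ^ 2) * y⁻¹ ^ (j + 1) * ((1 + |u|) ^ 2 * Real.exp (-u ^ 2 / 4))) *
          ((y ^ i * (1 + |u|) ^ i) * ((1 + y) ^ N * (1 + |u|) ^ N)) := by gcongr
      _ = (y ^ i * y⁻¹ ^ (j + 1)) * (Real.exp (-y ^ 2) * (1 + y) ^ N) *
          ((1 + |u|) ^ (2 + i + N) * Real.exp (-u ^ 2 / 4)) := by rw [pow_add, pow_add]; ring
      _ ≤ (y ^ i * y⁻¹ ^ (j + 1)) * (Real.exp (-y ^ 2) * (A * Real.exp (1 / 2 * y ^ 2))) *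
          (B * Real.exp (1 / 8 * |u| ^ 2) * Real.exp (-u ^ 2 / 4)) := by gcongr
      _ = A * B * (y ^ i * y⁻¹ ^ (j + 1)) * (Real.exp (-y ^ 2) * Real.exp (1 / 2 * y ^ 2)) *
          (Real.exp (1 / 8 * |u| ^ 2) * Real.exp (-u ^ 2 / 4)) := by ring
      _ = _ := by
        have e1 : Real.exp (-y ^ 2) * Real.exp (1 / 2 * y ^ 2) = Real.exp (-y ^ 2 / 2) := by
          rw [← Real.exp_add]
          ring_nf
        have e2 : Real.exp (1 / 8 * |u| ^ 2) * Real.exp (-u ^ 2 / 4) =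
            Real.exp (-(1 / (8 * y ^ 2)) * (y * u) ^ 2) := by
          rw [← Real.exp_add, sq_abs]
          congr 1
          field_simp
          ring
        rw [e1, e2]
  calc _ ≤ ∫⁻ x, ENNReal.ofReal (A * B * (y ^ i * y⁻¹ ^ (j + 1)) * Real.exp (-y ^ 2 / 2) *
        Real.exp (-(1 / (8 * y ^ 2)) * x ^ 2)) :=
      lintegral_mono fun x => ENNReal.ofReal_le_ofReal (key x)
    _ = ENNReal.ofReal (A * B * √(8 * Real.pi) * (y ^ i * y⁻¹ ^ j * Real.exp (-y ^ 2 / 2))) := by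
      rw [← ofReal_integral_eq_lintegral_ofReal
        ((integrable_exp_neg_mul_sq (by positivity)).const_mul _)
        (Eventually.of_forall fun x => by positivity), integral_const_mul, integral_gaussian]
      congr 1
      have : √(Real.pi / (1 / (8 * y ^ 2))) = √(8 * Real.pi) * y := by
        rw [show Real.pi / (1 / (8 * y ^ 2)) = (8 * Real.pi) * y ^ 2 by field_simp,
          Real.sqrt_mul (by positivity), Real.sqrt_sq hy.le]
      rw [this, pow_succ]
      field_simp
    _ ≤ _ := le_rfl

section

/-! ### Fourier multipliers on the Schwartz space -/

open scoped FourierTransform LineDeriv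

/-- The Fourier multiplier with symbol `m`, acting on test functions. -/
noncomputable def symbolOp (m : ℝ → ℂ) : 𝓢(ℝ, ℂ) →L[ℂ] 𝓢(ℝ, ℂ) :=
  FourierTransform.fourierCLM ℂ 𝓢(ℝ, ℂ) ∘L SchwartzMap.smulLeftCLM ℂ m ∘L
    FourierTransform.fourierInvCLM ℂ 𝓢(ℝ, ℂ)

/-- The order `𝓕 ∘ m ∘ 𝓕⁻` is that of the transpose: a Fourier multiplier acts on a tempered
distribution through this operator on test functions. It is also why the derivative below has symbol
`-2πiξ`. -/
theorem symbolOp_apply (m : ℝ → ℂ) (φ : 𝓢(ℝ, ℂ)) :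
    symbolOp m φ = 𝓕 (SchwartzMap.smulLeftCLM ℂ m (𝓕⁻ φ)) := rfl

theorem symbolOp_apply_apply {m : ℝ → ℂ} (hm : m.HasTemperateGrowth) (φ : 𝓢(ℝ, ℂ)) (x : ℝ) :
    symbolOp m φ x = ∫ ξ, Complex.exp (((-2 * Real.pi * ξ * x : ℝ) : ℂ) * Complex.I) *
      (m ξ * 𝓕⁻ φ ξ) := by
  rw [symbolOp_apply, SchwartzMap.fourier_coe, Real.fourier_real_eq_integral_exp_smul]
  simp [hm]

theorem symbolOp_symbolOp {m₁ m₂ : ℝ → ℂ} (h₁ : m₁.HasTemperateGrowth)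
    (h₂ : m₂.HasTemperateGrowth) (φ : 𝓢(ℝ, ℂ)) :
    symbolOp m₁ (symbolOp m₂ φ) = symbolOp (m₁ * m₂) φ := by
  simp [symbolOp_apply, h₁, h₂]

theorem deriv_symbolOp {m : ℝ → ℂ} (hm : m.HasTemperateGrowth) (φ : 𝓢(ℝ, ℂ)) (x : ℝ) :
    deriv (symbolOp m φ) x = symbolOp (fun ξ => -(2 * Real.pi * Complex.I * ξ) * m ξ) φ x := by
  have h := SchwartzMap.lineDerivOp_fourier_eq (SchwartzMap.smulLeftCLM ℂ m (𝓕⁻ φ)) (1 : ℝ)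
  have h2 := DFunLike.congr_fun h x
  rw [SchwartzMap.lineDerivOp_apply_eq_fderiv, fderiv_apply_one_eq_deriv] at h2
  rw [symbolOp_apply, h2, symbolOp_apply]
  congr 2
  ext ξ
  have h3 : (fun ξ : ℝ => -(2 * Real.pi * Complex.I * ξ) * m ξ).HasTemperateGrowth := by fun_prop
  have h4 : (fun x : ℝ => inner ℝ x (1 : ℝ)).HasTemperateGrowth := by fun_prop
  change -(2 * Real.pi * Complex.I) • (SchwartzMap.smulLeftCLM ℂ (fun x : ℝ => inner ℝ x (1 : ℝ))
    (SchwartzMap.smulLeftCLM ℂ m (𝓕⁻ φ))) ξ = _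
  rw [SchwartzMap.smulLeftCLM_apply_apply h4, SchwartzMap.smulLeftCLM_apply_apply hm,
    SchwartzMap.smulLeftCLM_apply_apply h3]
  simp
  ring

theorem lintegral_enorm_sq_symbolOp {m : ℝ → ℂ} (hm : m.HasTemperateGrowth) (φ : 𝓢(ℝ, ℂ)) :
    ∫⁻ x, ‖symbolOp m φ x‖ₑ ^ 2 = ∫⁻ ξ, ‖m ξ * 𝓕⁻ φ ξ‖ₑ ^ 2 := by
  have hp : ∀ f : 𝓢(ℝ, ℂ), ∫⁻ x, ‖f x‖ₑ ^ 2 = ENNReal.ofReal (∫ x, ‖f x‖ ^ 2) := by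
    intro f
    have hi : Integrable fun x => ‖f x‖ ^ 2 := by
      simpa using (f.memLp 2).integrable_norm_pow (by norm_num)
    rw [ofReal_integral_eq_lintegral_ofReal hi (Eventually.of_forall fun x => by positivity)]
    refine lintegral_congr fun x => ?_
    rw [ENNReal.ofReal_pow (norm_nonneg _), ofReal_norm]
  rw [hp, symbolOp_apply, SchwartzMap.integral_norm_sq_fourier, ← hp]
  simp [hm]

theorem lintegral_enorm_sq_fourierInv (φ : 𝓢(ℝ, ℂ)) :
    ∫⁻ ξ, ‖𝓕⁻ φ ξ‖ₑ ^ 2 = ∫⁻ x, ‖φ x‖ₑ ^ 2 := by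
  have h := lintegral_enorm_sq_symbolOp (m := fun _ => 1) (by fun_prop) φ
  simpa [symbolOp_apply] using h.symm

/-- The symbol of `1 - ∂²`. -/
noncomputable def helmholtzSymbol (ξ : ℝ) : ℝ := 1 + (2 * Real.pi * ξ) ^ 2

theorem helmholtzSymbol_pos (ξ : ℝ) : 0 < helmholtzSymbol ξ := by
  unfold helmholtzSymbol; positivity

@[fun_prop]
theorem hasTemperateGrowth_helmholtzSymbol : helmholtzSymbol.HasTemperateGrowth := by
  unfold helmholtzSymbol; fun_prop

@[fun_prop]
theorem measurable_helmholtzSymbol : Measurable helmholtzSymbol := by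
  unfold helmholtzSymbol; fun_prop

/-- The symbol of `exp (-y² (1 - ∂²))`. -/
noncomputable def heatSymbol (y ξ : ℝ) : ℝ := Real.exp (-(y ^ 2 * helmholtzSymbol ξ))

-- The exponential is not of temperate growth on the line, but all its derivatives are bounded on
-- `(-∞, 1)`, an open set containing the nonpositive values of the exponent.
@[fun_prop]
theorem hasTemperateGrowth_heatSymbol (y : ℝ) : (heatSymbol y).HasTemperateGrowth := by
  have hexp : ∀ (n : ℕ), ∀ x ∈ Iio (1 : ℝ), ‖iteratedFDerivWithin ℝ n Real.exp (Iio 1) x‖ ≤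
      Real.exp 1 := by
    intro n x hx
    rw [iteratedFDerivWithin_of_isOpen n isOpen_Iio hx, norm_iteratedFDeriv_eq_norm_iteratedDeriv,
      iteratedDeriv_eq_iterate, Real.iter_deriv_exp, Real.norm_eq_abs, Real.abs_exp]
    exact Real.exp_le_exp.2 (le_of_lt hx)
  have h : heatSymbol y = Real.exp ∘ fun ξ => -(y ^ 2 * helmholtzSymbol ξ) := rfl
  rw [h]
  refine Function.HasTemperateGrowth.comp' (t := Iio 1) ?_ isOpen_Iio.uniqueDiffOn
    Real.contDiff_exp.contDiffOn (fun N => ⟨0, Real.exp 1, (Real.exp_pos 1).le, fun n _ x hx => ?_⟩)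
    (by fun_prop)
  · rintro _ ⟨ξ, rfl⟩
    have : 0 ≤ y ^ 2 * helmholtzSymbol ξ := mul_nonneg (sq_nonneg y) (helmholtzSymbol_pos ξ).le
    simp only [mem_Iio]
    linarith
  · simpa using hexp n x hx

theorem measurable_heatSymbol : Measurable fun p : ℝ × ℝ => heatSymbol p.1 p.2 := by
  unfold heatSymbol; fun_prop

/-- The symbol of the `j`-th derivative of `exp (-y² (1 - ∂²))`. -/
noncomputable def heatDerivSymbol (j : ℕ) (y ξ : ℝ) : ℂ :=
  (-(2 * Real.pi * Complex.I * ξ)) ^ j * heatSymbol y ξ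

@[fun_prop]
theorem hasTemperateGrowth_heatDerivSymbol (j : ℕ) (y : ℝ) :
    (heatDerivSymbol j y).HasTemperateGrowth := by
  unfold heatDerivSymbol
  fun_prop

/-- The `j`-th derivative of `exp (-y² (1 - ∂²)) φ`. -/
noncomputable def heatOp (j : ℕ) (y : ℝ) : 𝓢(ℝ, ℂ) →L[ℂ] 𝓢(ℝ, ℂ) := symbolOp (heatDerivSymbol j y)

theorem deriv_heatOp (j : ℕ) (y : ℝ) (φ : 𝓢(ℝ, ℂ)) (x : ℝ) :
    deriv (heatOp j y φ) x = heatOp (j + 1) y φ x := by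
  unfold heatOp
  have e : (fun ξ : ℝ => -(2 * Real.pi * Complex.I * ξ) * heatDerivSymbol j y ξ) =
      heatDerivSymbol (j + 1) y := by
    ext ξ
    rw [heatDerivSymbol, heatDerivSymbol, pow_succ]
    ring
  rw [deriv_symbolOp (by fun_prop), e]

theorem hasDerivAt_heatOp (j : ℕ) (y : ℝ) (φ : 𝓢(ℝ, ℂ)) (x : ℝ) :
    HasDerivAt (heatOp j y φ) (heatOp (j + 1) y φ x) x := by
  rw [← deriv_heatOp]
  exact (heatOp j y φ).differentiableAt.hasDerivAt

/-- This places the two derivatives of `1 - ∂²` on the heat flow, where they can be estimated and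
integrated by parts. -/
theorem heatOp_helmholtz (y : ℝ) (φ : 𝓢(ℝ, ℂ)) (x : ℝ) :
    heatOp 0 y (symbolOp (fun ξ => (helmholtzSymbol ξ : ℂ)) φ) x =
      heatOp 0 y φ x - heatOp 2 y φ x := by
  have h : symbolOp (heatDerivSymbol 0 y * fun ξ => (helmholtzSymbol ξ : ℂ)) φ =
      heatOp 0 y φ - heatOp 2 y φ := by
    unfold heatOp
    simp only [symbolOp_apply]
    rw [← FourierTransform.fourierCLM_apply (R := ℂ), ← FourierTransform.fourierCLM_apply (R := ℂ),
      ← FourierTransform.fourierCLM_apply (R := ℂ), ← map_sub]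
    congr 1
    ext ξ
    have h1 : (heatDerivSymbol 0 y * fun ξ => (helmholtzSymbol ξ : ℂ)).HasTemperateGrowth := by
      fun_prop
    rw [sub_apply, SchwartzMap.smulLeftCLM_apply_apply h1,
      SchwartzMap.smulLeftCLM_apply_apply (by fun_prop),
      SchwartzMap.smulLeftCLM_apply_apply (by fun_prop)]
    simp only [heatDerivSymbol, helmholtzSymbol, Pi.mul_apply, smul_eq_mul]
    push_cast
    linear_combination (4 * Real.pi ^ 2 * ξ ^ 2 * heatSymbol y ξ * 𝓕⁻ φ ξ) * Complex.I_sq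
  unfold heatOp
  rw [symbolOp_symbolOp (by fun_prop) (by fun_prop), h]
  rfl

/-- The Fourier transform is moved from `φ` onto the Gaussian symbol times a character, and the
transform of a Gaussian is explicit. -/
theorem heatOp_zero_eq_convolution {y : ℝ} (hy : 0 < y) (φ : 𝓢(ℝ, ℂ)) (x : ℝ) :
    heatOp 0 y φ x = ∫ z, heatKernel 0 y (x - z) * φ z := by
  have hg : Integrable fun ξ : ℝ => Complex.exp (((2 * Real.pi * ξ * x : ℝ) : ℂ) * Complex.I) *
      (heatSymbol y ξ : ℂ) := by
    refine Integrable.bdd_mul (c := 1) ?_ (by fun_prop) (Eventually.of_forall fun ξ => ?_)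
    · refine Integrable.ofReal ?_
      have h1 : Integrable fun ξ : ℝ => Real.exp (-y ^ 2) *
          Real.exp (-(4 * Real.pi ^ 2 * y ^ 2) * ξ ^ 2) :=
        (integrable_exp_neg_mul_sq (by positivity)).const_mul _
      refine h1.congr (Eventually.of_forall fun ξ => ?_)
      simp only [helmholtzSymbol]
      rw [← Real.exp_add]
      congr 1
      ring
    · rw [Complex.norm_exp_ofReal_mul_I]
  have h1 := VectorFourier.integral_fourierIntegral_smul_eq_flip (μ := volume) (ν := volume)
    (L := innerₗ ℝ) Real.continuous_fourierChar continuous_inner φ.integrable hg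
  have e1 : heatOp 0 y φ x = ∫ ξ, VectorFourier.fourierIntegral Real.fourierChar volume (innerₗ ℝ)
      φ ξ • (Complex.exp (((2 * Real.pi * ξ * x : ℝ) : ℂ) * Complex.I) * (heatSymbol y ξ : ℂ)) := by
    unfold heatOp
    rw [symbolOp_apply_apply (by fun_prop), ← integral_neg_eq_self]
    refine integral_congr_ae (Eventually.of_forall fun ξ => ?_)
    have h2 : 𝓕⁻ φ (-ξ) = VectorFourier.fourierIntegral Real.fourierChar volume (innerₗ ℝ) φ ξ := by
      rw [SchwartzMap.fourierInv_coe, Real.fourierInv_eq_fourier_neg, neg_neg]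
      rfl
    have h3 : heatSymbol y (-ξ) = heatSymbol y ξ := by simp [heatSymbol, helmholtzSymbol]
    simp only [h2, heatDerivSymbol, h3, pow_zero, one_mul, smul_eq_mul]
    rw [show -2 * Real.pi * -ξ * x = 2 * Real.pi * ξ * x by ring]
    ring
  rw [e1, h1]
  refine integral_congr_ae (Eventually.of_forall fun z => ?_)
  have hb : (0 : ℝ) < ((4 * Real.pi ^ 2 * y ^ 2 : ℝ) : ℂ).re := by
    rw [Complex.ofReal_re]; positivity
  have h4 := fourierIntegral_gaussian hb ((2 * Real.pi * (x - z) : ℝ) : ℂ)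
  have h5 : VectorFourier.fourierIntegral Real.fourierChar volume (innerₗ ℝ).flip
      (fun ξ : ℝ => Complex.exp (((2 * Real.pi * ξ * x : ℝ) : ℂ) * Complex.I) *
        (heatSymbol y ξ : ℂ)) z = (Real.exp (-y ^ 2) : ℂ) *
      ∫ ξ : ℝ, Complex.exp (Complex.I * ((2 * Real.pi * (x - z) : ℝ) : ℂ) * ξ) *
        Complex.exp (-((4 * Real.pi ^ 2 * y ^ 2 : ℝ) : ℂ) * ξ ^ 2) := by
    rw [VectorFourier.fourierIntegral, ← integral_const_mul]
    refine integral_congr_ae (Eventually.of_forall fun ξ => ?_)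
    simp only [Circle.smul_def, Real.fourierChar_apply, smul_eq_mul, heatSymbol, helmholtzSymbol]
    push_cast
    rw [← Complex.exp_add, ← Complex.exp_add, ← Complex.exp_add, ← Complex.exp_add]
    congr 1
    simp
    ring
  dsimp only
  rw [h5, h4, smul_eq_mul, mul_comm]
  congr 1
  have h6 : ((Real.pi : ℂ) / ((4 * Real.pi ^ 2 * y ^ 2 : ℝ) : ℂ)) ^ (1 / 2 : ℂ) =
      (((√(4 * Real.pi))⁻¹ * y⁻¹ : ℝ) : ℂ) := by
    have : (((√(4 * Real.pi))⁻¹ * y⁻¹ : ℝ) : ℂ) =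
        (((Real.pi / (4 * Real.pi ^ 2 * y ^ 2)) ^ (1 / 2 : ℝ) : ℝ) : ℂ) := by
      congr 1
      rw [← Real.sqrt_eq_rpow, show Real.pi / (4 * Real.pi ^ 2 * y ^ 2) =
        (4 * Real.pi)⁻¹ * (y⁻¹) ^ 2 by field_simp,
        Real.sqrt_mul (inv_nonneg.2 (by positivity)) (y⁻¹ ^ 2),
        Real.sqrt_inv, Real.sqrt_sq (by positivity)]
    rw [this, Complex.ofReal_cpow (by positivity)]
    push_cast
    rfl
  rw [h6]
  simp only [heatKernel, gaussFactor]
  rw [show -(((2 * Real.pi * (x - z) : ℝ) : ℂ)) ^ 2 / (4 * ((4 * Real.pi ^ 2 * y ^ 2 : ℝ) : ℂ)) =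
    ((-((x - z) / y) ^ 2 / 4 : ℝ) : ℂ) by
      have h7 : (Real.pi : ℂ) ≠ 0 := by exact_mod_cast Real.pi_ne_zero
      have h8 : (y : ℂ) ≠ 0 := by exact_mod_cast hy.ne'
      push_cast
      field_simp
      ring, ← Complex.ofReal_exp]
  push_cast
  ring

theorem abs_heatKernel_le_const (j : ℕ) {y : ℝ} (hy : 0 < y) (x : ℝ) :
    |heatKernel j y x| ≤ Real.exp (-y ^ 2) * y⁻¹ ^ (j + 1) * Real.exp 4 := by
  refine (abs_heatKernel_le j hy x).trans ?_
  gcongr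
  -- With `a = 1/4` the growth `exp(u²/4)` cancels the Gaussian exactly and the constant is
  -- `exp(2²/(4a)) = exp 4`.
  have h := one_add_pow_le_exp 2 (a := 1 / 4) (by norm_num) (abs_nonneg (x / y))
  calc _ ≤ (Real.exp (((2 : ℕ) : ℝ) ^ 2 / (4 * (1 / 4))) * Real.exp (1 / 4 * |x / y| ^ 2)) *
      Real.exp (-(x / y) ^ 2 / 4) := by gcongr
    _ = _ := by
      rw [← Real.exp_add, ← Real.exp_add, sq_abs]
      congr 1
      push_cast
      ring

/-- Differentiation under the integral sign, by induction on `j`. The kernel form is what allows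
comparison with a weight in `x`, which the symbol does not see. -/
theorem heatOp_eq_convolution {j : ℕ} (hj : j ≤ 2) {y : ℝ} (hy : 0 < y) (φ : 𝓢(ℝ, ℂ)) (x : ℝ) :
    heatOp j y φ x = ∫ z, heatKernel j y (x - z) * φ z := by
  induction j generalizing x with
  | zero => exact heatOp_zero_eq_convolution hy φ x
  | succ j ih =>
    have hm : ∀ j x, Measurable fun z => heatKernel j y (x - z) := by
      intro j x
      have h := (measurable_heatKernel j).comp (measurable_prodMk_left (x := y))
      exact h.comp (measurable_id.const_sub x)
    have hK : ∀ j x, AEStronglyMeasurable (fun z => (heatKernel j y (x - z) : ℂ) * φ z) := by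
      intro j x
      have h := Complex.measurable_ofReal.comp (hm j x)
      exact (h.mul φ.continuous.measurable).aestronglyMeasurable
    have hb : ∀ j x z, ‖(heatKernel j y (x - z) : ℂ) * φ z‖ ≤
        Real.exp (-y ^ 2) * y⁻¹ ^ (j + 1) * Real.exp 4 * ‖φ z‖ := by
      intro j x z
      rw [norm_mul, Complex.norm_real, Real.norm_eq_abs]
      gcongr
      exact abs_heatKernel_le_const j hy _
    have hi : ∀ j, Integrable fun z =>
        Real.exp (-y ^ 2) * y⁻¹ ^ (j + 1) * Real.exp 4 * ‖φ z‖ := fun j =>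
      φ.integrable.norm.const_mul _
    have hd : ∀ z x, HasDerivAt (fun x => (heatKernel j y (x - z) : ℂ) * φ z)
        ((heatKernel (j + 1) y (x - z) : ℂ) * φ z) x := by
      intro z x
      have h3 := (hasDerivAt_heatKernel (j := j) (by omega) y (x - z)).comp x
        ((hasDerivAt_id x).sub_const z)
      rw [mul_one] at h3
      exact h3.ofReal_comp.mul_const (φ z)
    have h1 := hasDerivAt_integral_of_dominated_loc_of_deriv_le (μ := volume) (x₀ := x)
      (F := fun x z => (heatKernel j y (x - z) : ℂ) * φ z)
      (F' := fun x z => (heatKernel (j + 1) y (x - z) : ℂ) * φ z)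
      (bound := fun z => Real.exp (-y ^ 2) * y⁻¹ ^ (j + 1 + 1) * Real.exp 4 * ‖φ z‖)
      (s := univ) univ_mem (Eventually.of_forall (hK j))
      ((hi j).mono' (hK j x) (Eventually.of_forall (hb j x))) (hK (j + 1) x)
      (Eventually.of_forall fun z x _ => hb (j + 1) x z) (hi (j + 1))
      (Eventually.of_forall fun z x _ => hd z x)
    have h2 : heatOp j y φ = fun x => ∫ z, (heatKernel j y (x - z) : ℂ) * φ z := by
      ext x
      exact ih (by omega) x
    rw [← deriv_heatOp, h2]
    exact h1.2.deriv

end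

section

/-! ### Weighted estimates for the heat flow -/

open scoped FourierTransform

/-- A smooth positive weight of polynomial type, slowly varying with constants `A` and `N`. -/
structure IsTemperedWeight (A : ℝ) (N : ℕ) (w : ℝ → ℝ) : Prop where
  pos : ∀ x, 0 < w x
  growth : w.HasTemperateGrowth
  growth_inv : (fun x => (w x)⁻¹).HasTemperateGrowth
  abs_sub_le : ∀ x z, |w z - w x| ≤ A * |x - z| * (1 + |x - z|) ^ N * w x

theorem lintegral_pow_mul_exp_neg_mul_sq (n : ℕ) {b : ℝ} (hb : 0 < b) :
    ∫⁻ y in Ioi (0 : ℝ), ENNReal.ofReal (y ^ n * Real.exp (-b * y ^ 2)) =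
      ENNReal.ofReal (b ^ (-((n : ℝ) + 1) / 2) * (1 / 2) * Real.Gamma (((n : ℝ) + 1) / 2)) := by
  have hn : (-1 : ℝ) < n := by linarith [n.cast_nonneg (α := ℝ)]
  have h := integral_rpow_mul_exp_neg_mul_rpow (p := 2) (q := n) two_pos hn hb
  have hi := integrableOn_rpow_mul_exp_neg_mul_rpow (p := 2) (s := n) hn (by norm_num) hb
  simp only [Real.rpow_natCast, Real.rpow_two] at h hi
  rw [← h, ofReal_integral_eq_lintegral_ofReal hi]
  refine (ae_restrict_mem measurableSet_Ioi).mono fun y hy => ?_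
  have : 0 < y := hy
  positivity

/-- With `a = (2πξ)²` and `λ = 1 + a`, the integral is `aʲ ∫ y^(2j-1) exp(-2λy²) dy = aʲ Γ(j) / (2
(2λ)ʲ)`, where `Γ(j) = 1` for `j = 1, 2` and `a ≤ λ`. The power `y^(2j-1)` is the scale-invariant
one. -/
theorem lintegral_pow_mul_enorm_sq_heatDerivSymbol_le {j : ℕ} (hj : 1 ≤ j) (hj' : j ≤ 2) (ξ : ℝ) :
    ∫⁻ y in Ioi (0 : ℝ), ENNReal.ofReal (y ^ (2 * j - 1)) * ‖heatDerivSymbol j y ξ‖ₑ ^ 2 ≤ 1 := by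
  have hl := helmholtzSymbol_pos ξ
  have h1 : ∀ y ∈ Ioi (0 : ℝ), ENNReal.ofReal (y ^ (2 * j - 1)) * ‖heatDerivSymbol j y ξ‖ₑ ^ 2 =
      ENNReal.ofReal (((2 * Real.pi * ξ) ^ 2) ^ j) *
        ENNReal.ofReal (y ^ (2 * j - 1) * Real.exp (-(2 * helmholtzSymbol ξ) * y ^ 2)) := by
    intro y hy
    have hy : 0 < y := hy
    have h2 : ‖heatDerivSymbol j y ξ‖ ^ 2 = ((2 * Real.pi * ξ) ^ 2) ^ j *
        Real.exp (-(2 * helmholtzSymbol ξ) * y ^ 2) := by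
      rw [heatDerivSymbol, norm_mul, norm_pow, norm_neg, mul_pow, ← pow_mul, mul_comm j, pow_mul]
      congr 2
      · simp [mul_pow]
      · rw [Complex.norm_real, heatSymbol, Real.norm_eq_abs, Real.abs_exp, ← Real.exp_nat_mul]
        congr 1
        push_cast
        ring
    rw [← ofReal_norm, ← ENNReal.ofReal_pow (norm_nonneg _), h2,
      ← ENNReal.ofReal_mul (by positivity), ← ENNReal.ofReal_mul (by positivity)]
    ring_nf
  rw [setLIntegral_congr_fun measurableSet_Ioi h1, lintegral_const_mul _ (by fun_prop),
    lintegral_pow_mul_exp_neg_mul_sq _ (by positivity), ← ENNReal.ofReal_mul (by positivity),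
    ← ENNReal.ofReal_one]
  apply ENNReal.ofReal_le_ofReal
  have hle : (2 * Real.pi * ξ) ^ 2 ≤ helmholtzSymbol ξ := by
    unfold helmholtzSymbol; linarith
  have e1 : (-(((2 * j - 1 : ℕ) : ℝ) + 1) / 2) = -(j : ℝ) := by
    rw [Nat.cast_sub (by omega)]; push_cast; ring
  have e2 : ((((2 * j - 1 : ℕ) : ℝ) + 1) / 2) = (j : ℝ) := by
    rw [Nat.cast_sub (by omega)]; push_cast; ring
  have e3 : Real.Gamma j = 1 := by interval_cases j <;> norm_num
  rw [e1, e2, e3, Real.rpow_neg (by positivity), Real.rpow_natCast, mul_one, ← mul_assoc,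
    ← div_eq_mul_inv, ← div_pow]
  have h3 : ((2 * Real.pi * ξ) ^ 2 / (2 * helmholtzSymbol ξ)) ^ j ≤ 1 := by
    apply pow_le_one₀ (by positivity)
    rw [div_le_one (by positivity)]
    linarith
  linarith

theorem measurable_heatDerivSymbol (j : ℕ) :
    Measurable fun p : ℝ × ℝ => heatDerivSymbol j p.1 p.2 := by
  unfold heatDerivSymbol
  have := measurable_heatSymbol
  fun_prop

/-- The unweighted square function bound: Plancherel at each `y`, then Tonelli and the bound at each
frequency. -/
theorem lintegral_pow_mul_l2norm_heatOp_sq_le {j : ℕ} (hj : 1 ≤ j) (hj' : j ≤ 2) (v : 𝓢(ℝ, ℂ)) :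
    ∫⁻ y in Ioi (0 : ℝ), ENNReal.ofReal (y ^ (2 * j - 1)) *
      l2norm volume (fun x => ‖heatOp j y v x‖ₑ) ^ 2 ≤ l2norm volume (fun x => ‖v x‖ₑ) ^ 2 := by
  have hv : Measurable fun ξ => ‖𝓕⁻ v ξ‖ₑ := (𝓕⁻ v).continuous.measurable.enorm
  have hs : Measurable fun p : ℝ × ℝ => ‖heatDerivSymbol j p.1 p.2‖ₑ :=
    (measurable_heatDerivSymbol j).enorm
  have h1 : ∀ y : ℝ, ENNReal.ofReal (y ^ (2 * j - 1)) *
      l2norm volume (fun x => ‖heatOp j y v x‖ₑ) ^ 2 =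
      ∫⁻ ξ, ENNReal.ofReal (y ^ (2 * j - 1)) * (‖heatDerivSymbol j y ξ‖ₑ ^ 2 * ‖𝓕⁻ v ξ‖ₑ ^ 2) := by
    intro y
    rw [l2norm_sq, heatOp, lintegral_enorm_sq_symbolOp (by fun_prop), lintegral_const_mul]
    · simp_rw [enorm_mul, mul_pow]
    · exact ((hs.comp measurable_prodMk_left).pow_const 2).mul (hv.pow_const 2)
  simp_rw [h1]
  rw [lintegral_lintegral_swap, l2norm_sq, ← lintegral_enorm_sq_fourierInv]
  · refine lintegral_mono fun ξ => ?_
    simp_rw [← mul_assoc]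
    rw [lintegral_mul_const]
    · exact mul_le_of_le_one_left (zero_le)
        (lintegral_pow_mul_enorm_sq_heatDerivSymbol_le hj hj' ξ)
    · exact (by fun_prop : Measurable fun y : ℝ => ENNReal.ofReal (y ^ (2 * j - 1))).mul
        ((hs.comp measurable_prodMk_right).pow_const 2)
  · refine Measurable.aemeasurable ?_
    exact (by fun_prop : Measurable fun p : ℝ × ℝ => ENNReal.ofReal (p.1 ^ (2 * j - 1))).mul
      ((hs.pow_const 2).mul ((hv.comp measurable_snd).pow_const 2))

theorem l2norm_heatOp_zero_le (y : ℝ) (v : 𝓢(ℝ, ℂ)) :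
    l2norm volume (fun x => ‖heatOp 0 y v x‖ₑ) ≤
      ENNReal.ofReal (Real.exp (-y ^ 2)) * l2norm volume (fun x => ‖v x‖ₑ) := by
  apply l2norm_le_of_sq_le
  rw [heatOp, lintegral_enorm_sq_symbolOp (by fun_prop), mul_pow, l2norm_sq,
    ← lintegral_enorm_sq_fourierInv, ← lintegral_const_mul]
  · refine lintegral_mono fun ξ => ?_
    dsimp only
    rw [enorm_mul, mul_pow]
    gcongr
    rw [← ofReal_norm]
    apply ENNReal.ofReal_le_ofReal
    simp only [heatDerivSymbol, heatSymbol, pow_zero, one_mul, Complex.norm_real, Real.norm_eq_abs,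
      Real.abs_exp]
    apply Real.exp_le_exp.2
    have : 1 ≤ helmholtzSymbol ξ := by
      unfold helmholtzSymbol; nlinarith [sq_nonneg (2 * Real.pi * ξ)]
    nlinarith [sq_nonneg y]
  · exact (𝓕⁻ v).continuous.measurable.enorm.pow_const 2

theorem measurable_heatKernel_right (j : ℕ) (y : ℝ) : Measurable (heatKernel j y) := by
  have h := (measurable_heatKernel j).comp (measurable_prodMk_left (x := y))
  have e : (fun p : ℝ × ℝ => heatKernel j p.1 p.2) ∘ Prod.mk y = heatKernel j y := by
    ext x
    simp only [Function.comp]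
  rwa [e] at h

theorem measurable_heatKernel_sub (j : ℕ) (y x : ℝ) :
    Measurable fun z => heatKernel j y (x - z) := by
  have h := (measurable_heatKernel_right j y).comp (measurable_id.const_sub x)
  exact h

theorem integrable_heatKernel_mul (j : ℕ) {y : ℝ} (hy : 0 < y) (x : ℝ) (φ : 𝓢(ℝ, ℂ)) :
    Integrable fun z => (heatKernel j y (x - z) : ℂ) * φ z := by
  refine φ.integrable.bdd_mul (c := Real.exp (-y ^ 2) * y⁻¹ ^ (j + 1) * Real.exp 4)
    (Complex.measurable_ofReal.comp (measurable_heatKernel_sub j y x)).aestronglyMeasurable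
    (Eventually.of_forall fun z => ?_)
  rw [Complex.norm_real, Real.norm_eq_abs]
  exact abs_heatKernel_le_const j hy _

namespace IsTemperedWeight

variable {A : ℝ} {N : ℕ} {w : ℝ → ℝ}

theorem growth_ofReal (hw : IsTemperedWeight A N w) :
    (fun x => (w x : ℂ)).HasTemperateGrowth := by
  have := hw.growth
  fun_prop

theorem growth_inv_ofReal (hw : IsTemperedWeight A N w) :
    (fun x => ((w x)⁻¹ : ℂ)).HasTemperateGrowth := by
  have := hw.growth_inv
  have h : (fun x => (((w x)⁻¹ : ℝ) : ℂ)).HasTemperateGrowth := by fun_prop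
  simpa using h

theorem continuous (hw : IsTemperedWeight A N w) : Continuous w := hw.growth.1.continuous

/-- Conjugating the convolution by `w` changes it by the kernel `K(x - z) w(x)⁻¹ (w(z) - w(x))`, and
slow variation of `w` bounds the quotient by `A |x - z| (1 + |x - z|)^N`. -/
theorem enorm_inv_mul_heatOp_le (hw : IsTemperedWeight A N w) {j : ℕ} (hj : j ≤ 2) {y : ℝ}
    (hy : 0 < y) (v : 𝓢(ℝ, ℂ)) (x : ℝ) :
    ‖((w x)⁻¹ : ℂ) * heatOp j y (SchwartzMap.smulLeftCLM ℂ (fun x => (w x : ℂ)) v) x‖ₑ ≤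
      ‖heatOp j y v x‖ₑ + ∫⁻ z, ENNReal.ofReal (A * (|heatKernel j y (x - z)| *
        (|x - z| ^ 1 * (1 + |x - z|) ^ N))) * ‖v z‖ₑ := by
  have hwx : (w x : ℂ) ≠ 0 := by exact_mod_cast (hw.pos x).ne'
  set ψ := SchwartzMap.smulLeftCLM ℂ (fun x => (w x : ℂ)) v
  have e : ((w x)⁻¹ : ℂ) * heatOp j y ψ x = heatOp j y v x +
      ∫ z, (((w x)⁻¹ : ℂ) * ((heatKernel j y (x - z) : ℂ) * ψ z) -
        (heatKernel j y (x - z) : ℂ) * v z) := by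
    rw [heatOp_eq_convolution hj hy, heatOp_eq_convolution hj hy,
      integral_sub ((integrable_heatKernel_mul j hy x ψ).const_mul _)
        (integrable_heatKernel_mul j hy x v), integral_const_mul]
    ring
  rw [e]
  refine (enorm_add_le _ _).trans ?_
  gcongr
  refine (enorm_integral_le_lintegral_enorm _).trans (lintegral_mono fun z => ?_)
  have hz : ((w x)⁻¹ : ℂ) * ((heatKernel j y (x - z) : ℂ) * ψ z) -
      (heatKernel j y (x - z) : ℂ) * v z =
      ((heatKernel j y (x - z) * ((w x)⁻¹ * (w z - w x)) : ℝ) : ℂ) * v z := by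
    simp only [ψ, SchwartzMap.smulLeftCLM_apply_apply hw.growth_ofReal, smul_eq_mul]
    push_cast
    field_simp
  dsimp only
  rw [hz, enorm_mul]
  gcongr
  rw [← ofReal_norm, Complex.norm_real, Real.norm_eq_abs, abs_mul, abs_mul,
    abs_of_pos (inv_pos.2 (hw.pos x))]
  apply ENNReal.ofReal_le_ofReal
  have h1 := hw.abs_sub_le x z
  calc _ ≤ |heatKernel j y (x - z)| * ((w x)⁻¹ * (A * |x - z| * (1 + |x - z|) ^ N * w x)) := by
        have := (inv_pos.2 (hw.pos x)).le
        gcongr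
    _ = _ := by
        have := (hw.pos x).ne'
        field_simp

end IsTemperedWeight

/-- Young's inequality for the commutator kernel. Its first moment is of size `y · y⁻ʲ`, one power
of `y` better than the `L¹` norm of the kernel itself. -/
theorem exists_l2norm_inv_mul_heatOp_le {A : ℝ} (hA : 0 ≤ A) (N : ℕ) : ∃ C : ℝ, 0 < C ∧
    ∀ w : ℝ → ℝ, IsTemperedWeight A N w → ∀ j ≤ 2, ∀ y : ℝ, 0 < y → ∀ v : 𝓢(ℝ, ℂ),
    l2norm volume (fun x => ‖((w x)⁻¹ : ℂ) *
        heatOp j y (SchwartzMap.smulLeftCLM ℂ (fun x => (w x : ℂ)) v) x‖ₑ) ≤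
      l2norm volume (fun x => ‖heatOp j y v x‖ₑ) +
        ENNReal.ofReal (C * (y * y⁻¹ ^ j * Real.exp (-y ^ 2 / 2))) *
          l2norm volume (fun x => ‖v x‖ₑ) := by
  obtain ⟨C, hC0, hC⟩ := lintegral_heatKernel_moment_le N 1
  refine ⟨(A + 1) * C, by positivity, fun w hw j hj y hy v => ?_⟩
  have hK := measurable_heatKernel_right j y
  have hv : Measurable fun x => ‖v x‖ₑ := v.continuous.measurable.enorm
  set K : ℝ → ℝ≥0∞ := fun x =>
    ENNReal.ofReal (A * (|heatKernel j y x| * (|x| ^ 1 * (1 + |x|) ^ N)))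
  have hKm : Measurable K := by fun_prop
  refine (l2norm_mono_ae (Eventually.of_forall fun x =>
    hw.enorm_inv_mul_heatOp_le hj hy v x)).trans ?_
  refine (l2norm_add_le (heatOp j y v).continuous.measurable.enorm.aemeasurable ?_).trans ?_
  · refine Measurable.aemeasurable ?_
    exact Measurable.lintegral_prod_right'
      (f := fun p : ℝ × ℝ => K (p.1 - p.2) * ‖v p.2‖ₑ)
      ((hKm.comp (measurable_fst.sub measurable_snd)).mul (hv.comp measurable_snd))
  gcongr
  refine (l2norm_convolution_le hKm hv).trans ?_
  gcongr
  have : ∀ x, K x = ENNReal.ofReal A *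
      ENNReal.ofReal (|heatKernel j y x| * (|x| ^ 1 * (1 + |x|) ^ N)) := fun x =>
    ENNReal.ofReal_mul hA
  simp_rw [this]
  rw [lintegral_const_mul _ (by fun_prop)]
  calc _ ≤ ENNReal.ofReal A * ENNReal.ofReal (C * (y ^ 1 * y⁻¹ ^ j * Real.exp (-y ^ 2 / 2))) := by
        gcongr
        exact hC j y hy
    _ ≤ _ := by
        rw [← ENNReal.ofReal_mul hA]
        apply ENNReal.ofReal_le_ofReal
        rw [pow_one, ← mul_assoc]
        gcongr
        linarith

end

/-! ### Weighted bounds for the heat flow integrated in the height `y`. -/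

section

open scoped FourierTransform

/-- Joint measurability in `(y, x)` is read off from the Fourier integral, whose integrand is
jointly measurable. -/
theorem measurable_heatOp (j : ℕ) (ψ : 𝓢(ℝ, ℂ)) :
    Measurable fun p : ℝ × ℝ => heatOp j p.1 ψ p.2 := by
  have e : (fun p : ℝ × ℝ => heatOp j p.1 ψ p.2) = fun p : ℝ × ℝ =>
      ∫ ξ, Complex.exp (((-2 * Real.pi * ξ * p.2 : ℝ) : ℂ) * Complex.I) *
        (heatDerivSymbol j p.1 ξ * 𝓕⁻ ψ ξ) := by
    ext p
    rw [heatOp, symbolOp_apply_apply (by fun_prop)]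
  rw [e]
  refine StronglyMeasurable.measurable ?_
  refine StronglyMeasurable.integral_prod_right'
    (f := fun q : (ℝ × ℝ) × ℝ => Complex.exp (((-2 * Real.pi * q.2 * q.1.2 : ℝ) : ℂ) * Complex.I) *
        (heatDerivSymbol j q.1.1 q.2 * 𝓕⁻ ψ q.2)) (Measurable.stronglyMeasurable ?_)
  have h1 : Measurable fun q : (ℝ × ℝ) × ℝ => heatDerivSymbol j q.1.1 q.2 := by
    have h0 : Measurable fun q : (ℝ × ℝ) × ℝ => (q.1.1, q.2) := by fun_prop
    have h := (measurable_heatDerivSymbol j).comp h0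
    exact h
  have h2 : Measurable fun q : (ℝ × ℝ) × ℝ => 𝓕⁻ ψ q.2 :=
    (𝓕⁻ ψ).continuous.measurable.comp measurable_snd
  exact (by fun_prop : Measurable fun q : (ℝ × ℝ) × ℝ =>
    Complex.exp (((-2 * Real.pi * q.2 * q.1.2 : ℝ) : ℂ) * Complex.I)).mul (h1.mul h2)

/-- The norm of `∂ʲ exp (-y² (1 - ∂²)) ψ` in `L²` with weight `w⁻¹`. -/
noncomputable def heatNorm (w : ℝ → ℝ) (j : ℕ) (ψ : 𝓢(ℝ, ℂ)) (y : ℝ) : ℝ≥0∞ :=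
  l2norm volume fun x => ‖((w x)⁻¹ : ℂ) * heatOp j y ψ x‖ₑ

theorem IsTemperedWeight.measurable_heatNorm {A : ℝ} {N : ℕ} {w : ℝ → ℝ}
    (hw : IsTemperedWeight A N w) (j : ℕ) (ψ : 𝓢(ℝ, ℂ)) : Measurable (heatNorm w j ψ) := by
  unfold heatNorm l2norm
  refine Measurable.pow_const ?_ _
  refine Measurable.lintegral_prod_right'
    (f := fun p : ℝ × ℝ => ‖((w p.2)⁻¹ : ℂ) * heatOp j p.1 ψ p.2‖ₑ ^ 2) ?_
  have h1 : Measurable fun p : ℝ × ℝ => ((w p.2)⁻¹ : ℂ) :=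
    (Complex.measurable_ofReal.comp (hw.continuous.measurable.comp measurable_snd)).inv
  exact (h1.mul (measurable_heatOp j ψ)).enorm.pow_const 2

theorem ENNReal.add_sq_le_four_mul (a b : ℝ≥0∞) : (a + b) ^ 2 ≤ 4 * (a ^ 2 + b ^ 2) := by
  have h : ∀ a b : ℝ≥0∞, a ≤ b → (a + b) ^ 2 ≤ 4 * (a ^ 2 + b ^ 2) := by
    intro a b hab
    calc (a + b) ^ 2 ≤ (b + b) ^ 2 := by gcongr
      _ = 4 * b ^ 2 := by ring
      _ ≤ _ := by gcongr; exact le_add_self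
  rcases le_total a b with hab | hab
  · exact h a b hab
  · rw [add_comm a b, add_comm (a ^ 2)]
    exact h b a hab

/-- For `j = 0` no cancellation is needed: the norm is at most `(exp(-y²) + C y exp(-y²/2)) ‖v‖`,
because the symbol of `1 - ∂²` is at least `1`. This handles the lower order term and gives the
absolute convergence behind the exchange of integrals. -/
theorem exists_lintegral_heatNorm_zero_le {A : ℝ} (hA : 0 ≤ A) (N : ℕ) : ∃ C : ℝ, 0 < C ∧
    ∀ w : ℝ → ℝ, IsTemperedWeight A N w → ∀ v : 𝓢(ℝ, ℂ),
    ∫⁻ y in Ioi (0 : ℝ), ENNReal.ofReal (y ^ (1 / 2 : ℝ)) *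
        heatNorm w 0 (SchwartzMap.smulLeftCLM ℂ (fun x => (w x : ℂ)) v) y ≤
      ENNReal.ofReal C * l2norm volume (fun x => ‖v x‖ₑ) := by
  obtain ⟨C, hC0, hC⟩ := exists_l2norm_inv_mul_heatOp_le hA N
  have h12 : (0 : ℝ) < 1 / 2 := by norm_num
  refine ⟨2 * (1 + C) * ((1 / 2) ^ (-(((0 : ℕ) : ℝ) + 1) / 2) * (1 / 2) *
      Real.Gamma ((((0 : ℕ) : ℝ) + 1) / 2) + (1 / 2) ^ (-(((2 : ℕ) : ℝ) + 1) / 2) * (1 / 2) *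
      Real.Gamma ((((2 : ℕ) : ℝ) + 1) / 2)), ?_, fun w hw v => ?_⟩
  · have := Real.Gamma_pos_of_pos (s := (((0 : ℕ) : ℝ) + 1) / 2) (by positivity)
    have := Real.Gamma_pos_of_pos (s := (((2 : ℕ) : ℝ) + 1) / 2) (by positivity)
    positivity
  set V := l2norm volume (fun x => ‖v x‖ₑ)
  have key : ∀ y ∈ Ioi (0 : ℝ), ENNReal.ofReal (y ^ (1 / 2 : ℝ)) *
        heatNorm w 0 (SchwartzMap.smulLeftCLM ℂ (fun x => (w x : ℂ)) v) y ≤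
      ENNReal.ofReal (2 * (1 + C)) * (ENNReal.ofReal (y ^ 0 * Real.exp (-(1 / 2) * y ^ 2)) +
        ENNReal.ofReal (y ^ 2 * Real.exp (-(1 / 2) * y ^ 2))) * V := by
    intro y hy
    have hy : 0 < y := hy
    have h1 : heatNorm w 0 (SchwartzMap.smulLeftCLM ℂ (fun x => (w x : ℂ)) v) y ≤
        (ENNReal.ofReal (Real.exp (-y ^ 2)) +
          ENNReal.ofReal (C * (y * y⁻¹ ^ 0 * Real.exp (-y ^ 2 / 2)))) * V := by
      rw [add_mul]
      exact (hC w hw 0 (by norm_num) y hy v).trans (by gcongr; exact l2norm_heatOp_zero_le y v)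
    refine (mul_le_mul_right h1 _).trans ?_
    rw [← mul_assoc]
    refine mul_le_mul' ?_ le_rfl
    rw [← ENNReal.ofReal_add (by positivity) (by positivity),
      ← ENNReal.ofReal_add (by positivity) (by positivity), ← ENNReal.ofReal_mul (by positivity),
      ← ENNReal.ofReal_mul (by positivity)]
    apply ENNReal.ofReal_le_ofReal
    have h2 : y ^ (1 / 2 : ℝ) ≤ 1 + y := by
      rw [← Real.sqrt_eq_rpow, Real.sqrt_le_left (by positivity)]
      nlinarith
    have h3 : Real.exp (-y ^ 2) ≤ Real.exp (-(1 / 2) * y ^ 2) :=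
      Real.exp_le_exp.2 (by nlinarith [sq_nonneg y])
    have h4 : Real.exp (-y ^ 2 / 2) = Real.exp (-(1 / 2) * y ^ 2) := by congr 1; ring
    rw [h4, pow_zero, mul_one, pow_zero, one_mul]
    set E := Real.exp (-(1 / 2) * y ^ 2)
    have hE : 0 < E := Real.exp_pos _
    calc _ ≤ (1 + y) * (E + C * (y * E)) := by gcongr
      _ = ((1 + y) * (1 + C * y)) * E := by ring
      _ ≤ (2 * (1 + C) * (1 + y ^ 2)) * E := by
        refine mul_le_mul_of_nonneg_right ?_ hE.le
        have : 0 ≤ C * (1 - y) ^ 2 := by positivity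
        have : 0 ≤ C * y ^ 2 := by positivity
        nlinarith [sq_nonneg (1 - y)]
      _ = _ := by ring
  refine (setLIntegral_mono' measurableSet_Ioi key).trans ?_
  rw [lintegral_mul_const _ (by fun_prop), lintegral_const_mul _ (by fun_prop),
    lintegral_add_left (by fun_prop), lintegral_pow_mul_exp_neg_mul_sq 0 h12,
    lintegral_pow_mul_exp_neg_mul_sq 2 h12, ← ENNReal.ofReal_add, ← ENNReal.ofReal_mul]
  · positivity
  · have := Real.Gamma_pos_of_pos (s := (((0 : ℕ) : ℝ) + 1) / 2) (by positivity)
    positivity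
  · have := Real.Gamma_pos_of_pos (s := (((2 : ℕ) : ℝ) + 1) / 2) (by positivity)
    positivity

/-- The weighted square function bound. The commutator adds `y^(2j-1) (y · y⁻ʲ exp(-y²/2))² = y
exp(-y²)`, which is integrable at `0` only thanks to the gain of one power of `y`. -/
theorem exists_lintegral_heatNorm_sq_le {A : ℝ} (hA : 0 ≤ A) (N : ℕ) : ∃ C : ℝ, 0 < C ∧
    ∀ w : ℝ → ℝ, IsTemperedWeight A N w → ∀ j, 1 ≤ j → j ≤ 2 → ∀ v : 𝓢(ℝ, ℂ),
    ∫⁻ y in Ioi (0 : ℝ), ENNReal.ofReal (y ^ (2 * j - 1)) *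
        heatNorm w j (SchwartzMap.smulLeftCLM ℂ (fun x => (w x : ℂ)) v) y ^ 2 ≤
      ENNReal.ofReal C ^ 2 * l2norm volume (fun x => ‖v x‖ₑ) ^ 2 := by
  obtain ⟨C, hC0, hC⟩ := exists_l2norm_inv_mul_heatOp_le hA N
  refine ⟨2 * (1 + C), by positivity, fun w hw j hj hj' v => ?_⟩
  set V := l2norm volume (fun x => ‖v x‖ₑ)
  have key : ∀ y ∈ Ioi (0 : ℝ), ENNReal.ofReal (y ^ (2 * j - 1)) *
        heatNorm w j (SchwartzMap.smulLeftCLM ℂ (fun x => (w x : ℂ)) v) y ^ 2 ≤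
      4 * (ENNReal.ofReal (y ^ (2 * j - 1)) * l2norm volume (fun x => ‖heatOp j y v x‖ₑ) ^ 2 +
        ENNReal.ofReal (C ^ 2) * ENNReal.ofReal (y ^ 1 * Real.exp (-1 * y ^ 2)) * V ^ 2) := by
    intro y hy
    have hy : 0 < y := hy
    have h2 : ENNReal.ofReal (y ^ (2 * j - 1)) *
        ENNReal.ofReal (C * (y * y⁻¹ ^ j * Real.exp (-y ^ 2 / 2))) ^ 2 =
        ENNReal.ofReal (C ^ 2) * ENNReal.ofReal (y ^ 1 * Real.exp (-1 * y ^ 2)) := by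
      rw [← ENNReal.ofReal_pow (by positivity), ← ENNReal.ofReal_mul (by positivity),
        ← ENNReal.ofReal_mul (by positivity)]
      congr 1
      have h3 : Real.exp (-1 * y ^ 2) = Real.exp (-y ^ 2 / 2) ^ 2 := by
        rw [← Real.exp_nat_mul]; congr 1; push_cast; ring
      rw [h3]
      interval_cases j
      · field_simp
        norm_num
      · field_simp
    calc _ ≤ ENNReal.ofReal (y ^ (2 * j - 1)) *
          (4 * (l2norm volume (fun x => ‖heatOp j y v x‖ₑ) ^ 2 +
            (ENNReal.ofReal (C * (y * y⁻¹ ^ j * Real.exp (-y ^ 2 / 2))) * V) ^ 2)) := by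
          gcongr
          refine le_trans ?_ (ENNReal.add_sq_le_four_mul _ _)
          gcongr
          exact hC w hw j hj' y hy v
      _ = _ := by
        rw [← h2]
        ring
  refine (setLIntegral_mono' measurableSet_Ioi key).trans ?_
  rw [lintegral_const_mul' _ _ (by norm_num), lintegral_add_right _ (by fun_prop),
    lintegral_mul_const _ (by fun_prop), lintegral_const_mul _ (by fun_prop),
    lintegral_pow_mul_exp_neg_mul_sq 1 one_pos]
  calc _ ≤ 4 * (V ^ 2 + ENNReal.ofReal (C ^ 2) * 1 * V ^ 2) := by
        gcongr
        · exact lintegral_pow_mul_l2norm_heatOp_sq_le hj hj' v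
        · rw [← ENNReal.ofReal_one]
          apply ENNReal.ofReal_le_ofReal
          norm_num
    _ = ENNReal.ofReal (4 * (1 + C ^ 2)) * V ^ 2 := by
        rw [ENNReal.ofReal_mul (by norm_num), ENNReal.ofReal_add (by norm_num) (by positivity)]
        simp
        ring
    _ ≤ _ := by
        rw [← ENNReal.ofReal_pow (by positivity)]
        gcongr
        nlinarith

/-! ### The subordination formula for `(1 - ∂²)^(1/4)`. -/

/-- The symbol of `(1 - ∂²)^(1/4)`. -/
noncomputable def quarterSymbol (ξ : ℝ) : ℝ := helmholtzSymbol ξ ^ (1 / 2 / 2 : ℝ)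

@[fun_prop]
theorem hasTemperateGrowth_quarterSymbol : quarterSymbol.HasTemperateGrowth := by
  have h := Function.hasTemperateGrowth_one_add_norm_sq_rpow ℝ (1 / 2 / 2)
  have h2 : (fun ξ : ℝ => 2 * Real.pi * ξ).HasTemperateGrowth := by fun_prop
  have h3 := h.comp h2
  have e : quarterSymbol = (fun x : ℝ => (1 + ‖x‖ ^ 2) ^ (1 / 2 / 2 : ℝ)) ∘
      fun ξ => 2 * Real.pi * ξ := by
    ext ξ
    simp only [quarterSymbol, helmholtzSymbol, Function.comp, Real.norm_eq_abs, sq_abs]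
  rwa [e]

/-- The exponent `1/2` of `y` is chosen so that the result, multiplied by the symbol of `1 - ∂²`,
has the power `1 - 3/4 = 1/4`. -/
theorem integral_rpow_mul_heatSymbol (ξ : ℝ) :
    ∫ y in Ioi (0 : ℝ), y ^ (1 / 2 : ℝ) * heatSymbol y ξ =
      (Real.Gamma (3 / 4) / 2) * helmholtzSymbol ξ ^ (-(3 / 4) : ℝ) := by
  have h := integral_rpow_mul_exp_neg_mul_rpow (p := 2) (q := 1 / 2) two_pos (by norm_num)
    (helmholtzSymbol_pos ξ)
  simp only [Real.rpow_two] at h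
  simp only [heatSymbol]
  convert h using 1
  · congr 1
    ext y
    ring_nf
  · norm_num
    ring

theorem integrableOn_rpow_mul_heatSymbol (ξ : ℝ) :
    IntegrableOn (fun y => y ^ (1 / 2 : ℝ) * heatSymbol y ξ) (Ioi (0 : ℝ)) := by
  have h := integrableOn_rpow_mul_exp_neg_mul_rpow (p := 2) (s := 1 / 2) (by norm_num)
    (by norm_num) (helmholtzSymbol_pos ξ)
  simp only [Real.rpow_two] at h
  simp only [heatSymbol]
  convert h using 3
  ring_nf

/-- The identity holds frequency by frequency; Fubini exchanges the integrals in `ξ` and `y`. -/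
theorem symbolOp_quarterSymbol_eq (ψ : 𝓢(ℝ, ℂ)) (x : ℝ) :
    ((Real.Gamma (3 / 4) / 2 : ℝ) : ℂ) * symbolOp (fun ξ => (quarterSymbol ξ : ℂ)) ψ x =
      ∫ y in Ioi (0 : ℝ), ((y ^ (1 / 2 : ℝ) : ℝ) : ℂ) *
        heatOp 0 y (symbolOp (fun ξ => (helmholtzSymbol ξ : ℂ)) ψ) x := by
  set c : ℝ := Real.Gamma (3 / 4) / 2
  have hc : 0 < c := by
    have := Real.Gamma_pos_of_pos (s := 3 / 4) (by norm_num)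
    positivity
  have hquarter : ∀ ξ, c * quarterSymbol ξ =
      (∫ y in Ioi (0 : ℝ), y ^ (1 / 2 : ℝ) * heatSymbol y ξ) * helmholtzSymbol ξ := by
    intro ξ
    have := helmholtzSymbol_pos ξ
    rw [integral_rpow_mul_heatSymbol, quarterSymbol, mul_assoc]
    congr 1
    nth_rewrite 3 [← Real.rpow_one (helmholtzSymbol ξ)]
    rw [← Real.rpow_add this]
    norm_num
  set e : ℝ → ℂ := fun ξ => Complex.exp (((-2 * Real.pi * ξ * x : ℝ) : ℂ) * Complex.I)
  have he : ∀ ξ, ‖e ξ‖ = 1 := fun ξ => Complex.norm_exp_ofReal_mul_I _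
  set F : ℝ → ℝ → ℂ := fun ξ y => ((y ^ (1 / 2 : ℝ) * heatSymbol y ξ : ℝ) : ℂ) *
    (e ξ * (helmholtzSymbol ξ * 𝓕⁻ ψ ξ))
  -- The `y`-integral of `‖F‖` is `c` times the norm of `quarterSymbol · 𝓕⁻ ψ`, a Schwartz function
  -- of `ξ`.
  have hF : Integrable (Function.uncurry F) (volume.prod (volume.restrict (Ioi 0))) := by
    have hmeas : AEStronglyMeasurable (Function.uncurry F)
        (volume.prod (volume.restrict (Ioi 0))) := by
      refine Measurable.aestronglyMeasurable ?_
      have h1 : Measurable fun p : ℝ × ℝ => heatSymbol p.2 p.1 :=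
        measurable_heatSymbol.comp measurable_swap
      have h2 : Measurable fun p : ℝ × ℝ => 𝓕⁻ ψ p.1 :=
        (𝓕⁻ ψ).continuous.measurable.comp measurable_fst
      have h3 : Measurable fun p : ℝ × ℝ => e p.1 := by fun_prop
      have h4 : Measurable fun p : ℝ × ℝ => (helmholtzSymbol p.1 : ℂ) := by fun_prop
      have h5 : Measurable fun p : ℝ × ℝ => p.2 ^ (1 / 2 : ℝ) * heatSymbol p.2 p.1 :=
        (by fun_prop : Measurable fun p : ℝ × ℝ => p.2 ^ (1 / 2 : ℝ)).mul h1
      exact (Complex.measurable_ofReal.comp h5).mul (h3.mul (h4.mul h2))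
    rw [integrable_prod_iff hmeas]
    refine ⟨Eventually.of_forall fun ξ => ?_, ?_⟩
    · have h8 : Integrable (fun y => ((y ^ (1 / 2 : ℝ) * heatSymbol y ξ : ℝ) : ℂ))
          (volume.restrict (Ioi 0)) := (integrableOn_rpow_mul_heatSymbol ξ).ofReal
      exact h8.mul_const (e ξ * (helmholtzSymbol ξ * 𝓕⁻ ψ ξ))
    · have h6 : Integrable fun ξ => c * ‖SchwartzMap.smulLeftCLM ℂ (fun ξ => (quarterSymbol ξ : ℂ))
          (𝓕⁻ ψ) ξ‖ := (SchwartzMap.integrable (μ := volume) (SchwartzMap.smulLeftCLM ℂ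
            (fun ξ => (quarterSymbol ξ : ℂ)) (𝓕⁻ ψ))).norm.const_mul c
      refine h6.congr (Eventually.of_forall fun ξ => ?_)
      have hq : (fun ξ => (quarterSymbol ξ : ℂ)).HasTemperateGrowth := by fun_prop
      have hq0 : 0 ≤ quarterSymbol ξ := Real.rpow_nonneg (helmholtzSymbol_pos ξ).le _
      dsimp only
      rw [SchwartzMap.smulLeftCLM_apply_apply hq, norm_smul, Complex.norm_real, Real.norm_eq_abs,
        abs_of_nonneg hq0, ← mul_assoc, hquarter, mul_assoc, ← integral_mul_const]
      refine setIntegral_congr_fun measurableSet_Ioi fun y hy => ?_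
      have hy : 0 < y := hy
      simp only [Function.uncurry, F, norm_mul, he, Complex.norm_real, Real.norm_eq_abs]
      rw [abs_of_pos (helmholtzSymbol_pos ξ), abs_of_pos (Real.rpow_pos_of_pos hy _),
        abs_of_pos (a := heatSymbol y ξ) (Real.exp_pos _)]
      ring
  calc _ = ∫ ξ, ∫ y in Ioi (0 : ℝ), F ξ y := by
        rw [symbolOp_apply_apply (by fun_prop), ← integral_const_mul]
        refine integral_congr_ae (Eventually.of_forall fun ξ => ?_)
        have h7 : ((c * quarterSymbol ξ : ℝ) : ℂ) = (((∫ y in Ioi (0 : ℝ), y ^ (1 / 2 : ℝ) *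
            heatSymbol y ξ) * helmholtzSymbol ξ : ℝ) : ℂ) := by rw [hquarter]
        rw [Complex.ofReal_mul, Complex.ofReal_mul, ← integral_complex_ofReal] at h7
        simp only [F]
        rw [integral_mul_const]
        change (c : ℂ) * (e ξ * _) = _
        linear_combination (e ξ * 𝓕⁻ ψ ξ) * h7
    _ = ∫ y in Ioi (0 : ℝ), ∫ ξ, F ξ y := integral_integral_swap hF
    _ = _ := by
        refine setIntegral_congr_fun measurableSet_Ioi fun y hy => ?_
        rw [heatOp, symbolOp_symbolOp (by fun_prop) (by fun_prop),
          symbolOp_apply_apply (by fun_prop), ← integral_const_mul]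
        refine integral_congr_ae (Eventually.of_forall fun ξ => ?_)
        simp only [F, e, heatDerivSymbol, Pi.mul_apply]
        push_cast
        ring

end

/-! ### The trace estimate in dual form. -/

section

open scoped FourierTransform

namespace IsTemperedWeight

variable {A : ℝ} {N : ℕ} {w : ℝ → ℝ}

theorem smulLeftCLM_smulLeftCLM_inv (hw : IsTemperedWeight A N w) (ψ : 𝓢(ℝ, ℂ)) :
    SchwartzMap.smulLeftCLM ℂ (fun x => (w x : ℂ))
      (SchwartzMap.smulLeftCLM ℂ (fun x => ((w x)⁻¹ : ℂ)) ψ) = ψ := by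
  ext x
  have : (w x : ℂ) ≠ 0 := by exact_mod_cast (hw.pos x).ne'
  rw [SchwartzMap.smulLeftCLM_apply_apply hw.growth_ofReal,
    SchwartzMap.smulLeftCLM_apply_apply hw.growth_inv_ofReal]
  simp [this]

theorem lintegral_enorm_mul_le (hw : IsTemperedWeight A N w) {F : ℝ → ℝ} (hF : Measurable F)
    {φ : ℝ → ℂ} (hφ : Measurable φ) :
    ∫⁻ x, ‖F x‖ₑ * ‖φ x‖ₑ ≤ l2norm volume (fun x => ‖w x * F x‖ₑ) *
      l2norm volume (fun x => ‖((w x)⁻¹ : ℂ) * φ x‖ₑ) := by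
  have hwm := hw.continuous.measurable
  refine le_trans (le_of_eq ?_) (lintegral_mul_le_l2norm (hwm.mul hF).enorm.aemeasurable
    (((Complex.measurable_ofReal.comp hwm).inv).mul hφ).enorm.aemeasurable)
  refine lintegral_congr fun x => ?_
  have h0 : ‖w x‖ₑ * ‖((w x)⁻¹ : ℂ)‖ₑ = 1 := by
    rw [← ofReal_norm, ← ofReal_norm, ← ENNReal.ofReal_mul (norm_nonneg _), norm_inv,
      Complex.norm_real, mul_inv_cancel₀ (norm_ne_zero_iff.2 (hw.pos x).ne'), ENNReal.ofReal_one]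
  simp only [enorm_mul]
  rw [show ‖w x‖ₑ * ‖F x‖ₑ * (‖((w x)⁻¹ : ℂ)‖ₑ * ‖φ x‖ₑ) =
    (‖w x‖ₑ * ‖((w x)⁻¹ : ℂ)‖ₑ) * (‖F x‖ₑ * ‖φ x‖ₑ) by ring, h0, one_mul]

theorem l2norm_inv_mul_lt_top (hw : IsTemperedWeight A N w) (φ : 𝓢(ℝ, ℂ)) :
    l2norm volume (fun x => ‖((w x)⁻¹ : ℂ) * φ x‖ₑ) < ⊤ := by
  have h := (SchwartzMap.smulLeftCLM ℂ (fun x => ((w x)⁻¹ : ℂ)) φ).memLp 2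
  have h2 := h.2
  rw [eLpNorm_two_eq_l2norm] at h2
  simpa [hw.growth_inv_ofReal] using h2

theorem integrable_mul_schwartz (hw : IsTemperedWeight A N w) {T : ℝ → ℝ} (hT : Measurable T)
    (hT2 : l2norm volume (fun x => ‖w x * T x‖ₑ) < ⊤) (φ : 𝓢(ℝ, ℂ)) :
    Integrable fun x => (T x : ℂ) * φ x := by
  have hm : Measurable fun x => (T x : ℂ) * φ x :=
    (Complex.measurable_ofReal.comp hT).mul φ.continuous.measurable
  refine ⟨hm.aestronglyMeasurable, ?_⟩
  have h := hw.lintegral_enorm_mul_le hT φ.continuous.measurable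
  rw [HasFiniteIntegral]
  refine lt_of_le_of_lt (le_trans (le_of_eq ?_) h)
    (ENNReal.mul_lt_top hT2 (hw.l2norm_inv_mul_lt_top φ))
  refine lintegral_congr fun x => ?_
  rw [enorm_mul]
  congr 1
  rw [← ofReal_norm, ← ofReal_norm, Complex.norm_real]

/-- The subordination formula paired with `T`. Fubini applies since `w T` is in `L²` and the
weighted norms of the undifferentiated flow are integrable against `y^(1/2)`. -/
theorem enorm_integral_mul_quarter_le (hA : 0 ≤ A) (hw : IsTemperedWeight A N w) {T : ℝ → ℝ}
    (hT : Measurable T) (hT2 : l2norm volume (fun x => ‖w x * T x‖ₑ) < ⊤) (ψ : 𝓢(ℝ, ℂ)) :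
    ENNReal.ofReal (Real.Gamma (3 / 4) / 2) *
        ‖∫ x, (T x : ℂ) * symbolOp (fun ξ => (quarterSymbol ξ : ℂ)) ψ x‖ₑ ≤
      ∫⁻ y in Ioi (0 : ℝ), ENNReal.ofReal (y ^ (1 / 2 : ℝ)) *
        ‖∫ x, (T x : ℂ) * (heatOp 0 y ψ x - heatOp 2 y ψ x)‖ₑ := by
  set c : ℝ := Real.Gamma (3 / 4) / 2
  have hc : 0 < c := by
    have := Real.Gamma_pos_of_pos (s := 3 / 4) (by norm_num)
    positivity
  set H := symbolOp (fun ξ => (helmholtzSymbol ξ : ℂ)) ψ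
  set F : ℝ → ℝ → ℂ := fun y x => ((y ^ (1 / 2 : ℝ) : ℝ) : ℂ) * ((T x : ℂ) * heatOp 0 y H x)
  have hTm : Measurable fun p : ℝ × ℝ => (T p.2 : ℂ) :=
    Complex.measurable_ofReal.comp (hT.comp measurable_snd)
  have hm : Measurable (Function.uncurry F) :=
    (by fun_prop : Measurable fun p : ℝ × ℝ => ((p.1 ^ (1 / 2 : ℝ) : ℝ) : ℂ)).mul
      (hTm.mul (measurable_heatOp 0 H))
  have hF : Integrable (Function.uncurry F) ((volume.restrict (Ioi 0)).prod volume) := by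
    refine ⟨hm.aestronglyMeasurable, ?_⟩
    rw [HasFiniteIntegral, lintegral_prod _ hm.enorm.aemeasurable]
    obtain ⟨C, -, hC⟩ := exists_lintegral_heatNorm_zero_le hA N
    -- The estimate is stated for `w v`; taking `v = w⁻¹ H` makes it apply to `H`.
    have hH := hC w hw (SchwartzMap.smulLeftCLM ℂ (fun x => ((w x)⁻¹ : ℂ)) H)
    rw [hw.smulLeftCLM_smulLeftCLM_inv] at hH
    calc _ ≤ ∫⁻ y in Ioi (0 : ℝ), l2norm volume (fun x => ‖w x * T x‖ₑ) *
          (ENNReal.ofReal (y ^ (1 / 2 : ℝ)) * heatNorm w 0 H y) := by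
          refine setLIntegral_mono' measurableSet_Ioi fun y hy => ?_
          have hy : 0 < y := hy
          have hHm : Measurable fun x => heatOp 0 y H x := (heatOp 0 y H).continuous.measurable
          have h1 : ∀ x, ‖Function.uncurry F (y, x)‖ₑ =
              ENNReal.ofReal (y ^ (1 / 2 : ℝ)) * (‖T x‖ₑ * ‖heatOp 0 y H x‖ₑ) := by
            intro x
            simp only [Function.uncurry, F, enorm_mul]
            congr 1
            · rw [← ofReal_norm, Complex.norm_real, Real.norm_eq_abs, abs_of_nonneg (by positivity)]
            · congr 1
              rw [← ofReal_norm, ← ofReal_norm, Complex.norm_real]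
          simp_rw [h1]
          rw [lintegral_const_mul _ (by fun_prop), mul_left_comm]
          gcongr
          exact hw.lintegral_enorm_mul_le hT hHm
      _ < ⊤ := by
          rw [lintegral_const_mul' _ _ hT2.ne]
          refine ENNReal.mul_lt_top hT2 (lt_of_le_of_lt hH (ENNReal.mul_lt_top
            ENNReal.ofReal_lt_top ?_))
          rw [← eLpNorm_two_eq_l2norm]
          exact (SchwartzMap.memLp (SchwartzMap.smulLeftCLM ℂ (fun x => ((w x)⁻¹ : ℂ)) H) 2
            (μ := volume)).2
  have key : (c : ℂ) * ∫ x, (T x : ℂ) * symbolOp (fun ξ => (quarterSymbol ξ : ℂ)) ψ x =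
      ∫ y in Ioi (0 : ℝ), ((y ^ (1 / 2 : ℝ) : ℝ) : ℂ) *
        ∫ x, (T x : ℂ) * (heatOp 0 y ψ x - heatOp 2 y ψ x) := by
    calc _ = ∫ x, ∫ y in Ioi (0 : ℝ), F y x := by
          rw [← integral_const_mul]
          refine integral_congr_ae (Eventually.of_forall fun x => ?_)
          dsimp only
          rw [mul_left_comm, symbolOp_quarterSymbol_eq, ← integral_const_mul]
          refine setIntegral_congr_fun measurableSet_Ioi fun y _ => ?_
          simp only [F]
          ring
      _ = ∫ y in Ioi (0 : ℝ), ∫ x, F y x := (integral_integral_swap hF).symm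
      _ = _ := by
          refine setIntegral_congr_fun measurableSet_Ioi fun y _ => ?_
          simp only [F, H]
          rw [integral_const_mul]
          simp_rw [heatOp_helmholtz]
  have h2 : ENNReal.ofReal c = ‖(c : ℂ)‖ₑ := by
    rw [← ofReal_norm, Complex.norm_real, Real.norm_eq_abs, abs_of_pos hc]
  rw [h2, ← enorm_mul, key]
  refine (enorm_integral_le_lintegral_enorm _).trans (le_of_eq ?_)
  refine setLIntegral_congr_fun measurableSet_Ioi fun y hy => ?_
  have hy : 0 < y := hy
  rw [enorm_mul]
  congr 1
  rw [← ofReal_norm, Complex.norm_real, Real.norm_eq_abs, abs_of_nonneg (by positivity)]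

end IsTemperedWeight

theorem l2norm_ofReal_rpow_mul_heatNorm {w : ℝ → ℝ} {j : ℕ} (hj : 1 ≤ j) (ψ : 𝓢(ℝ, ℂ)) :
    l2norm (volume.restrict (Ioi 0)) (fun y => ENNReal.ofReal (y ^ ((j : ℝ) - 1 / 2)) *
      heatNorm w j ψ y) ^ 2 =
    ∫⁻ y in Ioi (0 : ℝ), ENNReal.ofReal (y ^ (2 * j - 1)) * heatNorm w j ψ y ^ 2 := by
  rw [l2norm_sq]
  refine setLIntegral_congr_fun measurableSet_Ioi fun y hy => ?_
  have hy : 0 < y := hy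
  rw [mul_pow, ← ENNReal.ofReal_pow (by positivity), ← Real.rpow_natCast, ← Real.rpow_mul hy.le,
    ← Real.rpow_natCast y]
  congr 3
  rw [Nat.cast_sub (by omega)]
  push_cast
  ring_nf

/-- The trace estimate in dual form, from a decomposition of the trace at each height `y`. -/
theorem exists_enorm_integral_mul_quarter_le {A : ℝ} (hA : 0 ≤ A) (N : ℕ) : ∃ C : ℝ, 0 < C ∧
    ∀ w : ℝ → ℝ, IsTemperedWeight A N w → ∀ (T : ℝ → ℝ) (G₁ G₂ : ℝ × ℝ → ℝ), Measurable T →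
    Measurable G₁ → Measurable G₂ → l2norm volume (fun x => ‖w x * T x‖ₑ) < ⊤ →
    (∀ᵐ y ∂volume.restrict (Ioi (0 : ℝ)), ∀ j (ψ : 𝓢(ℝ, ℂ)),
      ‖∫ x, (T x : ℂ) * heatOp (j + 2) y ψ x‖ₑ ≤
        (∫⁻ x, ‖G₁ (x, y)‖ₑ * ‖heatOp (j + 1) y ψ x‖ₑ) +
          ∫⁻ x, (∫⁻ τ in Ioc 0 y, ‖G₂ (x, τ)‖ₑ) * ‖heatOp (j + 2) y ψ x‖ₑ) →
    ∀ v : 𝓢(ℝ, ℂ),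
    ‖∫ x, (T x : ℂ) * symbolOp (fun ξ => (quarterSymbol ξ : ℂ))
        (SchwartzMap.smulLeftCLM ℂ (fun x => (w x : ℂ)) v) x‖ₑ ≤
      ENNReal.ofReal C * (l2norm volume (fun x => ‖w x * T x‖ₑ) +
        l2norm (volume.restrict (Ioi 0)) (fun y => l2norm volume fun x => ‖w x * G₁ (x, y)‖ₑ) +
        l2norm (volume.restrict (Ioi 0)) (fun y => l2norm volume fun x => ‖w x * G₂ (x, y)‖ₑ)) *
        l2norm volume (fun x => ‖v x‖ₑ) := by
  obtain ⟨C0, hC0, h0⟩ := exists_lintegral_heatNorm_zero_le hA N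
  obtain ⟨C1, hC1, h1⟩ := exists_lintegral_heatNorm_sq_le hA N
  set c : ℝ := Real.Gamma (3 / 4) / 2
  have hc : 0 < c := by
    have := Real.Gamma_pos_of_pos (s := 3 / 4) (by norm_num)
    positivity
  refine ⟨c⁻¹ * (C0 + 2 * C1), by positivity, fun w hw T G₁ G₂ hT hG₁ hG₂ hT2 hdec v => ?_⟩
  set V := l2norm volume (fun x => ‖v x‖ₑ)
  set ψ := SchwartzMap.smulLeftCLM ℂ (fun x => (w x : ℂ)) v
  set B := l2norm volume (fun x => ‖w x * T x‖ₑ)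
  set b₁ : ℝ → ℝ≥0∞ := fun y => l2norm volume fun x => ‖w x * G₁ (x, y)‖ₑ
  set b₂ : ℝ → ℝ≥0∞ := fun y => l2norm volume fun x => ‖w x * G₂ (x, y)‖ₑ
  have hwm := hw.continuous.measurable
  have hb : ∀ G : ℝ × ℝ → ℝ, Measurable G →
      Measurable fun y => l2norm volume fun x => ‖w x * G (x, y)‖ₑ := by
    intro G hG
    unfold l2norm
    refine Measurable.pow_const ?_ _
    exact Measurable.lintegral_prod_left'
      (f := fun p : ℝ × ℝ => ‖w p.1 * G (p.1, p.2)‖ₑ ^ 2) (by fun_prop)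
  have hb₁ : Measurable b₁ := hb G₁ hG₁
  have hb₂ : Measurable b₂ := hb G₂ hG₂
  have hN : ∀ j, Measurable (heatNorm w j ψ) := fun j => hw.measurable_heatNorm j ψ
  set β : ℝ → ℝ≥0∞ := fun y => ∫⁻ τ in Ioc 0 y, b₂ τ
  have hhm : ∀ j y, Measurable fun x => heatOp j y ψ x := fun j y =>
    (heatOp j y ψ).continuous.measurable
  have hβ : Measurable β := by
    have e : β = fun y => ∫⁻ τ, {p : ℝ × ℝ | 0 < p.2 ∧ p.2 ≤ p.1}.indicator
        (fun p => b₂ p.2) (y, τ) := by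
      ext y
      simp only [β]
      rw [← lintegral_indicator measurableSet_Ioc]
      rfl
    rw [e]
    refine Measurable.lintegral_prod_right' (Measurable.indicator (hb₂.comp measurable_snd) ?_)
    exact (measurableSet_lt measurable_const measurable_snd).inter
      (measurableSet_le measurable_snd measurable_fst)
  -- The factor `y^(1/2)` is exactly the square function weight `y^(j-1/2)` for `j = 1`. For `j = 2`
  -- it is written `y⁻¹ y^(3/2)`, and `y⁻¹` turns `∫₀^y b₂` into the average controlled by Hardy's
  -- inequality.
  have hpt : ∀ᵐ y ∂volume.restrict (Ioi (0 : ℝ)),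
      ENNReal.ofReal (y ^ (1 / 2 : ℝ)) *
        ‖∫ x, (T x : ℂ) * (heatOp 0 y ψ x - heatOp 2 y ψ x)‖ₑ ≤
      B * (ENNReal.ofReal (y ^ (1 / 2 : ℝ)) * heatNorm w 0 ψ y) +
        (b₁ y * (ENNReal.ofReal (y ^ (((1 : ℕ) : ℝ) - 1 / 2)) * heatNorm w 1 ψ y) +
        (β y * ENNReal.ofReal y⁻¹) *
          (ENNReal.ofReal (y ^ (((2 : ℕ) : ℝ) - 1 / 2)) * heatNorm w 2 ψ y)) := by
    filter_upwards [hdec, ae_restrict_mem measurableSet_Ioi] with y hy hy0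
    have hy0 : 0 < y := hy0
    have e1 : ENNReal.ofReal (y ^ (((1 : ℕ) : ℝ) - 1 / 2)) = ENNReal.ofReal (y ^ (1 / 2 : ℝ)) := by
      norm_num
    have e2 : ENNReal.ofReal y⁻¹ * ENNReal.ofReal (y ^ (((2 : ℕ) : ℝ) - 1 / 2)) =
        ENNReal.ofReal (y ^ (1 / 2 : ℝ)) := by
      rw [← ENNReal.ofReal_mul (by positivity), ← Real.rpow_neg_one, ← Real.rpow_add hy0]
      norm_num
    have f0 : ‖∫ x, (T x : ℂ) * heatOp 0 y ψ x‖ₑ ≤ B * heatNorm w 0 ψ y := by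
      refine (enorm_integral_le_lintegral_enorm _).trans
        (le_trans (le_of_eq ?_) (hw.lintegral_enorm_mul_le hT (hhm 0 y)))
      refine lintegral_congr fun x => ?_
      rw [enorm_mul]
      congr 1
      rw [← ofReal_norm, ← ofReal_norm, Complex.norm_real]
    have f1 : ∫⁻ x, ‖G₁ (x, y)‖ₑ * ‖heatOp 1 y ψ x‖ₑ ≤ b₁ y * heatNorm w 1 ψ y :=
      hw.lintegral_enorm_mul_le (F := fun x => G₁ (x, y)) (by fun_prop) (hhm 1 y)
    have f2 : ∫⁻ x, (∫⁻ τ in Ioc 0 y, ‖G₂ (x, τ)‖ₑ) * ‖heatOp 2 y ψ x‖ₑ ≤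
        β y * heatNorm w 2 ψ y := by
      have hm2 : Measurable fun p : ℝ × ℝ => ‖G₂ (p.1, p.2)‖ₑ * ‖heatOp 2 y ψ p.1‖ₑ :=
        (by fun_prop : Measurable fun p : ℝ × ℝ => ‖G₂ (p.1, p.2)‖ₑ).mul
          ((hhm 2 y).comp measurable_fst).enorm
      calc _ = ∫⁻ x, ∫⁻ τ in Ioc 0 y, ‖G₂ (x, τ)‖ₑ * ‖heatOp 2 y ψ x‖ₑ := by
            refine lintegral_congr fun x => ?_
            rw [lintegral_mul_const _ (by fun_prop)]
        _ = ∫⁻ τ in Ioc 0 y, ∫⁻ x, ‖G₂ (x, τ)‖ₑ * ‖heatOp 2 y ψ x‖ₑ :=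
            lintegral_lintegral_swap hm2.aemeasurable
        _ ≤ ∫⁻ τ in Ioc 0 y, b₂ τ * heatNorm w 2 ψ y := by
            refine lintegral_mono fun τ => ?_
            exact hw.lintegral_enorm_mul_le (F := fun x => G₂ (x, τ)) (by fun_prop) (hhm 2 y)
        _ = _ := lintegral_mul_const _ hb₂
    have hs : ∫ x, (T x : ℂ) * (heatOp 0 y ψ x - heatOp 2 y ψ x) =
        (∫ x, (T x : ℂ) * heatOp 0 y ψ x) - ∫ x, (T x : ℂ) * heatOp 2 y ψ x := by
      simp_rw [mul_sub]
      exact integral_sub (hw.integrable_mul_schwartz hT hT2 _)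
        (hw.integrable_mul_schwartz hT hT2 _)
    calc _ ≤ ENNReal.ofReal (y ^ (1 / 2 : ℝ)) *
          (B * heatNorm w 0 ψ y + (b₁ y * heatNorm w 1 ψ y + β y * heatNorm w 2 ψ y)) := by
          gcongr
          rw [hs]
          refine (enorm_sub_le).trans ?_
          gcongr
          exact (hy 0 ψ).trans (add_le_add f1 f2)
      _ = _ := by
          rw [e1, mul_assoc (β y), ← mul_assoc (ENNReal.ofReal y⁻¹), e2]
          ring
  have hl : ∀ j : ℕ, 1 ≤ j → j ≤ 2 → l2norm (volume.restrict (Ioi 0))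
      (fun y => ENNReal.ofReal (y ^ ((j : ℝ) - 1 / 2)) * heatNorm w j ψ y) ≤
      ENNReal.ofReal C1 * V := by
    intro j hj hj'
    have := h1 w hw j hj hj' v
    rw [← l2norm_ofReal_rpow_mul_heatNorm hj, ← mul_pow] at this
    exact (ENNReal.pow_le_pow_left_iff two_ne_zero).1 this
  have hhardy : l2norm (volume.restrict (Ioi 0)) (fun y => β y * ENNReal.ofReal y⁻¹) ≤
      2 * l2norm (volume.restrict (Ioi 0)) b₂ := by
    apply l2norm_le_of_sq_le
    rw [mul_pow, l2norm_sq]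
    norm_num
    exact hardy_inequality hb₂
  have hmain := (hw.enorm_integral_mul_quarter_le hA hT hT2 ψ).trans (lintegral_mono_ae hpt)
  have hm0 : Measurable fun y => B * (ENNReal.ofReal (y ^ (1 / 2 : ℝ)) * heatNorm w 0 ψ y) := by
    have := hN 0
    fun_prop
  have hm1 : Measurable fun y => ENNReal.ofReal (y ^ (((1 : ℕ) : ℝ) - 1 / 2)) *
      heatNorm w 1 ψ y := by
    have := hN 1
    fun_prop
  have hm2 : Measurable fun y => ENNReal.ofReal (y ^ (((2 : ℕ) : ℝ) - 1 / 2)) *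
      heatNorm w 2 ψ y := by
    have := hN 2
    fun_prop
  have hm3 : Measurable fun y => b₁ y *
      (ENNReal.ofReal (y ^ (((1 : ℕ) : ℝ) - 1 / 2)) * heatNorm w 1 ψ y) := hb₁.mul hm1
  rw [lintegral_add_left hm0, lintegral_add_left hm3, lintegral_const_mul' _ _ hT2.ne]
    at hmain
  have hfin : ENNReal.ofReal c * ‖∫ x, (T x : ℂ) * symbolOp (fun ξ => (quarterSymbol ξ : ℂ)) ψ x‖ₑ ≤
      B * (ENNReal.ofReal C0 * V) + (l2norm (volume.restrict (Ioi 0)) b₁ * (ENNReal.ofReal C1 * V) +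
        (2 * l2norm (volume.restrict (Ioi 0)) b₂) * (ENNReal.ofReal C1 * V)) := by
    refine hmain.trans ?_
    gcongr
    · exact h0 w hw v
    · refine (lintegral_mul_le_l2norm hb₁.aemeasurable hm1.aemeasurable).trans ?_
      gcongr
      exact hl 1 le_rfl (by norm_num)
    · refine (lintegral_mul_le_l2norm (hβ.mul (by fun_prop)).aemeasurable
        hm2.aemeasurable).trans ?_
      exact mul_le_mul' hhardy (hl 2 (by norm_num) le_rfl)
  calc _ = ENNReal.ofReal c⁻¹ * (ENNReal.ofReal c *
        ‖∫ x, (T x : ℂ) * symbolOp (fun ξ => (quarterSymbol ξ : ℂ)) ψ x‖ₑ) := by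
        rw [← mul_assoc, ← ENNReal.ofReal_mul (by positivity), inv_mul_cancel₀ hc.ne',
          ENNReal.ofReal_one, one_mul]
    _ ≤ ENNReal.ofReal c⁻¹ * _ := mul_le_mul_right hfin _
    _ = ENNReal.ofReal c⁻¹ * ((ENNReal.ofReal C0) * B +
        ENNReal.ofReal C1 * l2norm (volume.restrict (Ioi 0)) b₁ +
        2 * ENNReal.ofReal C1 * l2norm (volume.restrict (Ioi 0)) b₂) * V := by ring
    _ ≤ ENNReal.ofReal c⁻¹ * (ENNReal.ofReal (C0 + 2 * C1) * B +
        ENNReal.ofReal (C0 + 2 * C1) * l2norm (volume.restrict (Ioi 0)) b₁ +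
        ENNReal.ofReal (C0 + 2 * C1) * l2norm (volume.restrict (Ioi 0)) b₂) * V := by
        have e3 : 2 * ENNReal.ofReal C1 ≤ ENNReal.ofReal (C0 + 2 * C1) := by
          rw [show (2 : ℝ≥0∞) = ENNReal.ofReal 2 by simp, ← ENNReal.ofReal_mul (by norm_num)]
          exact ENNReal.ofReal_le_ofReal (by linarith)
        gcongr <;> linarith
    _ = _ := by
        rw [ENNReal.ofReal_mul (by positivity)]
        ring

end

/-! ### Weak derivatives and increments -/

/-- For `0 < τ ≤ h` the translates by `τ v` of the support of `Ψ` stay in one compact set, on which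
`G` is integrable. -/
theorem integrable_mul_comp_sub_smul {G : ℝ × ℝ → ℝ} (hG : LocallyIntegrable G)
    (hGm : Measurable G) {Ψ : ℝ × ℝ → ℝ} (hΨ : Continuous Ψ) (hΨc : HasCompactSupport Ψ)
    (v : ℝ × ℝ) (h : ℝ) :
    Integrable (fun p : ℝ × (ℝ × ℝ) => G p.2 * Ψ (p.2 - p.1 • v))
      ((volume.restrict (Ioc 0 h)).prod volume) := by
  set K : Set (ℝ × ℝ) := (fun p : ℝ × (ℝ × ℝ) => p.2 + p.1 • v) '' (Icc 0 h ×ˢ tsupport Ψ)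
  have hK : IsCompact K := (isCompact_Icc.prod hΨc).image (by fun_prop)
  obtain ⟨M, hM⟩ := hΨc.exists_bound_of_continuous hΨ
  have h1 : Integrable (K.indicator G) :=
    (hG.integrableOn_isCompact hK).integrable_indicator hK.measurableSet
  have h2 : Integrable (fun p : ℝ × (ℝ × ℝ) => (1 : ℝ) * (M * ‖K.indicator G p.2‖))
      ((volume.restrict (Ioc 0 h)).prod volume) :=
    Integrable.mul_prod (integrable_const (1 : ℝ)) (h1.norm.const_mul M)
  have hm : Measurable fun p : ℝ × (ℝ × ℝ) => G p.2 * Ψ (p.2 - p.1 • v) := by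
    have := hΨ.measurable
    fun_prop
  refine h2.mono' hm.aestronglyMeasurable ?_
  have hae : ∀ᵐ p ∂((volume.restrict (Ioc 0 h)).prod (volume : Measure (ℝ × ℝ))),
      p.1 ∈ Ioc 0 h := by
    have := (Measure.quasiMeasurePreserving_fst (μ := volume.restrict (Ioc 0 h))
      (ν := (volume : Measure (ℝ × ℝ)))).ae (ae_restrict_mem measurableSet_Ioc)
    exact this
  filter_upwards [hae] with p hp
  by_cases hpK : p.2 ∈ K
  · rw [indicator_of_mem hpK, norm_mul, one_mul, mul_comm]
    gcongr
    exact hM _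
  · have h0 : Ψ (p.2 - p.1 • v) = 0 := by
      by_contra hne
      refine hpK ⟨(p.1, p.2 - p.1 • v), ⟨⟨hp.1.le, hp.2⟩, subset_tsupport _ hne⟩, ?_⟩
      simp
    rw [h0, mul_zero, norm_zero, indicator_of_notMem hpK]
    simp

theorem integrable_comp_add_smul_mul {G : ℝ × ℝ → ℝ} (hG : LocallyIntegrable G)
    (hGm : Measurable G) {Ψ : ℝ × ℝ → ℝ} (hΨ : Continuous Ψ) (hΨc : HasCompactSupport Ψ)
    (v : ℝ × ℝ) (h : ℝ) :
    Integrable (fun p : ℝ × (ℝ × ℝ) => G (p.2 + p.1 • v) * Ψ p.2)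
      ((volume.restrict (Ioc 0 h)).prod volume) := by
  have hS : MeasurePreserving (fun p : ℝ × (ℝ × ℝ) => (p.1, p.2 + p.1 • v))
      ((volume.restrict (Ioc 0 h)).prod volume) ((volume.restrict (Ioc 0 h)).prod volume) :=
    MeasurePreserving.skew_product (g := fun (τ : ℝ) (x : ℝ × ℝ) => x + τ • v)
      (MeasurePreserving.id _) (by fun_prop)
      (Eventually.of_forall fun τ => (measurePreserving_add_right volume (τ • v)).map_eq)
  have := hS.integrable_comp_of_integrable (integrable_mul_comp_sub_smul hG hGm hΨ hΨc v h)
  refine this.congr (Eventually.of_forall fun p => ?_)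
  simp [Function.comp]

theorem locallyIntegrable_integral_comp_add_smul {G : ℝ × ℝ → ℝ} (hG : LocallyIntegrable G)
    (hGm : Measurable G) (v : ℝ × ℝ) (h : ℝ) :
    LocallyIntegrable fun x => ∫ τ in Ioc 0 h, G (x + τ • v) := by
  rw [locallyIntegrable_iff]
  intro K hK
  obtain ⟨f, hf1, -, hfc, -⟩ := exists_continuous_one_zero_of_isCompact hK isClosed_empty
    (disjoint_empty K)
  have h1 := (integrable_comp_add_smul_mul hG hGm f.continuous hfc v h).integral_prod_right
  refine (h1.integrableOn (s := K)).congr_fun (fun x hx => ?_) hK.measurableSet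
  have : f x = 1 := hf1 hx
  simp [this]

/-- A function with a weak derivative in the direction `v` is absolutely continuous in this
direction. -/
theorem ae_sub_eq_integral_of_weak_deriv {G G' : ℝ × ℝ → ℝ} (hG : LocallyIntegrable G)
    (hGm : Measurable G) (hG' : LocallyIntegrable G') (hGm' : Measurable G') {U : Set (ℝ × ℝ)}
    (hU : IsOpen U) {v : ℝ × ℝ} (hUv : ∀ x ∈ U, ∀ τ : ℝ, 0 ≤ τ → x + τ • v ∈ U)
    (hweak : ∀ Θ : ℝ × ℝ → ℝ, ContDiff ℝ ∞ Θ → HasCompactSupport Θ → tsupport Θ ⊆ U →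
      ∫ x, G x * fderiv ℝ Θ x v = -∫ x, G' x * Θ x) {h : ℝ} (hh : 0 ≤ h) :
    ∀ᵐ x, x ∈ U → G (x + h • v) - G x = ∫ τ in Ioc 0 h, G' (x + τ • v) := by
  have hshift : LocallyIntegrable fun x => G (x + h • v) := by
    rw [locallyIntegrable_iff]
    intro K hK
    have h1 := hG.integrableOn_isCompact (hK.image (continuous_add_const (h • v)))
    have h2 := (measurePreserving_add_right volume (h • v)).integrableOn_comp_preimage
      (MeasurableEquiv.addRight (h • v)).measurableEmbedding
      (f := G) (s := (fun x => x + h • v) '' K)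
    rw [preimage_image_eq _ (add_left_injective (h • v))] at h2
    exact h2.2 h1
  have hI := locallyIntegrable_integral_comp_add_smul hG' hGm' v h
  -- Tested against `Θ`, the increment of `G` becomes an increment of `Θ`, which is an integral of
  -- `∂_v Θ` along the segment. The weak derivative is then used with `Θ(· - τ v)`, supported in `U`
  -- because `U` is stable under forward translation.
  have key := hU.ae_eq_zero_of_integral_contDiff_smul_eq_zero (μ := volume)
    (f := fun x => (G (x + h • v) - G x) - ∫ τ in Ioc 0 h, G' (x + τ • v))
    (((hshift.sub hG).sub hI).locallyIntegrableOn U) ?_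
  · filter_upwards [key] with x hx hxU
    exact sub_eq_zero.1 (hx hxU)
  intro Θ hΘ hΘc hΘU
  have hcont := hΘ.continuous
  have hD : Continuous fun x => fderiv ℝ Θ x v :=
    (hΘ.continuous_fderiv (by simp)).clm_apply continuous_const
  have hDc : HasCompactSupport fun x => fderiv ℝ Θ x v := hΘc.fderiv_apply (𝕜 := ℝ) v
  have i1 := hshift.integrable_smul_left_of_hasCompactSupport hcont hΘc
  have i2 := hG.integrable_smul_left_of_hasCompactSupport hcont hΘc
  have i3 := hI.integrable_smul_left_of_hasCompactSupport hcont hΘc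
  simp_rw [smul_sub]
  have i5 : Integrable fun x => Θ x • G (x + h • v) - Θ x • G x := i1.sub i2
  rw [integral_sub i5 i3, integral_sub i1 i2, sub_eq_zero]
  have e1 : ∫ x, Θ x • G (x + h • v) = ∫ x, Θ (x - h • v) • G x := by
    rw [← integral_add_right_eq_self (fun x => Θ (x - h • v) • G x) (h • v)]
    simp
  have i4 : Integrable fun x => Θ (x - h • v) • G x := by
    refine hG.integrable_smul_left_of_hasCompactSupport (by fun_prop) ?_
    exact hΘc.comp_homeomorph (Homeomorph.subRight (h • v))
  have hftc : ∀ x, Θ (x - h • v) - Θ x = -∫ τ in Ioc 0 h, fderiv ℝ Θ (x - τ • v) v := by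
    intro x
    have hd : ∀ τ ∈ uIcc 0 h, HasDerivAt (fun τ : ℝ => Θ (x - τ • v))
        (-(fderiv ℝ Θ (x - τ • v) v)) τ := by
      intro τ _
      have h1 : HasFDerivAt Θ (fderiv ℝ Θ (x - τ • v)) (x - τ • v) :=
        (hΘ.differentiable (by simp)).differentiableAt.hasFDerivAt
      have h2 : HasDerivAt (fun τ : ℝ => x - τ • v) (-v) τ := by
        simpa using ((hasDerivAt_id τ).smul_const v).const_sub x
      have h3 := h1.comp_hasDerivAt τ h2
      rw [map_neg] at h3
      exact h3
    have hc : Continuous fun τ : ℝ => -(fderiv ℝ Θ (x - τ • v) v) :=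
      (hD.comp (by fun_prop : Continuous fun τ : ℝ => x - τ • v)).neg
    have := intervalIntegral.integral_eq_sub_of_hasDerivAt hd (hc.intervalIntegrable 0 h)
    rw [intervalIntegral.integral_of_le hh, integral_neg] at this
    simpa using this.symm
  have hτ : ∀ τ ∈ Ioc 0 h, -∫ x, G x * fderiv ℝ Θ (x - τ • v) v =
      ∫ x, G' (x + τ • v) * Θ x := by
    intro τ hτ
    have h1 := hweak (fun x => Θ (x - τ • v)) (hΘ.comp (contDiff_id.sub contDiff_const))
      (hΘc.comp_homeomorph (Homeomorph.subRight (τ • v))) ?_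
    · simp_rw [fderiv_comp_sub] at h1
      rw [h1, neg_neg, ← integral_add_right_eq_self (fun x => G' x * Θ (x - τ • v)) (τ • v)]
      simp
    · have e : tsupport (fun x => Θ (x - τ • v)) = (Homeomorph.subRight (τ • v)) ⁻¹' tsupport Θ :=
        tsupport_comp_eq_preimage Θ (Homeomorph.subRight (τ • v))
      rw [e]
      intro x hx
      have := hUv _ (hΘU hx) τ hτ.1.le
      simpa using this
  calc _ = ∫ x, G x * (Θ (x - h • v) - Θ x) := by
        rw [e1, ← integral_sub i4 i2]
        refine integral_congr_ae (Eventually.of_forall fun x => ?_)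
        simp only [smul_eq_mul]
        ring
    _ = -∫ x, ∫ τ in Ioc 0 h, G x * fderiv ℝ Θ (x - τ • v) v := by
        rw [← integral_neg]
        refine integral_congr_ae (Eventually.of_forall fun x => ?_)
        dsimp only
        rw [hftc, integral_const_mul, mul_neg]
    _ = -∫ τ in Ioc 0 h, ∫ x, G x * fderiv ℝ Θ (x - τ • v) v := by
        rw [integral_integral_swap]
        exact (integrable_mul_comp_sub_smul hG hGm hD hDc v h).swap
    _ = ∫ τ in Ioc 0 h, ∫ x, G' (x + τ • v) * Θ x := by
        rw [← integral_neg]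
        exact setIntegral_congr_fun measurableSet_Ioc hτ
    _ = ∫ x, ∫ τ in Ioc 0 h, G' (x + τ • v) * Θ x :=
        integral_integral_swap (integrable_comp_add_smul_mul hG' hGm' hcont hΘc v h)
    _ = _ := by
        refine integral_congr_ae (Eventually.of_forall fun x => ?_)
        dsimp only
        rw [integral_mul_const, smul_eq_mul, mul_comm]

/-! ### Restriction of weak derivatives to horizontal lines -/

theorem l2norm_lt_top_of_lintegral {α : Type*} [MeasurableSpace α] {μ : Measure α} {f : α → ℝ≥0∞}
    (h : ∫⁻ x, f x ^ 2 ∂μ < ⊤) : l2norm μ f < ⊤ :=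
  ENNReal.rpow_lt_top_of_nonneg (by norm_num) h.ne

/-- Since `w⁻¹` grows at most like `(1 + |x|)^k`, its product with `(1 + |x|)^(-k-1)` is in `L²`, so
Cauchy-Schwarz applies. This yields the dominating functions for passing to the limit in difference
quotients. -/
theorem IsTemperedWeight.exists_integrable_mul_inv_pow {A : ℝ} {N : ℕ} {w : ℝ → ℝ}
    (hw : IsTemperedWeight A N w) : ∃ k : ℕ, ∀ a : ℝ → ℝ, Measurable a →
      l2norm volume (fun x => ‖w x * a x‖ₑ) < ⊤ →
      Integrable fun x => |a x| * ((1 + ‖x‖) ^ k)⁻¹ := by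
  obtain ⟨k, C, hC⟩ := hw.growth_inv.2 0
  refine ⟨k + 1, fun a ha ha2 => ⟨by fun_prop, ?_⟩⟩
  have hC' : ∀ x, ‖(w x)⁻¹‖ ≤ C * (1 + ‖x‖) ^ k := fun x => by simpa using hC x
  have hm : Measurable fun x : ℝ => ((((1 + ‖x‖) ^ (k + 1))⁻¹ : ℝ) : ℂ) := by fun_prop
  refine lt_of_le_of_lt (le_trans (le_of_eq ?_) (hw.lintegral_enorm_mul_le ha hm))
    (ENNReal.mul_lt_top ha2 (l2norm_lt_top_of_lintegral ?_))
  · refine lintegral_congr fun x => ?_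
    rw [enorm_mul]
    congr 1
    · simp
    · rw [← ofReal_norm, ← ofReal_norm, Complex.norm_real]
  · have hi : Integrable fun x : ℝ => (1 + ‖x‖) ^ (-(2 : ℝ)) :=
      integrable_one_add_norm (by simp)
    refine lt_of_le_of_lt (lintegral_mono fun x => ?_)
      ((hi.const_mul (C ^ 2)).lintegral_lt_top)
    have hp : 0 < 1 + ‖x‖ := by positivity
    rw [← ofReal_norm, ← ENNReal.ofReal_pow (norm_nonneg _)]
    apply ENNReal.ofReal_le_ofReal
    have e : ‖((w x)⁻¹ : ℂ) * ((((1 + ‖x‖) ^ (k + 1))⁻¹ : ℝ) : ℂ)‖ =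
        ‖(w x)⁻¹‖ * ((1 + ‖x‖) ^ (k + 1))⁻¹ := by
      rw [norm_mul, ← Complex.ofReal_inv, Complex.norm_real, Complex.norm_real,
        Real.norm_of_nonneg (inv_nonneg.2 (pow_nonneg hp.le _))]
    rw [e]
    calc _ ≤ (C * (1 + ‖x‖) ^ k * ((1 + ‖x‖) ^ (k + 1))⁻¹) ^ 2 := by
          gcongr
          exact hC' x
      _ = _ := by
          rw [Real.rpow_neg hp.le, Real.rpow_two]
          field_simp
          ring

theorem SchwartzMap.exists_norm_comp_sub_le (φ : 𝓢(ℝ, ℂ)) (k : ℕ) :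
    ∃ C : ℝ, ∀ x τ : ℝ, |τ| ≤ 1 → ‖φ (x - τ)‖ ≤ C * ((1 + ‖x‖) ^ k)⁻¹ := by
  obtain ⟨C, hC⟩ : ∃ C : ℝ, ∀ z, (1 + ‖z‖) ^ k * ‖φ z‖ ≤ C := by
    have := SchwartzMap.one_add_le_sup_seminorm_apply (𝕜 := ℝ) (m := (k, 0)) le_rfl le_rfl φ
    simp only [norm_iteratedFDeriv_zero] at this
    exact ⟨_, this⟩
  refine ⟨2 ^ k * C, fun x τ hτ => ?_⟩
  have hp : 0 < 1 + ‖x‖ := by positivity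
  have h1 : 1 + ‖x‖ ≤ 2 * (1 + ‖x - τ‖) := by
    have : ‖x‖ ≤ ‖x - τ‖ + ‖τ‖ := by simpa using norm_add_le (x - τ) τ
    rw [Real.norm_eq_abs τ] at this
    linarith [norm_nonneg (x - τ)]
  rw [← div_eq_mul_inv, le_div_iff₀ (by positivity)]
  calc ‖φ (x - τ)‖ * (1 + ‖x‖) ^ k ≤ ‖φ (x - τ)‖ * (2 * (1 + ‖x - τ‖)) ^ k := by gcongr
    _ = 2 ^ k * ((1 + ‖x - τ‖) ^ k * ‖φ (x - τ)‖) := by rw [mul_pow]; ring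
    _ ≤ _ := by gcongr; exact hC _

/-- Translating moves the difference quotient of `a` onto `φ`, where it is an average of `φ'`;
dominated convergence lets the step tend to `0`. Only the steps `1/(n+1)` occur, so that on slices
of a plane function only countably many null sets arise. -/
theorem IsTemperedWeight.integral_mul_deriv_of_translation {A : ℝ} {N : ℕ} {w : ℝ → ℝ}
    (hw : IsTemperedWeight A N w) {a b : ℝ → ℝ} (ha : Measurable a) (hb : Measurable b)
    (ha2 : l2norm volume (fun x => ‖w x * a x‖ₑ) < ⊤)
    (hb2 : l2norm volume (fun x => ‖w x * b x‖ₑ) < ⊤)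
    (h : ∀ n : ℕ, ∀ᵐ x, a (x + 1 / ((n : ℝ) + 1)) - a x =
      ∫ τ in Ioc 0 (1 / ((n : ℝ) + 1)), b (x + τ)) {φ φ' : 𝓢(ℝ, ℂ)}
    (hφ : ∀ x, HasDerivAt φ (φ' x) x) :
    ∫ x, (a x : ℂ) * φ' x = -∫ x, (b x : ℂ) * φ x := by
  obtain ⟨k, hk⟩ := hw.exists_integrable_mul_inv_pow
  obtain ⟨C, hC⟩ := φ.exists_norm_comp_sub_le k
  obtain ⟨C', hC'⟩ := φ'.exists_norm_comp_sub_le k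
  have ia := hk a ha ha2
  have ib := hk b hb hb2
  set s : ℕ → ℝ := fun n => 1 / ((n : ℝ) + 1) with hs
  have hs0 : ∀ n, 0 < s n := fun n => by positivity
  have hs1 : ∀ n, s n ≤ 1 := fun n => by
    rw [hs, div_le_one (by positivity)]; linarith [n.cast_nonneg (α := ℝ)]
  have hslim : Tendsto s atTop (𝓝[>] 0) :=
    tendsto_nhdsWithin_iff.2 ⟨tendsto_one_div_add_atTop_nhds_zero_nat,
      Eventually.of_forall hs0⟩
  have hac : Measurable fun x => (a x : ℂ) := Complex.measurable_ofReal.comp ha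
  have hbc : Measurable fun x => (b x : ℂ) := Complex.measurable_ofReal.comp hb
  have hφc := φ.continuous
  have hφ'c := φ'.continuous
  have hftc : ∀ x, ∀ c : ℝ, 0 ≤ c → φ (x - c) - φ x = -∫ τ in (0 : ℝ)..c, φ' (x - τ) := by
    intro x c hc
    have hd : ∀ τ ∈ uIcc 0 c, HasDerivAt (fun τ : ℝ => φ (x - τ)) (-φ' (x - τ)) τ := by
      intro τ _
      have := (hφ (x - τ)).scomp τ ((hasDerivAt_id τ).const_sub x)
      rw [neg_smul, one_smul] at this
      exact this
    have := intervalIntegral.integral_eq_sub_of_hasDerivAt hd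
      (Continuous.intervalIntegrable (by fun_prop) 0 c)
    rw [intervalIntegral.integral_neg] at this
    simpa using this.symm
  -- the dominated convergence argument, used for `a, φ'` and for `b, φ`
  have lim : ∀ (d : ℝ → ℝ), Measurable d → Integrable (fun x => |d x| * ((1 + ‖x‖) ^ k)⁻¹) →
      ∀ (θ : 𝓢(ℝ, ℂ)) (D : ℝ),
      (∀ x τ : ℝ, |τ| ≤ 1 → ‖θ (x - τ)‖ ≤ D * ((1 + ‖x‖) ^ k)⁻¹) →
      Tendsto (fun n => ∫ x, (d x : ℂ) * ((s n)⁻¹ • ∫ τ in (0 : ℝ)..s n, θ (x - τ))) atTop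
        (𝓝 (∫ x, (d x : ℂ) * θ x)) := by
    intro d hd hdi θ D hD
    have hθ := θ.continuous
    refine tendsto_integral_of_dominated_convergence
      (fun x => D * (|d x| * ((1 + ‖x‖) ^ k)⁻¹)) (fun n => ?_) (hdi.const_mul D) (fun n => ?_) ?_
    · have : Continuous fun x => ∫ τ in (0 : ℝ)..s n, θ (x - τ) :=
        intervalIntegral.continuous_parametric_intervalIntegral_of_continuous'
          (f := fun x τ => θ (x - τ)) (by fun_prop) 0 (s n)
      have hdc : Measurable fun x => (d x : ℂ) := Complex.measurable_ofReal.comp hd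
      have h2 : Measurable fun x => (s n)⁻¹ • ∫ τ in (0 : ℝ)..s n, θ (x - τ) :=
        (this.const_smul (s n)⁻¹).measurable
      exact (hdc.mul h2).aestronglyMeasurable
    · refine Eventually.of_forall fun x => ?_
      have h1 : ‖∫ τ in (0 : ℝ)..s n, θ (x - τ)‖ ≤ D * ((1 + ‖x‖) ^ k)⁻¹ * |s n - 0| := by
        refine intervalIntegral.norm_integral_le_of_norm_le_const fun τ hτ => hD x τ ?_
        rw [uIoc_of_le (hs0 n).le] at hτ
        rw [abs_of_pos hτ.1]
        exact hτ.2.trans (hs1 n)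
      rw [sub_zero, abs_of_pos (hs0 n)] at h1
      rw [norm_mul, norm_smul, Complex.norm_real, norm_inv, Real.norm_of_nonneg (hs0 n).le,
        Real.norm_eq_abs]
      calc |d x| * ((s n)⁻¹ * ‖∫ τ in (0 : ℝ)..s n, θ (x - τ)‖)
          ≤ |d x| * ((s n)⁻¹ * (D * ((1 + ‖x‖) ^ k)⁻¹ * s n)) := by
            have := (hs0 n).le
            gcongr
        _ = _ := by
            have := (hs0 n).ne'
            field_simp
    · refine Eventually.of_forall fun x => Tendsto.const_mul _ ?_
      have hc : Continuous fun τ => θ (x - τ) := by fun_prop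
      have h1 := (intervalIntegral.integral_hasDerivAt_right (hc.intervalIntegrable 0 0)
        (hc.stronglyMeasurableAtFilter _ _) hc.continuousAt).tendsto_slope_zero_right.comp hslim
      simpa [Function.comp_def] using h1
  have la := lim a ha ia φ' C' hC'
  have lb := lim b hb ib φ C hC
  have heq : ∀ n, ∫ x, (a x : ℂ) * ((s n)⁻¹ • ∫ τ in (0 : ℝ)..s n, φ' (x - τ)) =
      -∫ x, (b x : ℂ) * ((s n)⁻¹ • ∫ τ in (0 : ℝ)..s n, φ (x - τ)) := by
    intro n
    have hi0 := hw.integrable_mul_schwartz ha ha2 φ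
    have hi1 : Integrable fun x => (a x : ℂ) * φ (x - s n) := by
      refine (ia.const_mul C).mono' (by fun_prop) (Eventually.of_forall fun x => ?_)
      rw [norm_mul, Complex.norm_real, Real.norm_eq_abs, mul_left_comm]
      gcongr
      exact hC x _ (by rw [abs_of_pos (hs0 n)]; exact hs1 n)
    have hi2 : Integrable fun x => (a (x + s n) : ℂ) * φ x := by
      have := hi1.comp_add_right (s n)
      simpa using this
    have hP : Integrable (fun p : ℝ × ℝ => (b p.1 : ℂ) * φ (p.1 - p.2))
        ((volume : Measure ℝ).prod (volume.restrict (Ioc 0 (s n)))) := by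
      have hI : Integrable (fun p : ℝ × ℝ => C * (|b p.1| * ((1 + ‖p.1‖) ^ k)⁻¹) * 1)
          ((volume : Measure ℝ).prod (volume.restrict (Ioc 0 (s n)))) :=
        (ib.const_mul C).mul_prod (integrable_const 1)
      have hm : Measurable fun p : ℝ × ℝ => (b p.1 : ℂ) * φ (p.1 - p.2) :=
        (hbc.comp measurable_fst).mul
          (hφc.comp (continuous_fst.sub continuous_snd)).measurable
      refine hI.mono' hm.aestronglyMeasurable ?_
      have : ∀ᵐ p : ℝ × ℝ ∂(volume : Measure ℝ).prod (volume.restrict (Ioc 0 (s n))),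
          p.2 ∈ Ioc 0 (s n) :=
        Measure.quasiMeasurePreserving_snd.ae (ae_restrict_mem measurableSet_Ioc)
      filter_upwards [this] with p hp
      rw [norm_mul, Complex.norm_real, Real.norm_eq_abs, mul_one, mul_left_comm]
      gcongr
      exact hC p.1 p.2 (by rw [abs_of_pos hp.1]; exact hp.2.trans (hs1 n))
    have hP' : Integrable (fun p : ℝ × ℝ => (b (p.1 + p.2) : ℂ) * φ p.1)
        ((volume : Measure ℝ).prod (volume.restrict (Ioc 0 (s n)))) := by
      have hS : MeasurePreserving (fun p : ℝ × ℝ => (p.1, p.2 + p.1))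
          ((volume.restrict (Ioc 0 (s n))).prod (volume : Measure ℝ))
          ((volume.restrict (Ioc 0 (s n))).prod (volume : Measure ℝ)) :=
        (MeasurePreserving.id _).skew_product (g := fun τ x => x + τ) (by fun_prop)
          (Eventually.of_forall fun τ => map_add_right_eq_self volume τ)
      have h1 := (hS.integrable_comp hP.swap.aestronglyMeasurable).2 hP.swap
      refine h1.swap.congr (Eventually.of_forall fun p => ?_)
      simp
    calc _ = (s n)⁻¹ • ∫ x, (a x : ℂ) * ∫ τ in (0 : ℝ)..s n, φ' (x - τ) := by
          rw [← integral_smul]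
          refine integral_congr_ae (Eventually.of_forall fun x => ?_)
          dsimp only
          rw [mul_smul_comm]
      _ = (s n)⁻¹ • -∫ x, ((a (x + s n) : ℂ) - a x) * φ x := by
          congr 1
          have e1 : ∫ x, (a (x + s n) : ℂ) * φ x = ∫ x, (a x : ℂ) * φ (x - s n) := by
            rw [← integral_add_right_eq_self (fun x => (a x : ℂ) * φ (x - s n)) (s n)]
            simp
          simp_rw [sub_mul]
          rw [integral_sub hi2 hi0, e1, ← integral_sub hi1 hi0, ← integral_neg]
          refine integral_congr_ae (Eventually.of_forall fun x => ?_)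
          dsimp only
          rw [← mul_sub, hftc x _ (hs0 n).le, mul_neg, neg_neg]
      _ = (s n)⁻¹ • -∫ x, ∫ τ in Ioc 0 (s n), (b (x + τ) : ℂ) * φ x := by
          congr 2
          refine integral_congr_ae ((h n).mono fun x hx => ?_)
          dsimp only
          rw [integral_mul_const, integral_complex_ofReal, ← hx]
          push_cast
          rfl
      _ = (s n)⁻¹ • -∫ τ in Ioc 0 (s n), ∫ x, (b x : ℂ) * φ (x - τ) := by
          rw [integral_integral_swap hP']
          congr 2
          refine integral_congr_ae (Eventually.of_forall fun τ => ?_)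
          dsimp only
          rw [← integral_add_right_eq_self (fun x => (b x : ℂ) * φ (x - τ)) τ]
          simp
      _ = _ := by
          rw [← integral_integral_swap hP, smul_neg, ← integral_smul]
          congr 1
          refine integral_congr_ae (Eventually.of_forall fun x => ?_)
          dsimp only
          rw [integral_const_mul, mul_smul_comm, intervalIntegral.integral_of_le (hs0 n).le]
  refine tendsto_nhds_unique la ?_
  simp_rw [heq]
  exact lb.neg

/-! ### Weighted Sobolev functions on a half-plane -/

theorem locallyIntegrable_of_l2norm_mul_lt_top {w : ℝ → ℝ} (hw : Continuous w)
    (hw0 : ∀ x, 0 < w x) {G : ℝ × ℝ → ℝ} (hG : Measurable G)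
    (h : l2norm volume (fun x => ‖w x.1 * G x‖ₑ) < ⊤) : LocallyIntegrable G := by
  have hm : MemLp (fun x => w x.1 * G x) 2 volume := by
    refine ⟨(Measurable.aestronglyMeasurable (by fun_prop)), ?_⟩
    rwa [eLpNorm_two_eq_l2norm]
  have h1 := hm.locallyIntegrable one_le_two
  rw [← locallyIntegrableOn_univ] at h1 ⊢
  have hc : Continuous fun x : ℝ × ℝ => (w x.1)⁻¹ :=
    (hw.comp continuous_fst).inv₀ fun x => (hw0 _).ne'
  refine (h1.continuousOn_mul hc.continuousOn isOpen_univ.isLocallyClosed).congr ?_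
  refine Eventually.of_forall fun x => ?_
  have := (hw0 x.1).ne'
  simp [this]

/-- `G` is a function on the half-plane `x₂ > 0` with weak derivatives `G₁` and `G₂`, supported in
the strip `0 < x₂ < δ` and square integrable together with its derivatives against the weight
`w(x₁)`. -/
structure IsStripSobolev (w : ℝ → ℝ) (δ : ℝ) (G G₁ G₂ : ℝ × ℝ → ℝ) : Prop where
  measurable : Measurable G
  measurable₁ : Measurable G₁
  measurable₂ : Measurable G₂
  eq_zero : ∀ x, x.2 ∉ Ioo 0 δ → G x = 0
  eq_zero₂ : ∀ x, x.2 ∉ Ioo 0 δ → G₂ x = 0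
  lt_top : l2norm volume (fun x => ‖w x.1 * G x‖ₑ) < ⊤
  lt_top₁ : l2norm volume (fun x => ‖w x.1 * G₁ x‖ₑ) < ⊤
  lt_top₂ : l2norm volume (fun x => ‖w x.1 * G₂ x‖ₑ) < ⊤
  weak₁ : ∀ Θ : ℝ × ℝ → ℝ, ContDiff ℝ ∞ Θ → HasCompactSupport Θ → tsupport Θ ⊆ {x | 0 < x.2} →
    ∫ x, G x * fderiv ℝ Θ x (1, 0) = -∫ x, G₁ x * Θ x
  weak₂ : ∀ Θ : ℝ × ℝ → ℝ, ContDiff ℝ ∞ Θ → HasCompactSupport Θ → tsupport Θ ⊆ {x | 0 < x.2} →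
    ∫ x, G x * fderiv ℝ Θ x (0, 1) = -∫ x, G₂ x * Θ x

/-- The boundary value of a strip function with vertical derivative `G₂`. -/
noncomputable def stripTrace (δ : ℝ) (G₂ : ℝ × ℝ → ℝ) (x : ℝ) : ℝ := -∫ τ in Ioc 0 δ, G₂ (x, τ)

theorem measurable_stripTrace (δ : ℝ) {G₂ : ℝ × ℝ → ℝ} (h : Measurable G₂) :
    Measurable (stripTrace δ G₂) := by
  have := h.stronglyMeasurable.integral_prod_right (ν := volume.restrict (Ioc (0 : ℝ) δ))
    (f := fun x τ => G₂ (x, τ))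
  exact this.measurable.neg

theorem isOpen_upperHalf : IsOpen {x : ℝ × ℝ | 0 < x.2} := isOpen_lt continuous_const continuous_snd

namespace IsStripSobolev

variable {w : ℝ → ℝ} {δ : ℝ} {G G₁ G₂ : ℝ × ℝ → ℝ}

theorem lintegral_sq_slice_lt_top {F : ℝ × ℝ → ℝ} (hw : Continuous w) (hF : Measurable F)
    (h : l2norm volume (fun x => ‖w x.1 * F x‖ₑ) < ⊤) :
    ∀ᵐ x, ∫⁻ τ, ‖w x * F (x, τ)‖ₑ ^ 2 < ⊤ := by
  have hwm := hw.measurable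
  have hm : Measurable fun p : ℝ × ℝ => ‖w p.1 * F p‖ₑ ^ 2 := by fun_prop
  have h2 := ENNReal.pow_lt_top (n := 2) h
  rw [l2norm_sq, Measure.volume_eq_prod, lintegral_prod _ hm.aemeasurable] at h2
  exact ae_lt_top (hm.lintegral_prod_right') h2.ne

theorem integrableOn_slice {F : ℝ × ℝ → ℝ} (hw : Continuous w) (hw0 : ∀ x, 0 < w x)
    (hF : Measurable F) (h : l2norm volume (fun x => ‖w x.1 * F x‖ₑ) < ⊤) (δ : ℝ) :
    ∀ᵐ x, IntegrableOn (fun τ => F (x, τ)) (Ioc 0 δ) := by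
  filter_upwards [lintegral_sq_slice_lt_top hw hF h] with x hx
  have hm : Measurable fun τ => w x * F (x, τ) := by fun_prop
  have h1 : MemLp (fun τ => w x * F (x, τ)) 2 volume := by
    refine ⟨hm.aestronglyMeasurable, ?_⟩
    rw [eLpNorm_two_eq_l2norm]
    exact l2norm_lt_top_of_lintegral hx
  have h2 : IntegrableOn (fun τ => w x * F (x, τ)) (Ioc 0 δ) :=
    (h1.restrict _).integrable one_le_two
  refine (h2.const_mul (w x)⁻¹).congr (Eventually.of_forall fun τ => ?_)
  have := (hw0 x).ne'
  simp [this]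

/-- A vertical increment of length `δ` leaves the strip, where `G` vanishes; hence `G(x, y) = -∫_y^δ
G₂(x, τ) dτ`. -/
theorem ae_eq_stripTrace_add (hw : Continuous w) (hw0 : ∀ x, 0 < w x) (hδ : 0 < δ)
    (h : IsStripSobolev w δ G G₁ G₂) : ∀ᵐ x : ℝ × ℝ, 0 < x.2 →
      G x = stripTrace δ G₂ x.1 + ∫ τ in Ioc 0 x.2, G₂ (x.1, τ) := by
  have h1 := ae_sub_eq_integral_of_weak_deriv
    (locallyIntegrable_of_l2norm_mul_lt_top hw hw0 h.measurable h.lt_top) h.measurable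
    (locallyIntegrable_of_l2norm_mul_lt_top hw hw0 h.measurable₂ h.lt_top₂) h.measurable₂
    isOpen_upperHalf (v := (0, 1)) (fun x hx τ hτ => by
      have : 0 < x.2 := hx
      simp only [mem_ofPred_eq, Prod.snd_add, Prod.smul_snd, smul_eq_mul, mul_one]
      positivity) h.weak₂ hδ.le
  have h2 : ∀ᵐ x : ℝ × ℝ, IntegrableOn (fun τ => G₂ (x.1, τ)) (Ioc 0 δ) :=
    Measure.quasiMeasurePreserving_fst.ae (integrableOn_slice hw hw0 h.measurable₂ h.lt_top₂ δ)
  filter_upwards [h1, h2] with x hx hi hx0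
  have h3 := hx hx0
  rw [h.eq_zero (x + δ • (0, 1)) (by simp [hx0.le]), zero_sub] at h3
  have hz : ∀ a b : ℝ, δ ≤ a → ∫ τ in a..b, G₂ (x.1, τ) = 0 ∨ b < a := by
    intro a b ha
    rcases lt_or_ge b a with hb | hb
    · exact Or.inr hb
    left
    rw [intervalIntegral.integral_of_le hb]
    refine setIntegral_eq_zero_of_forall_eq_zero fun τ hτ => h.eq_zero₂ _ ?_
    simp only [mem_Ioo, not_and, not_lt]
    intro _
    exact ha.trans hτ.1.le
  have hii : ∀ a b : ℝ, IntervalIntegrable (fun τ => G₂ (x.1, τ)) volume a b := by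
    have hI : Integrable fun τ => G₂ (x.1, τ) := by
      refine (integrableOn_iff_integrable_of_support_subset fun τ hτ => ?_).1 hi
      by_contra hcon
      exact hτ (h.eq_zero₂ _ fun h' => hcon ⟨h'.1, h'.2.le⟩)
    exact fun a b => hI.intervalIntegrable
  have e1 : ∫ τ in Ioc 0 δ, G₂ (x + τ • (0, 1)) = ∫ τ in x.2..(x.2 + δ), G₂ (x.1, τ) := by
    rw [← intervalIntegral.integral_of_le hδ.le, ← zero_add x.2]
    rw [show (0 + x.2 + δ) = δ + x.2 by ring,
      ← intervalIntegral.integral_comp_add_right (fun τ => G₂ (x.1, τ))]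
    refine intervalIntegral.integral_congr fun τ _ => ?_
    congr 1
    ext <;> simp [add_comm]
  have e2 : ∫ τ in x.2..(x.2 + δ), G₂ (x.1, τ) = ∫ τ in x.2..δ, G₂ (x.1, τ) := by
    rw [← intervalIntegral.integral_add_adjacent_intervals (hii x.2 δ) (hii δ _)]
    rcases hz δ (x.2 + δ) le_rfl with h' | h'
    · rw [h', add_zero]
    · linarith
  rw [stripTrace, ← intervalIntegral.integral_of_le hx0.le, ← intervalIntegral.integral_of_le hδ.le]
  have e3 := intervalIntegral.integral_add_adjacent_intervals (hii 0 x.2) (hii x.2 δ)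
  rw [e1, e2] at h3
  linarith

theorem l2norm_slices_le {F : ℝ × ℝ → ℝ} (hw : Continuous w) (hF : Measurable F) :
    l2norm (volume.restrict (Ioi (0 : ℝ))) (fun y => l2norm volume fun x => ‖w x * F (x, y)‖ₑ) ≤
      l2norm volume (fun x => ‖w x.1 * F x‖ₑ) := by
  have hwm := hw.measurable
  have hm : Measurable fun p : ℝ × ℝ => ‖w p.1 * F p‖ₑ ^ 2 := by fun_prop
  apply l2norm_le_of_sq_le
  simp_rw [l2norm_sq]
  rw [Measure.volume_eq_prod, lintegral_prod_symm _ hm.aemeasurable]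
  exact setLIntegral_le_lintegral _ _

theorem l2norm_mul_stripTrace_le (hw : Continuous w) (hδ : 0 ≤ δ) (hG₂ : Measurable G₂) :
    l2norm volume (fun x => ‖w x * stripTrace δ G₂ x‖ₑ) ≤
      ENNReal.ofReal (Real.sqrt δ) * l2norm volume (fun x => ‖w x.1 * G₂ x‖ₑ) := by
  have hwm := hw.measurable
  have hm : Measurable fun p : ℝ × ℝ => ‖w p.1 * G₂ p‖ₑ ^ 2 := by fun_prop
  apply l2norm_le_of_sq_le
  rw [mul_pow, l2norm_sq, ← ENNReal.ofReal_pow (Real.sqrt_nonneg _), Real.sq_sqrt hδ,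
    Measure.volume_eq_prod, lintegral_prod _ hm.aemeasurable,
    ← lintegral_const_mul _ hm.lintegral_prod_right']
  refine lintegral_mono fun x => ?_
  have hx : Measurable fun τ => ‖w x * G₂ (x, τ)‖ₑ := by fun_prop
  calc ‖w x * stripTrace δ G₂ x‖ₑ ^ 2 = ‖∫ τ in Ioc 0 δ, w x * G₂ (x, τ)‖ₑ ^ 2 := by
        rw [stripTrace, integral_const_mul, mul_neg, enorm_neg]
    _ ≤ (∫⁻ τ in Ioc 0 δ, ‖w x * G₂ (x, τ)‖ₑ * 1) ^ 2 := by
        gcongr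
        simp_rw [mul_one]
        exact enorm_integral_le_lintegral_enorm _
    _ ≤ (l2norm (volume.restrict (Ioc 0 δ)) (fun τ => ‖w x * G₂ (x, τ)‖ₑ) *
          l2norm (volume.restrict (Ioc 0 δ)) (fun _ => 1)) ^ 2 := by
        gcongr
        exact lintegral_mul_le_l2norm hx.aemeasurable aemeasurable_const
    _ = (∫⁻ τ in Ioc 0 δ, ‖w x * G₂ (x, τ)‖ₑ ^ 2) * ENNReal.ofReal δ := by
        rw [mul_pow, l2norm_sq, l2norm_sq]
        simp
    _ ≤ _ := by
        rw [mul_comm]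
        gcongr
        exact Measure.restrict_le_self

variable {A : ℝ} {N : ℕ}

/-- The weak derivative restricts to almost every horizontal line through its increments, by Fubini.
The null set of heights serves all test functions at once, which matters because `heatOp j y ψ`
depends on `y`. -/
theorem ae_integral_mul_deriv_slice (hw : IsTemperedWeight A N w)
    (h : IsStripSobolev w δ G G₁ G₂) : ∀ᵐ y, 0 < y →
      l2norm volume (fun x => ‖w x * G (x, y)‖ₑ) < ⊤ ∧
      ∀ φ φ' : 𝓢(ℝ, ℂ), (∀ x, HasDerivAt φ (φ' x) x) →
        ∫ x, (G (x, y) : ℂ) * φ' x = -∫ x, (G₁ (x, y) : ℂ) * φ x := by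
  have hwc := hw.continuous
  have hsl : ∀ {F : ℝ × ℝ → ℝ}, Measurable F →
      l2norm volume (fun x : ℝ × ℝ => ‖w x.1 * F x‖ₑ) < ⊤ →
      ∀ᵐ y, l2norm volume (fun x => ‖w x * F (x, y)‖ₑ) < ⊤ := by
    intro F hF hlt
    have hwm := hwc.measurable
    have hm : Measurable fun p : ℝ × ℝ => ‖w p.1 * F p‖ₑ ^ 2 := by fun_prop
    have h2 := ENNReal.pow_lt_top (n := 2) hlt
    rw [l2norm_sq, Measure.volume_eq_prod, lintegral_prod_symm _ hm.aemeasurable] at h2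
    filter_upwards [ae_lt_top hm.lintegral_prod_left' h2.ne] with y hy
    exact l2norm_lt_top_of_lintegral hy
  have htr : ∀ n : ℕ, ∀ᵐ y, ∀ᵐ x, 0 < y → G (x + 1 / ((n : ℝ) + 1), y) - G (x, y) =
      ∫ τ in Ioc 0 (1 / ((n : ℝ) + 1)), G₁ (x + τ, y) := by
    intro n
    have h1 := ae_sub_eq_integral_of_weak_deriv
      (locallyIntegrable_of_l2norm_mul_lt_top hwc hw.pos h.measurable h.lt_top) h.measurable
      (locallyIntegrable_of_l2norm_mul_lt_top hwc hw.pos h.measurable₁ h.lt_top₁) h.measurable₁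
      isOpen_upperHalf (v := (1, 0)) (fun x hx τ hτ => by simpa using hx) h.weak₁
      (h := 1 / ((n : ℝ) + 1)) (by positivity)
    have h2 : ∀ᵐ p : ℝ × ℝ, p.swap ∈ {x : ℝ × ℝ | 0 < x.2} →
        G (p.swap + (1 / ((n : ℝ) + 1)) • (1, 0)) - G p.swap =
          ∫ τ in Ioc 0 (1 / ((n : ℝ) + 1)), G₁ (p.swap + τ • (1, 0)) :=
      Measure.measurePreserving_swap.quasiMeasurePreserving.ae h1
    have h3 := Measure.ae_ae_of_ae_prod h2
    filter_upwards [h3] with y hy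
    filter_upwards [hy] with x hx hy0
    simpa using hx hy0
  filter_upwards [hsl h.measurable h.lt_top, hsl h.measurable₁ h.lt_top₁, ae_all_iff.2 htr]
    with y hy hy1 hy2 hy0
  refine ⟨hy, fun φ φ' hφ => ?_⟩
  have m0 := h.measurable
  have m1 := h.measurable₁
  refine hw.integral_mul_deriv_of_translation (a := fun x => G (x, y)) (b := fun x => G₁ (x, y))
    (by fun_prop) (by fun_prop) hy hy1 (fun n => ?_) hφ
  filter_upwards [hy2 n] with x hx
  exact hx hy0

/-- Here `T = G(·, y) - ∫₀^y G₂(·, τ) dτ`, and one `x`-derivative of the flow is moved onto `G(·,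
y)`. -/
theorem ae_enorm_integral_stripTrace_mul_le (hw : IsTemperedWeight A N w) (hδ : 0 < δ)
    (h : IsStripSobolev w δ G G₁ G₂) :
    ∀ᵐ y ∂volume.restrict (Ioi (0 : ℝ)), ∀ j (ψ : 𝓢(ℝ, ℂ)),
      ‖∫ x, (stripTrace δ G₂ x : ℂ) * heatOp (j + 2) y ψ x‖ₑ ≤
        (∫⁻ x, ‖G₁ (x, y)‖ₑ * ‖heatOp (j + 1) y ψ x‖ₑ) +
          ∫⁻ x, (∫⁻ τ in Ioc 0 y, ‖G₂ (x, τ)‖ₑ) * ‖heatOp (j + 2) y ψ x‖ₑ := by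
  have hT := measurable_stripTrace δ h.measurable₂
  have hT2 : l2norm volume (fun x => ‖w x * stripTrace δ G₂ x‖ₑ) < ⊤ :=
    (l2norm_mul_stripTrace_le hw.continuous hδ.le h.measurable₂).trans_lt
      (ENNReal.mul_lt_top ENNReal.ofReal_lt_top h.lt_top₂)
  have h1 : ∀ᵐ p : ℝ × ℝ, 0 < p.1 →
      G p.swap = stripTrace δ G₂ p.2 + ∫ τ in Ioc 0 p.1, G₂ (p.2, τ) :=
    Measure.measurePreserving_swap.quasiMeasurePreserving.ae
      (h.ae_eq_stripTrace_add hw.continuous hw.pos hδ)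
  have h2 := Measure.ae_ae_of_ae_prod h1
  rw [ae_restrict_iff' measurableSet_Ioi]
  filter_upwards [h2, h.ae_integral_mul_deriv_slice hw] with y hy hy' hy0 j ψ
  obtain ⟨hfin, hparts⟩ := hy' hy0
  have hGm : Measurable fun x => G (x, y) := h.measurable.comp (by fun_prop)
  have iT := hw.integrable_mul_schwartz hT hT2 (heatOp (j + 2) y ψ)
  have iG := hw.integrable_mul_schwartz hGm hfin (heatOp (j + 2) y ψ)
  have hD := hparts (heatOp (j + 1) y ψ) (heatOp (j + 2) y ψ)
    (fun x => hasDerivAt_heatOp (j + 1) y ψ x)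
  have hsplit : ∫ x, (stripTrace δ G₂ x : ℂ) * heatOp (j + 2) y ψ x =
      -(∫ x, (G₁ (x, y) : ℂ) * heatOp (j + 1) y ψ x) -
        ∫ x, ((∫ τ in Ioc 0 y, G₂ (x, τ) : ℝ) : ℂ) * heatOp (j + 2) y ψ x := by
    have e : ∀ᵐ x, ((∫ τ in Ioc 0 y, G₂ (x, τ) : ℝ) : ℂ) * heatOp (j + 2) y ψ x =
        (G (x, y) : ℂ) * heatOp (j + 2) y ψ x -
          (stripTrace δ G₂ x : ℂ) * heatOp (j + 2) y ψ x := by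
      filter_upwards [hy] with x hx
      have := hx hy0
      simp only [Prod.swap_prod_mk] at this
      rw [this, ← sub_mul]
      push_cast
      ring
    rw [integral_congr_ae e, integral_sub iG iT, hD]
    ring
  rw [hsplit]
  refine enorm_sub_le.trans ?_
  rw [enorm_neg]
  have hen : ∀ r : ℝ, ‖(r : ℂ)‖ₑ = ‖r‖ₑ := fun r => by
    rw [← ofReal_norm, ← ofReal_norm, Complex.norm_real]
  gcongr
  · refine (enorm_integral_le_lintegral_enorm _).trans (le_of_eq (lintegral_congr fun x => ?_))
    rw [enorm_mul, hen]
  · refine (enorm_integral_le_lintegral_enorm _).trans (lintegral_mono fun x => ?_)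
    rw [enorm_mul, hen]
    gcongr
    exact enorm_integral_le_lintegral_enorm _

end IsStripSobolev

/-- The term with `w T` is absorbed by `√δ` times the norm of `w G₂`, by Cauchy-Schwarz on `(0, δ]`.
-/
theorem exists_enorm_integral_stripTrace_le {A : ℝ} (hA : 0 ≤ A) (N : ℕ) {δ : ℝ} (hδ : 0 < δ) :
    ∃ C : ℝ, 0 < C ∧ ∀ (w : ℝ → ℝ) (G G₁ G₂ : ℝ × ℝ → ℝ), IsTemperedWeight A N w →
      IsStripSobolev w δ G G₁ G₂ → ∀ v : 𝓢(ℝ, ℂ),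
      ‖∫ x, (stripTrace δ G₂ x : ℂ) * symbolOp (fun ξ => (quarterSymbol ξ : ℂ))
          (SchwartzMap.smulLeftCLM ℂ (fun x => (w x : ℂ)) v) x‖ₑ ≤
        ENNReal.ofReal C * (l2norm volume (fun x : ℝ × ℝ => ‖w x.1 * G₁ x‖ₑ) +
          l2norm volume (fun x : ℝ × ℝ => ‖w x.1 * G₂ x‖ₑ)) * l2norm volume (fun x => ‖v x‖ₑ) := by
  obtain ⟨C, hC, h⟩ := exists_enorm_integral_mul_quarter_le hA N
  refine ⟨C * (Real.sqrt δ + 1), by positivity, fun w G G₁ G₂ hw hG v => ?_⟩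
  have hT := measurable_stripTrace δ hG.measurable₂
  have hTle := IsStripSobolev.l2norm_mul_stripTrace_le hw.continuous hδ.le hG.measurable₂
  have hT2 := hTle.trans_lt (ENNReal.mul_lt_top ENNReal.ofReal_lt_top hG.lt_top₂)
  refine (h w hw _ G₁ G₂ hT hG.measurable₁ hG.measurable₂ hT2
    (hG.ae_enorm_integral_stripTrace_mul_le hw hδ) v).trans ?_
  rw [ENNReal.ofReal_mul hC.le, mul_assoc (ENNReal.ofReal C) (ENNReal.ofReal _)]
  gcongr
  have s1 := IsStripSobolev.l2norm_slices_le hw.continuous hG.measurable₁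
  have s2 := IsStripSobolev.l2norm_slices_le hw.continuous hG.measurable₂
  rw [ENNReal.ofReal_add (Real.sqrt_nonneg _) zero_le_one, ENNReal.ofReal_one]
  refine (add_le_add (add_le_add hTle s1) s2).trans ?_
  rw [add_mul, one_mul, mul_add, add_assoc]
  gcongr
  exact le_add_self

/-! ### Flattening the boundary -/

section

open scoped Convolution

/-- The derivative first falls on the mollifier; integration by parts for Lipschitz functions
transfers it to `f`. -/
theorem LipschitzWith.deriv_normed_convolution {f : ℝ → ℝ} {L : ℝ≥0} (hf : LipschitzWith L f)
    (φ : ContDiffBump (0 : ℝ)) (x : ℝ) :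
    deriv (φ.normed volume ⋆[ContinuousLinearMap.lsmul ℝ ℝ, volume] f) x =
      (φ.normed volume ⋆[ContinuousLinearMap.lsmul ℝ ℝ, volume] (deriv f)) x := by
  have hφ : ContDiff ℝ ∞ (φ.normed volume) := φ.contDiff_normed
  have hd := (φ.hasCompactSupport_normed (μ := volume)).hasDerivAt_convolution_left
    (ContinuousLinearMap.lsmul ℝ ℝ) (hφ.of_le (by simp))
    (hf.continuous.locallyIntegrable (μ := volume)) x
  rw [hd.deriv, convolution_eq_swap, convolution_eq_swap]
  have hg : ContDiff ℝ ∞ fun t => φ.normed volume (x - t) := hφ.comp (by fun_prop)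
  have hgc : HasCompactSupport fun t => φ.normed volume (x - t) :=
    (φ.hasCompactSupport_normed (μ := volume)).comp_homeomorph (Homeomorph.subLeft x)
  obtain ⟨D, hD⟩ := ContDiff.lipschitzWith_of_hasCompactSupport hgc hg (by simp)
  have := hf.integral_lineDeriv_mul_eq (μ := volume) hD hgc 1
  simp only [ContinuousLinearMap.lsmul_apply, smul_eq_mul]
  rw [show (∫ t, φ.normed volume (x - t) * deriv f t) =
      ∫ t, lineDeriv ℝ f t 1 * φ.normed volume (x - t) from ?_, this]
  · refine integral_congr_ae (Eventually.of_forall fun t => ?_)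
    dsimp only
    congr 1
    have h1 : HasDerivAt (fun t => φ.normed volume (x - t))
        (-deriv (φ.normed volume) (x - t)) t := by
      have h2 := ((hφ.differentiable (by simp)).differentiableAt (x := x - t)).hasDerivAt
      have h3 := h2.scomp t ((hasDerivAt_id t).const_sub x)
      rw [neg_smul, one_smul] at h3
      exact h3
    rw [h1.differentiableAt.lineDeriv_eq_fderiv, map_neg, fderiv_apply_one_eq_deriv, h1.deriv,
      neg_neg]
  · refine integral_congr_ae (Eventually.of_forall fun t => ?_)
    dsimp only
    rw [mul_comm]
    congr 1
    simp [lineDeriv, deriv_comp_const_add]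

/-- A Lipschitz function on the line is the uniform limit of smooth functions with the same
Lipschitz constant, whose derivatives converge almost everywhere. -/
theorem LipschitzWith.exists_smooth_approx {f : ℝ → ℝ} {L : ℝ≥0} (hf : LipschitzWith L f) :
    ∃ F : ℕ → ℝ → ℝ, (∀ n, ContDiff ℝ ∞ (F n)) ∧ (∀ n x, |f x - F n x| ≤ 1 / ((n : ℝ) + 1)) ∧
      (∀ n x, |deriv (F n) x| ≤ L) ∧
      ∀ᵐ x, Tendsto (fun n => deriv (F n) x) atTop (𝓝 (deriv f x)) := by
  -- Mollifying at this radius moves an `L`-Lipschitz function by at most `1/(n+1)`; `L + 1` avoids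
  -- division by zero.
  have hr : ∀ n : ℕ, 0 < 1 / ((L + 1 : ℝ) * ((n : ℝ) + 1)) := fun n => by positivity
  let φ : ℕ → ContDiffBump (0 : ℝ) := fun n =>
    ⟨1 / ((L + 1 : ℝ) * ((n : ℝ) + 1)) / 2, 1 / ((L + 1 : ℝ) * ((n : ℝ) + 1)),
      half_pos (hr n), half_lt_self (hr n)⟩
  refine ⟨fun n => (φ n).normed volume ⋆[ContinuousLinearMap.lsmul ℝ ℝ, volume] f, fun n => ?_,
    fun n x => ?_, fun n x => ?_, ?_⟩
  · exact (φ n).hasCompactSupport_normed.contDiff_convolution_left _ (φ n).contDiff_normed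
      hf.continuous.locallyIntegrable
  · rw [abs_sub_comm, ← Real.dist_eq]
    refine (φ n).dist_normed_convolution_le hf.continuous.aestronglyMeasurable fun z hz => ?_
    refine (hf.dist_le_mul z x).trans ?_
    have h1 : dist z x ≤ 1 / ((L + 1 : ℝ) * ((n : ℝ) + 1)) := (Metric.mem_ball.1 hz).le
    calc (L : ℝ) * dist z x ≤ (L + 1) * (1 / ((L + 1 : ℝ) * ((n : ℝ) + 1))) := by
          gcongr
          linarith
      _ = _ := by field_simp
  · rw [hf.deriv_normed_convolution, ← Real.norm_eq_abs, convolution_def]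
    refine (norm_integral_le_of_norm_le (g := fun t => (φ n).normed volume t * L)
      ((φ n).integrable_normed.mul_const _) (Eventually.of_forall fun t => ?_)).trans ?_
    · rw [ContinuousLinearMap.lsmul_apply, norm_smul,
        Real.norm_of_nonneg ((φ n).nonneg_normed t)]
      gcongr
      · exact (φ n).nonneg_normed t
      · exact norm_deriv_le_of_lipschitz hf
    · rw [integral_mul_const, (φ n).integral_normed, one_mul]
  · have hli : LocallyIntegrable (deriv f) :=
      (memLp_top_of_bound (measurable_deriv f).aestronglyMeasurable L
        (Eventually.of_forall fun _ => norm_deriv_le_of_lipschitz hf)).locallyIntegrable le_top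
    have h := ContDiffBump.ae_convolution_tendsto_right_of_locallyIntegrable (φ := φ) (K := 2)
      (l := atTop) ?_ ?_ hli
    · filter_upwards [h] with x hx
      simp_rw [hf.deriv_normed_convolution]
      exact hx
    · have := (tendsto_one_div_add_atTop_nhds_zero_nat (𝕜 := ℝ)).const_mul (1 / (L + 1 : ℝ))
      rw [mul_zero] at this
      refine this.congr fun n => ?_
      simp only [φ]
      field_simp
    · refine Eventually.of_forall fun n => le_of_eq ?_
      simp only [φ]
      ring

end

/-- The homeomorphism `(x, y) ↦ (x, f x + σ y)` of the plane, which maps the line `y = 0` onto the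
graph of `f`. -/
def graphHomeo (f : ℝ → ℝ) (hf : Continuous f) (σ : ℝ) (hσ : σ * σ = 1) : ℝ × ℝ ≃ₜ ℝ × ℝ where
  toFun p := (p.1, f p.1 + σ * p.2)
  invFun p := (p.1, σ * (p.2 - f p.1))
  left_inv p := by
    ext
    · rfl
    · simp [← mul_assoc, hσ]
  right_inv p := by
    ext
    · rfl
    · simp [← mul_assoc, hσ]
  continuous_toFun := by fun_prop
  continuous_invFun := by fun_prop

theorem graphHomeo_apply (f : ℝ → ℝ) (hf : Continuous f) (σ : ℝ) (hσ : σ * σ = 1) (p : ℝ × ℝ) :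
    graphHomeo f hf σ hσ p = (p.1, f p.1 + σ * p.2) := rfl

theorem graphHomeo_symm_apply (f : ℝ → ℝ) (hf : Continuous f) (σ : ℝ) (hσ : σ * σ = 1)
    (p : ℝ × ℝ) : (graphHomeo f hf σ hσ).symm p = (p.1, σ * (p.2 - f p.1)) := rfl

theorem measurePreserving_graphHomeo (f : ℝ → ℝ) (hf : Continuous f) (σ : ℝ) (hσ : σ * σ = 1) :
    MeasurePreserving (graphHomeo f hf σ hσ) := by
  refine (MeasurePreserving.id (volume : Measure ℝ)).skew_product (μb := volume) (μd := volume)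
    (g := fun x y => f x + σ * y)
    (Continuous.measurable (by fun_prop)) (Eventually.of_forall fun x => ?_)
  rcases mul_self_eq_one_iff.1 hσ with rfl | rfl
  · simp only [one_mul]
    exact map_add_left_eq_self volume (f x)
  · simp only [neg_one_mul, ← sub_eq_add_neg]
    exact (Measure.measurePreserving_sub_left volume (f x)).map_eq

theorem tendsto_integral_mul_of_isCompact {a : ℝ × ℝ → ℝ} (ha : LocallyIntegrable a)
    {K : Set (ℝ × ℝ)} (hK : IsCompact K) {m : ℕ → ℝ × ℝ → ℝ} {m' : ℝ × ℝ → ℝ} {M : ℝ}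
    (hm : ∀ᶠ n in atTop, Measurable (m n)) (hM : ∀ᶠ n in atTop, ∀ p, |m n p| ≤ M)
    (hK0 : ∀ᶠ n in atTop, ∀ p ∉ K, m n p = 0)
    (hlim : ∀ᵐ p, Tendsto (fun n => m n p) atTop (𝓝 (m' p))) :
    Tendsto (fun n => ∫ p, a p * m n p) atTop (𝓝 (∫ p, a p * m' p)) := by
  have hi : Integrable (K.indicator fun p => ‖a p‖ * M) :=
    (integrable_indicator_iff hK.measurableSet).2
      ((ha.integrableOn_isCompact hK).norm.mul_const M)
  refine tendsto_integral_filter_of_dominated_convergence _ ?_ ?_ hi ?_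
  · filter_upwards [hm] with n hn
    exact ha.aestronglyMeasurable.mul hn.aestronglyMeasurable
  · filter_upwards [hM, hK0] with n hn hn0
    refine Eventually.of_forall fun p => ?_
    by_cases hp : p ∈ K
    · rw [indicator_of_mem hp, norm_mul]
      gcongr
      exact hn p
    · rw [indicator_of_notMem hp, hn0 p hp, mul_zero, norm_zero]
  · filter_upwards [hlim] with p hp
    exact hp.const_mul _

section Flatten

variable {f : ℝ → ℝ} {L : ℝ≥0} {σ δ : ℝ}

theorem fderiv_comp_graphHomeo_symm {F : ℝ → ℝ} (hF : ContDiff ℝ ∞ F)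
    (hc : Continuous F) (hσ : σ * σ = 1)
    {Ξ : ℝ × ℝ → ℝ} (hΞ : ContDiff ℝ ∞ Ξ) (p v : ℝ × ℝ) :
    fderiv ℝ (Ξ ∘ (graphHomeo F hc σ hσ).symm) p v =
      fderiv ℝ Ξ ((graphHomeo F hc σ hσ).symm p)
        (v.1, σ * (v.2 - deriv F p.1 * v.1)) := by
  have h1 : HasFDerivAt (fun q : ℝ × ℝ => (q.1, σ * (q.2 - F q.1)))
      ((ContinuousLinearMap.fst ℝ ℝ ℝ).prod
        (σ • (ContinuousLinearMap.snd ℝ ℝ ℝ - deriv F p.1 • ContinuousLinearMap.fst ℝ ℝ ℝ))) p := by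
    refine hasFDerivAt_fst.prodMk ((hasFDerivAt_snd.sub ?_).const_mul σ)
    exact ((hF.differentiable (by simp)).differentiableAt (x := p.1)).hasDerivAt.comp_hasFDerivAt p
      hasFDerivAt_fst
  have h2 := ((hΞ.differentiable (by simp)).differentiableAt
    (x := (p.1, σ * (p.2 - F p.1)))).hasFDerivAt.comp p h1
  have h3 := h2.fderiv
  rw [show (Ξ ∘ (graphHomeo F hc σ hσ).symm) =
    Ξ ∘ (fun q : ℝ × ℝ => (q.1, σ * (q.2 - F q.1))) from rfl, h3]
  simp [graphHomeo_symm_apply]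

theorem tsupport_comp_graphHomeo_symm {F : ℝ → ℝ} (hF : Continuous F) (hσ : σ * σ = 1)
    (Ξ : ℝ × ℝ → ℝ) : tsupport (Ξ ∘ (graphHomeo F hF σ hσ).symm) =
      (graphHomeo F hF σ hσ).symm ⁻¹' tsupport Ξ :=
  tsupport_comp_eq_preimage Ξ (graphHomeo F hF σ hσ).symm

/-- Weak derivatives in the flattened coordinates. -/
theorem weak_deriv_comp_graphHomeo (hf : LipschitzWith L f) (hσ : σ * σ = 1)
    {Ω : Set (ℝ × ℝ)} (hΩ : ∀ p : ℝ × ℝ, p.2 ∈ Ioo 0 δ → graphHomeo f hf.continuous σ hσ p ∈ Ω)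
    {g g₁ g₂ : ℝ × ℝ → ℝ}
    (ha : LocallyIntegrable fun p => g (graphHomeo f hf.continuous σ hσ p))
    (ha₁ : LocallyIntegrable fun p => g₁ (graphHomeo f hf.continuous σ hσ p))
    (ha₂ : LocallyIntegrable fun p => g₂ (graphHomeo f hf.continuous σ hσ p))
    (h₁ : ∀ φ : ℝ × ℝ → ℝ, ContDiff ℝ ∞ φ → HasCompactSupport φ → tsupport φ ⊆ Ω →
      ∫ x, g x * fderiv ℝ φ x (1, 0) = -∫ x, g₁ x * φ x)
    (h₂ : ∀ φ : ℝ × ℝ → ℝ, ContDiff ℝ ∞ φ → HasCompactSupport φ → tsupport φ ⊆ Ω →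
      ∫ x, g x * fderiv ℝ φ x (0, 1) = -∫ x, g₂ x * φ x)
    {Ξ : ℝ × ℝ → ℝ} (hΞ : ContDiff ℝ ∞ Ξ) (hΞc : HasCompactSupport Ξ)
    (hΞδ : tsupport Ξ ⊆ {p | p.2 ∈ Ioo 0 δ}) :
    (∫ p, g (graphHomeo f hf.continuous σ hσ p) * fderiv ℝ Ξ p (1, 0) =
      -∫ p, (g₁ (graphHomeo f hf.continuous σ hσ p) +
        deriv f p.1 * g₂ (graphHomeo f hf.continuous σ hσ p)) * Ξ p) ∧
    (∫ p, g (graphHomeo f hf.continuous σ hσ p) * fderiv ℝ Ξ p (0, 1) =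
      -∫ p, (σ * g₂ (graphHomeo f hf.continuous σ hσ p)) * Ξ p) := by
  -- A test function composed with the inverse of `Φ` is only Lipschitz, hence not admissible. The
  -- shear along the smooth `F n` replaces it; read in the coordinates of `Φ`, this evaluates `Ξ` at
  -- the perturbed point `s n p`, which tends to `p`.
  obtain ⟨F, hFs, hFf, hFd, hFlim⟩ := hf.exists_smooth_approx
  set Φ := graphHomeo f hf.continuous σ hσ with hΦ
  have hmp := measurePreserving_graphHomeo f hf.continuous σ hσ
  have hemb := Φ.measurableEmbedding
  set s : ℕ → ℝ × ℝ → ℝ × ℝ := fun n p => (p.1, p.2 + σ * (f p.1 - F n p.1)) with hs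
  have hfc := hf.continuous
  have hFc : ∀ n, Continuous (F n) := fun n => (hFs n).continuous
  have hsc : ∀ n, Continuous (s n) := fun n => by
    have := hFc n
    fun_prop
  have hsΦ : ∀ n p, (graphHomeo (F n) (hFc n) σ hσ).symm (Φ p) = s n p := by
    intro n p
    simp only [hΦ, graphHomeo_symm_apply, graphHomeo_apply, hs]
    congr 1
    linear_combination p.2 * hσ
  have hσ1 : |σ| = 1 := by
    rcases mul_self_eq_one_iff.1 hσ with rfl | rfl <;> simp
  have he : ∀ n x, |σ * (f x - F n x)| ≤ 1 / ((n : ℝ) + 1) := fun n x => by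
    rw [abs_mul, hσ1, one_mul]; exact hFf n x
  have hslim : ∀ p, Tendsto (fun n => s n p) atTop (𝓝 p) := by
    intro p
    have h0 : Tendsto (fun n => σ * (f p.1 - F n p.1)) atTop (𝓝 0) :=
      squeeze_zero_norm (fun n => he n p.1) tendsto_one_div_add_atTop_nhds_zero_nat
    have h1 := (tendsto_const_nhds (x := p.1)).prodMk_nhds
      ((tendsto_const_nhds (x := p.2)).add h0)
    simpa [hs] using h1
  -- a compact set containing all supports
  have key : ∀ Ξ : ℝ × ℝ → ℝ, ContDiff ℝ ∞ Ξ → HasCompactSupport Ξ →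
      tsupport Ξ ⊆ {p | p.2 ∈ Ioo 0 δ} →
      (∃ K, IsCompact K ∧ ∀ n p, p ∉ K → s n p ∉ tsupport Ξ) ∧
      ∀ᶠ n in atTop, (∫ p, g (Φ p) * (fderiv ℝ Ξ (s n p) (1, 0) -
          σ * deriv (F n) p.1 * fderiv ℝ Ξ (s n p) (0, 1)) = -∫ p, g₁ (Φ p) * Ξ (s n p)) ∧
        σ * ∫ p, g (Φ p) * fderiv ℝ Ξ (s n p) (0, 1) = -∫ p, g₂ (Φ p) * Ξ (s n p) := by
    intro Ξ hΞ hΞc hΞδ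
    constructor
    · refine ⟨(fun q : (ℝ × ℝ) × ℝ => (q.1.1, q.1.2 - q.2)) '' (tsupport Ξ ×ˢ Icc (-1) 1),
        (hΞc.isCompact.prod isCompact_Icc).image (by fun_prop), fun n p hp hsp => hp ?_⟩
      refine ⟨(s n p, σ * (f p.1 - F n p.1)), ⟨hsp, ?_⟩, ?_⟩
      · rw [← Set.mem_ofPred_eq (p := fun x => x ∈ Icc (-1 : ℝ) 1), Set.mem_ofPred_eq, mem_Icc,
          ← abs_le]
        refine (he n p.1).trans ?_
        rw [div_le_one (by positivity)]
        linarith [n.cast_nonneg (α := ℝ)]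
      · simp [hs]
    -- The support keeps a distance `c` from both edges of the strip, so the perturbed supports
    -- remain in `Ω` once `1/(n+1) < c`.
    · obtain ⟨c, hc, hcK⟩ : ∃ c > 0, ∀ p ∈ tsupport Ξ, c ≤ p.2 ∧ p.2 ≤ δ - c := by
        rcases (tsupport Ξ).eq_empty_or_nonempty with h0 | hne
        · exact ⟨1, one_pos, by simp [h0]⟩
        obtain ⟨p, hp, hpm⟩ := hΞc.isCompact.exists_isMinOn hne
          (f := fun p : ℝ × ℝ => min p.2 (δ - p.2)) (by fun_prop)
        refine ⟨min p.2 (δ - p.2), lt_min (hΞδ hp).1 (sub_pos.2 (hΞδ hp).2), fun q hq => ?_⟩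
        have : min p.2 (δ - p.2) ≤ min q.2 (δ - q.2) := hpm hq
        constructor
        · exact this.trans (min_le_left _ _)
        · linarith [this.trans (min_le_right _ _)]
      have hev : ∀ᶠ n : ℕ in atTop, 1 / ((n : ℝ) + 1) < c :=
        tendsto_one_div_add_atTop_nhds_zero_nat.eventually (gt_mem_nhds hc)
      filter_upwards [hev] with n hn
      set κ := graphHomeo (F n) (hFc n) σ hσ with hκ
      have hψ : ContDiff ℝ ∞ (Ξ ∘ κ.symm) := by
        have h1 := hFs n
        have : ContDiff ℝ ∞ fun q : ℝ × ℝ => (q.1, σ * (q.2 - F n q.1)) := by fun_prop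
        exact hΞ.comp this
      have hψc : HasCompactSupport (Ξ ∘ κ.symm) := hΞc.comp_homeomorph κ.symm
      have hψΩ : tsupport (Ξ ∘ κ.symm) ⊆ Ω := by
        rw [hκ, tsupport_comp_graphHomeo_symm]
        intro x hx
        have h1 := hcK _ hx
        obtain ⟨p, rfl⟩ := Φ.surjective x
        rw [hsΦ] at h1
        have h2 := abs_lt.1 ((he n p.1).trans_lt hn)
        simp only [hs] at h1
        exact hΩ p ⟨by linarith, by linarith⟩
      have e1 := h₁ _ hψ hψc hψΩ
      have e2 := h₂ _ hψ hψc hψΩ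
      have cov : ∀ u : ℝ × ℝ → ℝ, ∫ x, u x = ∫ p, u (Φ p) := fun u =>
        (hmp.integral_comp hemb u).symm
      rw [cov (fun x => g₁ x * (Ξ ∘ κ.symm) x), cov] at e1
      rw [cov (fun x => g₂ x * (Ξ ∘ κ.symm) x), cov] at e2
      simp only [hκ, Function.comp_apply,
        fderiv_comp_graphHomeo_symm (hFs n) (hFc n) hσ hΞ] at e1 e2
      simp only [hsΦ] at e1 e2
      constructor
      · rw [← e1]
        refine integral_congr_ae (Eventually.of_forall fun p => ?_)
        dsimp only
        rw [show ((1 : ℝ), σ * (0 - deriv (F n) (Φ p).1 * 1)) =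
          ((1 : ℝ), (0 : ℝ)) - (σ * deriv (F n) p.1) • ((0 : ℝ), (1 : ℝ)) from ?_, map_sub, map_smul,
          smul_eq_mul]
        ext <;> simp [hΦ, graphHomeo_apply]
      · rw [← e2, ← integral_const_mul]
        refine integral_congr_ae (Eventually.of_forall fun p => ?_)
        dsimp only
        rw [show ((0 : ℝ), σ * (1 - deriv (F n) (Φ p).1 * 0)) = σ • ((0 : ℝ), (1 : ℝ)) from ?_,
          map_smul, smul_eq_mul]
        · ring
        · ext <;> simp
  have bdd : ∀ Ξ : ℝ × ℝ → ℝ, ContDiff ℝ ∞ Ξ → HasCompactSupport Ξ →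
      ∃ M, 0 ≤ M ∧ ∀ p, |Ξ p| ≤ M ∧ |fderiv ℝ Ξ p (1, 0)| ≤ M ∧ |fderiv ℝ Ξ p (0, 1)| ≤ M := by
    intro Ξ hΞ hΞc
    have hD : ∀ v, Continuous fun p => fderiv ℝ Ξ p v := fun v =>
      (hΞ.continuous_fderiv (by simp)).clm_apply continuous_const
    obtain ⟨M0, h0⟩ := hΞc.exists_bound_of_continuous hΞ.continuous
    obtain ⟨M1, h1⟩ := (hΞc.fderiv_apply (𝕜 := ℝ) (1, 0)).exists_bound_of_continuous (hD _)
    obtain ⟨M2, h2⟩ := (hΞc.fderiv_apply (𝕜 := ℝ) (0, 1)).exists_bound_of_continuous (hD _)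
    exact ⟨max M0 (max M1 M2), (norm_nonneg _).trans ((h0 0).trans (le_max_left _ _)), fun p =>
      ⟨(h0 p).trans (le_max_left _ _),
        (h1 p).trans ((le_max_left _ _).trans (le_max_right _ _)),
        (h2 p).trans ((le_max_right _ _).trans (le_max_right _ _))⟩⟩
  have zero : ∀ Ξ : ℝ × ℝ → ℝ, ∀ p ∉ tsupport Ξ, Ξ p = 0 ∧ ∀ v, fderiv ℝ Ξ p v = 0 := by
    intro Ξ p hp
    refine ⟨image_eq_zero_of_notMem_tsupport hp, fun v => ?_⟩
    have : fderiv ℝ Ξ p = 0 := by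
      by_contra hcon
      exact hp (support_fderiv_subset ℝ hcon)
    rw [this]; rfl
  have vert : ∀ Ξ : ℝ × ℝ → ℝ, ContDiff ℝ ∞ Ξ → HasCompactSupport Ξ →
      tsupport Ξ ⊆ {p | p.2 ∈ Ioo 0 δ} →
      σ * ∫ p, g (Φ p) * fderiv ℝ Ξ p (0, 1) = -∫ p, g₂ (Φ p) * Ξ p := by
    intro Ξ hΞ hΞc hΞδ
    obtain ⟨⟨K, hK, hKs⟩, hev⟩ := key Ξ hΞ hΞc hΞδ
    obtain ⟨M, hM0, hM⟩ := bdd Ξ hΞ hΞc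
    have hD : Continuous fun p => fderiv ℝ Ξ p (0, 1) :=
      (hΞ.continuous_fderiv (by simp)).clm_apply continuous_const
    have l1 := tendsto_integral_mul_of_isCompact ha hK
      (m := fun n p => fderiv ℝ Ξ (s n p) (0, 1)) (m' := fun p => fderiv ℝ Ξ p (0, 1)) (M := M)
      (Eventually.of_forall fun n => (hD.comp (hsc n)).measurable)
      (Eventually.of_forall fun n p => (hM _).2.2)
      (Eventually.of_forall fun n p hp => (zero Ξ _ (hKs n p hp)).2 _)
      (Eventually.of_forall fun p => (hD.tendsto p).comp (hslim p))
    have l2 := tendsto_integral_mul_of_isCompact ha₂ hK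
      (m := fun n p => Ξ (s n p)) (m' := Ξ) (M := M)
      (Eventually.of_forall fun n => (hΞ.continuous.comp (hsc n)).measurable)
      (Eventually.of_forall fun n p => (hM _).1)
      (Eventually.of_forall fun n p hp => (zero Ξ _ (hKs n p hp)).1)
      (Eventually.of_forall fun p => (hΞ.continuous.tendsto p).comp (hslim p))
    refine tendsto_nhds_unique ((l1.const_mul σ).congr' ?_) l2.neg
    filter_upwards [hev] with n hn
    exact hn.2
  obtain ⟨⟨K, hK, hKs⟩, hev⟩ := key Ξ hΞ hΞc hΞδ
  obtain ⟨M, hM0, hM⟩ := bdd Ξ hΞ hΞc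
  have hD : ∀ v, Continuous fun p => fderiv ℝ Ξ p v := fun v =>
    (hΞ.continuous_fderiv (by simp)).clm_apply continuous_const
  have hDm : ∀ n, Measurable fun p : ℝ × ℝ => deriv (F n) p.1 := fun n =>
    (measurable_deriv (F n)).comp measurable_fst
  have hlim' : ∀ᵐ p : ℝ × ℝ, Tendsto (fun n => deriv (F n) p.1) atTop (𝓝 (deriv f p.1)) :=
    Measure.quasiMeasurePreserving_fst.ae hFlim
  have l1 := tendsto_integral_mul_of_isCompact ha hK
    (m := fun n p => fderiv ℝ Ξ (s n p) (1, 0) -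
          σ * deriv (F n) p.1 * fderiv ℝ Ξ (s n p) (0, 1))
    (m' := fun p => fderiv ℝ Ξ p (1, 0) - σ * deriv f p.1 * fderiv ℝ Ξ p (0, 1))
    (M := M + L * M)
    (Eventually.of_forall fun n => ((hD _).comp (hsc n)).measurable.sub
      (((hDm n).const_mul σ).mul ((hD _).comp (hsc n)).measurable))
    (Eventually.of_forall fun n p => by
      refine (abs_sub _ _).trans (add_le_add (hM _).2.1 ?_)
      rw [abs_mul, abs_mul, hσ1, one_mul]
      gcongr
      · exact hFd n p.1
      · exact (hM _).2.2)
    (Eventually.of_forall fun n p hp => by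
      simp only [(zero Ξ _ (hKs n p hp)).2, mul_zero, sub_zero])
    (by
      filter_upwards [hlim'] with p hp
      exact (((hD _).tendsto p).comp (hslim p)).sub
        ((hp.const_mul σ).mul (((hD _).tendsto p).comp (hslim p))))
  have l2 := tendsto_integral_mul_of_isCompact ha₁ hK
      (m := fun n p => Ξ (s n p)) (m' := Ξ) (M := M)
      (Eventually.of_forall fun n => (hΞ.continuous.comp (hsc n)).measurable)
      (Eventually.of_forall fun n p => (hM _).1)
      (Eventually.of_forall fun n p hp => (zero Ξ _ (hKs n p hp)).1)
      (Eventually.of_forall fun p => (hΞ.continuous.tendsto p).comp (hslim p))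
  have hor : ∫ p, g (Φ p) * (fderiv ℝ Ξ p (1, 0) - σ * deriv f p.1 * fderiv ℝ Ξ p (0, 1)) =
      -∫ p, g₁ (Φ p) * Ξ p := by
    refine tendsto_nhds_unique (l1.congr' ?_) l2.neg
    filter_upwards [hev] with n hn
    exact hn.1
  have hdF : ∀ n, ContDiff ℝ ∞ (deriv (F n)) := fun n =>
    ContDiff.iterate_deriv 1 (hFs n)
  -- The term `f' ∂₂Ξ` is converted by the vertical identity. As `f'` is not smooth, this is done
  -- with the test function `F n' Ξ`; `F n'` does not depend on the second variable, so it passes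
  -- through `∂₂`.
  have hmix : ∀ n, σ * ∫ p, g (Φ p) * (deriv (F n) p.1 * fderiv ℝ Ξ p (0, 1)) =
      -∫ p, g₂ (Φ p) * (deriv (F n) p.1 * Ξ p) := by
    intro n
    have hc : ContDiff ℝ ∞ fun p : ℝ × ℝ => deriv (F n) p.1 := (hdF n).comp contDiff_fst
    have h1 := vert (fun p => deriv (F n) p.1 * Ξ p) (hc.mul hΞ) hΞc.mul_left
      ((tsupport_mul_subset_right).trans hΞδ)
    rw [← h1]
    congr 2
    funext p
    congr 1
    have d1 : HasFDerivAt (fun p : ℝ × ℝ => deriv (F n) p.1)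
        (deriv (deriv (F n)) p.1 • ContinuousLinearMap.fst ℝ ℝ ℝ) p :=
      (((hdF n).differentiable (by simp)).differentiableAt (x := p.1)).hasDerivAt.comp_hasFDerivAt p
        hasFDerivAt_fst
    have d2 : HasFDerivAt (fun p => deriv (F n) p.1 * Ξ p) _ p := d1.mul ((hΞ.differentiable (by simp)).differentiableAt (x := p)).hasFDerivAt
    rw [d2.fderiv]
    simp
  have hΞK : ∀ p ∉ tsupport Ξ, Ξ p = 0 := fun p hp => (zero Ξ p hp).1
  have l3 := tendsto_integral_mul_of_isCompact ha hΞc.isCompact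
    (m := fun n p => deriv (F n) p.1 * fderiv ℝ Ξ p (0, 1))
    (m' := fun p => deriv f p.1 * fderiv ℝ Ξ p (0, 1)) (M := L * M)
    (Eventually.of_forall fun n => (hDm n).mul (hD _).measurable)
    (Eventually.of_forall fun n p => by
      rw [abs_mul]
      gcongr
      · exact hFd n p.1
      · exact (hM _).2.2)
    (Eventually.of_forall fun n p hp => by rw [(zero Ξ p hp).2, mul_zero])
    (by
      filter_upwards [hlim'] with p hp
      exact hp.mul_const _)
  have l4 := tendsto_integral_mul_of_isCompact ha₂ hΞc.isCompact
    (m := fun n p => deriv (F n) p.1 * Ξ p)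
    (m' := fun p => deriv f p.1 * Ξ p) (M := L * M)
    (Eventually.of_forall fun n => (hDm n).mul hΞ.continuous.measurable)
    (Eventually.of_forall fun n p => by
      rw [abs_mul]
      gcongr
      · exact hFd n p.1
      · exact (hM _).1)
    (Eventually.of_forall fun n p hp => by rw [hΞK p hp, mul_zero])
    (by
      filter_upwards [hlim'] with p hp
      exact hp.mul_const _)
  have hmix' : σ * ∫ p, g (Φ p) * (deriv f p.1 * fderiv ℝ Ξ p (0, 1)) =
      -∫ p, g₂ (Φ p) * (deriv f p.1 * Ξ p) :=
    tendsto_nhds_unique ((l3.const_mul σ).congr hmix) l4.neg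
  have hdfm : Measurable fun p : ℝ × ℝ => deriv f p.1 :=
    (measurable_deriv f).comp measurable_fst
  have hint : ∀ {a m : ℝ × ℝ → ℝ}, LocallyIntegrable a → Continuous m →
      (∀ p ∉ tsupport Ξ, m p = 0) → Integrable (fun p => a p * m p) := by
    intro a m ha hm hm0
    have := ha.integrable_smul_left_of_hasCompactSupport hm
      (HasCompactSupport.intro hΞc.isCompact hm0)
    simpa [mul_comm] using this
  have hint' : ∀ {a m : ℝ × ℝ → ℝ}, LocallyIntegrable a → Continuous m →
      (∀ p ∉ tsupport Ξ, m p = 0) → Integrable (fun p => a p * (deriv f p.1 * m p)) := by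
    intro a m ha hm hm0
    have h := (hint ha hm hm0).bdd_mul (c := L) hdfm.aestronglyMeasurable
      (Eventually.of_forall fun p => norm_deriv_le_of_lipschitz hf)
    refine h.congr (Eventually.of_forall fun p => ?_)
    dsimp only
    ring
  have zD : ∀ v, ∀ p ∉ tsupport Ξ, fderiv ℝ Ξ p v = 0 := fun v p hp => (zero Ξ p hp).2 v
  constructor
  · have s1 : ∫ p, g (Φ p) * (fderiv ℝ Ξ p (1, 0) - σ * deriv f p.1 * fderiv ℝ Ξ p (0, 1)) =
        (∫ p, g (Φ p) * fderiv ℝ Ξ p (1, 0)) -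
          σ * ∫ p, g (Φ p) * (deriv f p.1 * fderiv ℝ Ξ p (0, 1)) := by
      rw [← integral_const_mul, ← integral_sub (hint ha (hD _) (zD _))
        ((hint' ha (hD _) (zD _)).const_mul σ)]
      refine integral_congr_ae (Eventually.of_forall fun p => ?_)
      dsimp only
      ring
    have s2 : ∫ p, (g₁ (Φ p) + deriv f p.1 * g₂ (Φ p)) * Ξ p =
        (∫ p, g₁ (Φ p) * Ξ p) + ∫ p, g₂ (Φ p) * (deriv f p.1 * Ξ p) := by
      rw [← integral_add (hint ha₁ hΞ.continuous hΞK) (hint' ha₂ hΞ.continuous hΞK)]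
      refine integral_congr_ae (Eventually.of_forall fun p => ?_)
      dsimp only
      ring
    rw [s2]
    linarith
  · have h := vert Ξ hΞ hΞc hΞδ
    have s2 : ∫ p, σ * g₂ (Φ p) * Ξ p = σ * ∫ p, g₂ (Φ p) * Ξ p := by
      rw [← integral_const_mul]
      refine integral_congr_ae (Eventually.of_forall fun p => ?_)
      dsimp only
      ring
    rw [s2]
    linear_combination σ * h - (∫ p, g (Φ p) * fderiv ℝ Ξ p (0, 1)) * hσ

end Flatten

/-! ### The weights -/

namespace IsTemperedWeight

/-- The increment of the product is split in two, with `v z ≤ v x (1 + A₂ d (1 + d)^N₂)`. The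
additional exponent `1` absorbs the factor `d` in this bound. -/
theorem mul {A₁ A₂ : ℝ} {N₁ N₂ : ℕ} {u v : ℝ → ℝ} (hA₁ : 0 ≤ A₁) (hA₂ : 0 ≤ A₂)
    (hu : IsTemperedWeight A₁ N₁ u) (hv : IsTemperedWeight A₂ N₂ v) :
    IsTemperedWeight (A₁ * (1 + A₂) + A₂) (N₁ + N₂ + 1) (fun x => u x * v x) where
  pos x := mul_pos (hu.pos x) (hv.pos x)
  growth := hu.growth.mul hv.growth
  growth_inv := by
    simp_rw [mul_inv]
    exact hu.growth_inv.mul hv.growth_inv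
  abs_sub_le x z := by
    have h1 := hu.abs_sub_le x z
    have h2 := hv.abs_sub_le x z
    have pu := hu.pos x
    have pv := hv.pos x
    set d := |x - z|
    have hd : 0 ≤ d := abs_nonneg _
    have hd1 : 1 ≤ 1 + d := by linarith
    have hvz : |v z| ≤ v x * (1 + A₂ * d * (1 + d) ^ N₂) := by
      have := abs_add_le (v z - v x) (v x)
      rw [sub_add_cancel, abs_of_pos pv] at this
      linarith
    have e1 : (1 + d) ^ N₁ * (1 + A₂ * d * (1 + d) ^ N₂) ≤ (1 + A₂) * (1 + d) ^ (N₁ + N₂ + 1) := by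
      have i1 : (1 + d) ^ N₁ ≤ (1 + d) ^ (N₁ + N₂ + 1) := pow_le_pow_right₀ hd1 (by omega)
      have i2 : d * ((1 + d) ^ N₁ * (1 + d) ^ N₂) ≤ (1 + d) ^ (N₁ + N₂ + 1) := by
        rw [← pow_add, pow_succ, mul_comm]
        gcongr
        linarith
      nlinarith
    have e2 : (1 + d) ^ N₂ ≤ (1 + d) ^ (N₁ + N₂ + 1) := pow_le_pow_right₀ hd1 (by omega)
    calc |u z * v z - u x * v x| = |(u z - u x) * v z + u x * (v z - v x)| := by ring_nf
      _ ≤ |u z - u x| * |v z| + u x * |v z - v x| := by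
          refine (abs_add_le _ _).trans ?_
          rw [abs_mul, abs_mul, abs_of_pos pu]
      _ ≤ (A₁ * d * (1 + d) ^ N₁ * u x) * (v x * (1 + A₂ * d * (1 + d) ^ N₂)) +
          u x * (A₂ * d * (1 + d) ^ N₂ * v x) := by gcongr
      _ = A₁ * d * ((1 + d) ^ N₁ * (1 + A₂ * d * (1 + d) ^ N₂)) * (u x * v x) +
          A₂ * d * (1 + d) ^ N₂ * (u x * v x) := by ring
      _ ≤ A₁ * d * ((1 + A₂) * (1 + d) ^ (N₁ + N₂ + 1)) * (u x * v x) +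
          A₂ * d * (1 + d) ^ (N₁ + N₂ + 1) * (u x * v x) := by gcongr
      _ = _ := by ring

/-- The constants do not change under translation. This is the source of the uniformity in `t`. -/
theorem comp_add_const {A : ℝ} {N : ℕ} {w : ℝ → ℝ} (hw : IsTemperedWeight A N w) (c : ℝ) :
    IsTemperedWeight A N (fun x => w (x + c)) where
  pos x := hw.pos _
  growth := hw.growth.comp (by fun_prop)
  growth_inv := hw.growth_inv.comp (g := fun x => (w x)⁻¹) (f := fun x => x + c) (by fun_prop)
  abs_sub_le x z := by simpa using hw.abs_sub_le (x + c) (z + c)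

end IsTemperedWeight

theorem Real.rpow_le_rpow_abs_of_le {q M : ℝ} (hq : 0 < q) (h1 : q ≤ M) (h2 : q⁻¹ ≤ M) (s : ℝ) :
    q ^ s ≤ M ^ |s| := by
  rcases le_total 0 s with hs | hs
  · rw [abs_of_nonneg hs]
    exact Real.rpow_le_rpow hq.le h1 hs
  · rw [abs_of_nonpos hs, ← inv_inv q, Real.inv_rpow (inv_nonneg.2 hq.le),
      ← Real.rpow_neg (inv_nonneg.2 hq.le)]
    exact Real.rpow_le_rpow (inv_nonneg.2 hq.le) h2 (by linarith)

theorem one_add_sq_le_mul (x z : ℝ) : 1 + z ^ 2 ≤ (2 * (1 + |x - z|)) ^ 2 * (1 + x ^ 2) := by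
  have h : z ^ 2 ≤ 2 * x ^ 2 + 2 * |x - z| ^ 2 := by
    rw [sq_abs]
    nlinarith [sq_nonneg (2 * x - z)]
  nlinarith [abs_nonneg (x - z), sq_nonneg x, sq_nonneg (|x - z|),
    mul_nonneg (abs_nonneg (x - z)) (sq_nonneg x),
    mul_nonneg (sq_nonneg (|x - z|)) (sq_nonneg x)]

/-- Peetre's inequality. The elementary comparison is symmetric in `x` and `z`, which covers both
signs of `r`. -/
theorem one_add_sq_rpow_le (r x z : ℝ) :
    (1 + z ^ 2) ^ (r / 2) ≤ (2 * (1 + |x - z|)) ^ ⌈|r|⌉₊ * (1 + x ^ 2) ^ (r / 2) := by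
  have px : 0 < 1 + x ^ 2 := by positivity
  have pz : 0 < 1 + z ^ 2 := by positivity
  have pd : 0 ≤ |x - z| := abs_nonneg _
  have h1 : (1 + z ^ 2) / (1 + x ^ 2) ≤ (2 * (1 + |x - z|)) ^ 2 :=
    (div_le_iff₀ px).2 (one_add_sq_le_mul x z)
  have h2 : ((1 + z ^ 2) / (1 + x ^ 2))⁻¹ ≤ (2 * (1 + |x - z|)) ^ 2 := by
    rw [inv_div]
    have := (div_le_iff₀ pz).2 (one_add_sq_le_mul z x)
    rwa [abs_sub_comm] at this
  have h := Real.rpow_le_rpow_abs_of_le (div_pos pz px) h1 h2 (r / 2)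
  rw [Real.div_rpow pz.le px.le, div_le_iff₀ (Real.rpow_pos_of_pos px _)] at h
  refine h.trans ?_
  gcongr
  rw [← Real.rpow_natCast (2 * (1 + |x - z|)) 2, ← Real.rpow_mul (by positivity),
    ← Real.rpow_natCast]
  refine Real.rpow_le_rpow_of_exponent_le (by linarith) ?_
  rw [abs_div, abs_two]
  refine le_trans (le_of_eq ?_) (Nat.le_ceil _)
  push_cast
  ring

/-- The logarithmic derivative of this weight is bounded by `|r|`. The mean value inequality then
applies, with Peetre's inequality comparing intermediate points to `x`. -/
theorem isTemperedWeight_one_add_sq_rpow (r : ℝ) :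
    IsTemperedWeight (|r| * 2 ^ ⌈|r|⌉₊) ⌈|r|⌉₊ (fun x => (1 + x ^ 2) ^ (r / 2)) where
  pos x := by positivity
  growth := by simpa using Function.hasTemperateGrowth_one_add_norm_sq_rpow ℝ (r / 2)
  growth_inv := by
    have := Function.hasTemperateGrowth_one_add_norm_sq_rpow ℝ (-(r / 2))
    have e : (fun x : ℝ => ((1 + x ^ 2) ^ (r / 2))⁻¹) = fun x => (1 + ‖x‖ ^ 2) ^ (-(r / 2)) := by
      funext x
      rw [Real.rpow_neg (by positivity), Real.norm_eq_abs, sq_abs]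
    rwa [e]
  abs_sub_le x z := by
    have hd : ∀ s : ℝ, HasDerivAt (fun s : ℝ => (1 + s ^ 2) ^ (r / 2))
        (r * s * (1 + s ^ 2) ^ (r / 2 - 1)) s := by
      intro s
      have h1 : HasDerivAt (fun s : ℝ => 1 + s ^ 2) (2 * s) s := by
        simpa using (hasDerivAt_pow 2 s).const_add 1
      refine (h1.rpow_const (Or.inl (by positivity))).congr_deriv ?_
      ring
    have hb : ∀ s ∈ uIcc x z, ‖r * s * (1 + s ^ 2) ^ (r / 2 - 1)‖ ≤
        |r| * (2 * (1 + |x - z|)) ^ ⌈|r|⌉₊ * (1 + x ^ 2) ^ (r / 2) := by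
      intro s hs
      have ps : 0 < 1 + s ^ 2 := by positivity
      have h1 : |s| * (1 + s ^ 2) ^ (r / 2 - 1) ≤ (1 + s ^ 2) ^ (r / 2) := by
        rw [Real.rpow_sub_one ps.ne', ← mul_div_assoc, div_le_iff₀ ps, mul_comm]
        gcongr
        nlinarith [sq_abs s, sq_nonneg (|s| - 1)]
      have h2 := one_add_sq_rpow_le r x s
      have h3 : |x - s| ≤ |x - z| := by
        rw [abs_sub_comm, abs_sub_comm x z]
        exact abs_sub_left_of_mem_uIcc hs
      rw [norm_mul, norm_mul, Real.norm_eq_abs, Real.norm_eq_abs, Real.norm_of_nonneg (by positivity),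
        mul_assoc, mul_assoc]
      refine mul_le_mul_of_nonneg_left (h1.trans (h2.trans ?_)) (abs_nonneg r)
      gcongr
    have := (convex_uIcc x z).norm_image_sub_le_of_norm_hasDerivWithin_le
      (fun s _ => (hd s).hasDerivWithinAt) hb left_mem_uIcc right_mem_uIcc
    rw [Real.norm_eq_abs, Real.norm_eq_abs, abs_sub_comm z x] at this
    refine this.trans (le_of_eq ?_)
    rw [mul_pow]
    ring

theorem weight_eq (μ ν t x : ℝ) : weight μ ν t x =
    (1 + (x + t) ^ 2) ^ (μ / 2) * (1 + (x + -t) ^ 2) ^ (ν / 2) := by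
  have h : ∀ a r : ℝ, japaneseBracket a ^ r = (1 + a ^ 2) ^ (r / 2) := by
    intro a r
    rw [japaneseBracket, Real.sqrt_eq_rpow, ← Real.rpow_mul (by positivity)]
    congr 1
    ring
  rw [weight, h, h, sub_eq_add_neg]

/-- The weights `⟨w⁺⟩^μ ⟨w⁻⟩^ν` are slowly varying, uniformly in time. -/
theorem exists_isTemperedWeight_weight (μ ν : ℝ) :
    ∃ (A : ℝ) (N : ℕ), 0 ≤ A ∧ ∀ t, IsTemperedWeight A N (weight μ ν t) := by
  have h := fun t => ((isTemperedWeight_one_add_sq_rpow μ).comp_add_const t).mul (by positivity)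
    (by positivity) ((isTemperedWeight_one_add_sq_rpow ν).comp_add_const (-t))
  simp_rw [← weight_eq] at h
  exact ⟨_, _, by positivity, h⟩

/-! ### Domains bounded by a graph -/

/-- Within vertical distance `δ` the graph is the only boundary. Each one-sided strip of height `δ`
is connected and misses the frontier, so it lies in `Ω` as soon as it meets `Ω`; one of them does,
since the graph lies in the closure. Connectedness of `Ω`, which misses the graph, excludes the
other side. -/
theorem IsGraphDomain.exists_side {f : ℝ → ℝ} {δ : ℝ} {Ω : Set (ℝ × ℝ)} (hΩ : IsGraphDomain f δ Ω)
    (hf : Continuous f) (hδ : 0 < δ) :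
    ∃ σ : ℝ, σ * σ = 1 ∧ (∀ x : ℝ × ℝ, σ * (x.2 - f x.1) ∈ Ioo 0 δ → x ∈ Ω) ∧
      ∀ x ∈ Ω, |x.2 - f x.1| < δ → 0 < σ * (x.2 - f x.1) := by
  obtain ⟨hopen, hconn, hfr⟩ := hΩ
  have hgr : ∀ x, (x, f x) ∈ frontier Ω := by
    intro x
    rcases hfr with h | ⟨b, -, h⟩ <;> rw [h]
    · rfl
    · exact Or.inl rfl
  have hnear : ∀ x : ℝ × ℝ, |x.2 - f x.1| < δ → x ∈ frontier Ω → x.2 = f x.1 := by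
    intro x hx hxf
    rcases hfr with h | ⟨b, hb, h⟩ <;> rw [h] at hxf
    · exact hxf
    · rcases hxf with hxf | hxf
      · exact hxf
      · have h1 := hb x.1
        rw [← show x.2 = b from hxf, abs_sub_comm] at h1
        linarith
  have hdisj : ∀ x ∈ Ω, x.2 ≠ f x.1 := by
    intro x hx he
    have := hgr x.1
    rw [← he, hopen.frontier_eq] at this
    exact this.2 hx
  have hside : ∀ σ : ℝ, σ * σ = 1 → (∃ x ∈ Ω, σ * (x.2 - f x.1) ∈ Ioo 0 δ) →
      ∀ x : ℝ × ℝ, σ * (x.2 - f x.1) ∈ Ioo 0 δ → x ∈ Ω := by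
    rintro σ hσ ⟨z, hz, hzδ⟩ x hx
    have hpre : IsPreconnected {x : ℝ × ℝ | σ * (x.2 - f x.1) ∈ Ioo 0 δ} := by
      have h1 := ((isPreconnected_univ (α := ℝ)).prod (isPreconnected_Ioo (a := 0) (b := δ))).image
        (graphHomeo f hf σ hσ) (graphHomeo f hf σ hσ).continuous.continuousOn
      rw [(graphHomeo f hf σ hσ).image_eq_preimage_symm] at h1
      convert h1 using 1
      ext x
      simp [graphHomeo_symm_apply]
    refine hpre.subset_left_of_subset_union hopen isClosed_closure.isOpen_compl
      (disjoint_compl_right.mono_left subset_closure) (fun p hp => ?_) ⟨z, hzδ, hz⟩ hx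
    by_cases hpΩ : p ∈ Ω
    · exact Or.inl hpΩ
    refine Or.inr fun hpc => ?_
    have hp' : σ * (p.2 - f p.1) ∈ Ioo 0 δ := hp
    have habs : |p.2 - f p.1| < δ := by
      have hσ1 : |σ| = 1 := by rcases mul_self_eq_one_iff.1 hσ with rfl | rfl <;> simp
      have := abs_lt.2 ⟨by linarith [hp'.1], hp'.2⟩
      rwa [abs_mul, hσ1, one_mul] at this
    have hpf : p ∈ frontier Ω := by
      rw [hopen.frontier_eq]
      exact ⟨hpc, hpΩ⟩
    rw [hnear p habs hpf] at hp'
    simp at hp'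
  have hex : ∃ σ : ℝ, σ * σ = 1 ∧ ∃ x ∈ Ω, σ * (x.2 - f x.1) ∈ Ioo 0 δ := by
    have hV : IsOpen {x : ℝ × ℝ | |x.2 - f x.1| < δ} := isOpen_lt (by fun_prop) continuous_const
    have h0 : ((0 : ℝ), f 0) ∈ closure Ω := frontier_subset_closure (hgr 0)
    obtain ⟨x, hxV, hx⟩ := mem_closure_iff.1 h0 _ hV (by simpa using hδ)
    have hxV' : |x.2 - f x.1| < δ := hxV
    rcases lt_or_gt_of_ne (hdisj x hx) with h | h
    · refine ⟨-1, by norm_num, x, hx, ?_⟩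
      have := (abs_lt.1 hxV').1
      constructor <;> linarith
    · refine ⟨1, by norm_num, x, hx, ?_⟩
      have := (abs_lt.1 hxV').2
      constructor <;> linarith
  obtain ⟨σ, hσ, z, hz, hzδ⟩ := hex
  refine ⟨σ, hσ, hside σ hσ ⟨z, hz, hzδ⟩, fun x hx hxδ => ?_⟩
  by_contra hcon
  have hpos : Ω ⊆ {x : ℝ × ℝ | 0 < σ * (x.2 - f x.1)} := by
    refine hconn.isPreconnected.subset_left_of_subset_union
      (isOpen_lt continuous_const (by fun_prop))
      (v := {x : ℝ × ℝ | σ * (x.2 - f x.1) < 0}) (isOpen_lt (by fun_prop) continuous_const)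
      ?_ ?_ ⟨z, hz, hzδ.1⟩
    · rw [Set.disjoint_left]
      intro y h1 h2
      exact lt_asymm (mem_ofPred_eq.mp h1) (mem_ofPred_eq.mp h2)
    · intro y hy
      have h0 : σ * (y.2 - f y.1) ≠ 0 :=
        mul_ne_zero (left_ne_zero_of_mul_eq_one hσ) (sub_ne_zero.2 (hdisj y hy))
      exact h0.lt_or_gt.symm
  exact hcon (hpos hx)

/-! ### Cutoff and reduction to a function on a strip. -/

/-- A smooth cutoff function: `1` for `y ≤ δ / 3` and `0` for `y ≥ 2 δ / 3`. -/
noncomputable def stripCutoff (δ y : ℝ) : ℝ := Real.smoothTransition (2 - 3 * y / δ)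

theorem contDiff_stripCutoff (δ : ℝ) : ContDiff ℝ ∞ (stripCutoff δ) := by
  unfold stripCutoff
  exact Real.smoothTransition.contDiff.comp (by fun_prop)

theorem stripCutoff_eq_one {δ y : ℝ} (hδ : 0 < δ) (hy : y ≤ δ / 3) : stripCutoff δ y = 1 := by
  refine Real.smoothTransition.one_of_one_le ?_
  have : 3 * y / δ ≤ 1 := by
    rw [div_le_one hδ]; linarith
  linarith

theorem stripCutoff_eq_zero {δ y : ℝ} (hδ : 0 < δ) (hy : 2 * δ / 3 ≤ y) : stripCutoff δ y = 0 := by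
  refine Real.smoothTransition.zero_of_nonpos ?_
  have : 2 ≤ 3 * y / δ := by
    rw [le_div_iff₀ hδ]; linarith
  linarith

theorem abs_stripCutoff_le_one (δ y : ℝ) : |stripCutoff δ y| ≤ 1 := by
  rw [stripCutoff, abs_of_nonneg (Real.smoothTransition.nonneg _)]
  exact Real.smoothTransition.le_one _

theorem l2norm_comp_graphHomeo (w f : ℝ → ℝ) (hw : Continuous w) (hf : Continuous f) (σ : ℝ)
    (hσ : σ * σ = 1) {g : ℝ × ℝ → ℝ} (hg : Measurable g) :
    l2norm volume (fun p : ℝ × ℝ => ‖w p.1 * g (graphHomeo f hf σ hσ p)‖ₑ) =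
      l2norm volume (fun x : ℝ × ℝ => ‖w x.1 * g x‖ₑ) := by
  have hwm := hw.measurable
  have hm : Measurable fun x : ℝ × ℝ => ‖w x.1 * g x‖ₑ ^ 2 := by fun_prop
  have := (measurePreserving_graphHomeo f hf σ hσ).lintegral_comp hm
  rw [l2norm, l2norm, ← this]
  rfl

theorem l2norm_le_add_const_mul {w : ℝ → ℝ} (hw : Continuous w) {F a b : ℝ × ℝ → ℝ}
    (ha : Measurable a) (hb : Measurable b) {c : ℝ} (hc : 0 ≤ c)
    (h : ∀ p, |F p| ≤ |a p| + c * |b p|) :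
    l2norm volume (fun p : ℝ × ℝ => ‖w p.1 * F p‖ₑ) ≤
      l2norm volume (fun p : ℝ × ℝ => ‖w p.1 * a p‖ₑ) +
        ENNReal.ofReal c * l2norm volume (fun p : ℝ × ℝ => ‖w p.1 * b p‖ₑ) := by
  have hwm := hw.measurable
  have m1 : Measurable fun p : ℝ × ℝ => ‖w p.1 * a p‖ₑ := by fun_prop
  have m2 : Measurable fun p : ℝ × ℝ => ‖w p.1 * b p‖ₑ := by fun_prop
  rw [← l2norm_const_mul m2.aemeasurable]
  refine le_trans (l2norm_mono_ae (Eventually.of_forall fun p => ?_))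
    (l2norm_add_le m1.aemeasurable (m2.const_mul _).aemeasurable)
  simp only [← ofReal_norm]
  rw [← ENNReal.ofReal_mul hc, ← ENNReal.ofReal_add (norm_nonneg _) (by positivity)]
  apply ENNReal.ofReal_le_ofReal
  simp only [norm_mul, Real.norm_eq_abs]
  calc |w p.1| * |F p| ≤ |w p.1| * (|a p| + c * |b p|) := by gcongr; exact h p
    _ = _ := by ring

/-- A weighted Sobolev function on one side of a Lipschitz graph becomes, after flattening and
truncation, a strip function. -/
theorem exists_isStripSobolev {δ : ℝ} (hδ : 0 < δ) (L : ℝ≥0) : ∃ M : ℝ, 0 < M ∧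
    ∀ (w f : ℝ → ℝ) (hf : LipschitzWith L f) (σ : ℝ) (hσ : σ * σ = 1) (Ω : Set (ℝ × ℝ))
      (g g₁ g₂ : ℝ × ℝ → ℝ), Continuous w → (∀ x, 0 < w x) →
      (∀ x : ℝ × ℝ, σ * (x.2 - f x.1) ∈ Ioo 0 δ → x ∈ Ω) →
      Measurable g → Measurable g₁ → Measurable g₂ →
      l2norm volume (fun x : ℝ × ℝ => ‖w x.1 * g x‖ₑ) < ⊤ →
      l2norm volume (fun x : ℝ × ℝ => ‖w x.1 * g₁ x‖ₑ) < ⊤ →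
      l2norm volume (fun x : ℝ × ℝ => ‖w x.1 * g₂ x‖ₑ) < ⊤ →
      (∀ φ : ℝ × ℝ → ℝ, ContDiff ℝ ∞ φ → HasCompactSupport φ → tsupport φ ⊆ Ω →
        ∫ x, g x * fderiv ℝ φ x (1, 0) = -∫ x, g₁ x * φ x) →
      (∀ φ : ℝ × ℝ → ℝ, ContDiff ℝ ∞ φ → HasCompactSupport φ → tsupport φ ⊆ Ω →
        ∫ x, g x * fderiv ℝ φ x (0, 1) = -∫ x, g₂ x * φ x) →
      ∃ G G₁ G₂ : ℝ × ℝ → ℝ, IsStripSobolev w δ G G₁ G₂ ∧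
        (∀ p : ℝ × ℝ, p.2 ∈ Ioo 0 (δ / 3) → G p = g (graphHomeo f hf.continuous σ hσ p)) ∧
        l2norm volume (fun x : ℝ × ℝ => ‖w x.1 * G₁ x‖ₑ) +
          l2norm volume (fun x : ℝ × ℝ => ‖w x.1 * G₂ x‖ₑ) ≤
        ENNReal.ofReal M * (l2norm volume (fun x : ℝ × ℝ => ‖w x.1 * g x‖ₑ) +
          l2norm volume (fun x : ℝ × ℝ => ‖w x.1 * g₁ x‖ₑ) +
          l2norm volume (fun x : ℝ × ℝ => ‖w x.1 * g₂ x‖ₑ)) := by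
  have hχ := contDiff_stripCutoff δ
  have hχ' : Continuous (deriv (stripCutoff δ)) := hχ.continuous_deriv (by simp)
  obtain ⟨M₁, hM₁⟩ := isCompact_Icc.exists_bound_of_continuousOn (s := Icc 0 δ) hχ'.continuousOn
  have hM₁0 : 0 ≤ M₁ := (norm_nonneg _).trans (hM₁ 0 ⟨le_rfl, hδ.le⟩)
  -- `L` comes from the term `f' g₂` in the horizontal derivative, `M₁` from the derivative of the
  -- cutoff in the vertical one.
  refine ⟨1 + L + M₁, by positivity, ?_⟩
  intro w f hf σ hσ Ω g g₁ g₂ hw hw0 hside hg hg₁ hg₂ hgt hgt₁ hgt₂ h₁ h₂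
  set Φ := graphHomeo f hf.continuous σ hσ with hΦ
  have hσ1 : |σ| = 1 := by rcases mul_self_eq_one_iff.1 hσ with rfl | rfl <;> simp
  have hΩ : ∀ p : ℝ × ℝ, p.2 ∈ Ioo 0 δ → Φ p ∈ Ω := by
    intro p hp
    refine hside _ ?_
    rw [hΦ, graphHomeo_apply]
    convert hp using 1
    linear_combination p.2 * hσ
  have hΦm : Measurable Φ := Φ.continuous.measurable
  have ma : Measurable fun p => g (Φ p) := hg.comp hΦm
  have ma₁ : Measurable fun p => g₁ (Φ p) := hg₁.comp hΦm
  have ma₂ : Measurable fun p => g₂ (Φ p) := hg₂.comp hΦm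
  have na := l2norm_comp_graphHomeo w f hw hf.continuous σ hσ hg
  have na₁ := l2norm_comp_graphHomeo w f hw hf.continuous σ hσ hg₁
  have na₂ := l2norm_comp_graphHomeo w f hw hf.continuous σ hσ hg₂
  rw [← hΦ] at na na₁ na₂
  have ia := locallyIntegrable_of_l2norm_mul_lt_top hw hw0 ma (na.trans_lt hgt)
  have ia₁ := locallyIntegrable_of_l2norm_mul_lt_top hw hw0 ma₁ (na₁.trans_lt hgt₁)
  have ia₂ := locallyIntegrable_of_l2norm_mul_lt_top hw hw0 ma₂ (na₂.trans_lt hgt₂)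
  have hχm : Measurable fun p : ℝ × ℝ => stripCutoff δ p.2 :=
    hχ.continuous.measurable.comp measurable_snd
  have hχm' : Measurable fun p : ℝ × ℝ => deriv (stripCutoff δ) p.2 :=
    hχ'.measurable.comp measurable_snd
  have hdf : Measurable fun p : ℝ × ℝ => deriv f p.1 := (measurable_deriv f).comp measurable_fst
  set S : Set (ℝ × ℝ) := {p | p.2 ∈ Ioo 0 δ} with hS
  have hSm : MeasurableSet S := measurableSet_Ioo.preimage measurable_snd
  set G : ℝ × ℝ → ℝ := S.indicator fun p => stripCutoff δ p.2 * g (Φ p) with hG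
  set G₁ : ℝ × ℝ → ℝ := S.indicator fun p =>
    stripCutoff δ p.2 * (g₁ (Φ p) + deriv f p.1 * g₂ (Φ p)) with hG₁
  set G₂ : ℝ × ℝ → ℝ := S.indicator fun p =>
    stripCutoff δ p.2 * (σ * g₂ (Φ p)) + deriv (stripCutoff δ) p.2 * g (Φ p) with hG₂
  have bG : ∀ p, |G p| ≤ |g (Φ p)| + 0 * |g (Φ p)| := by
    intro p
    rw [zero_mul, add_zero]
    by_cases hp : p ∈ S
    · rw [hG, indicator_of_mem hp, abs_mul]
      exact mul_le_of_le_one_left (abs_nonneg _) (abs_stripCutoff_le_one _ _)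
    · rw [hG, indicator_of_notMem hp, abs_zero]
      exact abs_nonneg _
  have bG₁ : ∀ p, |G₁ p| ≤ |g₁ (Φ p)| + L * |g₂ (Φ p)| := by
    intro p
    by_cases hp : p ∈ S
    · rw [hG₁, indicator_of_mem hp, abs_mul]
      refine (mul_le_of_le_one_left (abs_nonneg _) (abs_stripCutoff_le_one _ _)).trans ?_
      refine (abs_add_le _ _).trans ?_
      rw [abs_mul]
      gcongr
      exact norm_deriv_le_of_lipschitz hf
    · rw [hG₁, indicator_of_notMem hp, abs_zero]
      positivity
  have bG₂ : ∀ p, |G₂ p| ≤ |g₂ (Φ p)| + M₁ * |g (Φ p)| := by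
    intro p
    by_cases hp : p ∈ S
    · rw [hG₂, indicator_of_mem hp]
      refine (abs_add_le _ _).trans ?_
      rw [abs_mul, abs_mul, abs_mul, hσ1, one_mul]
      gcongr
      · exact mul_le_of_le_one_left (abs_nonneg _) (abs_stripCutoff_le_one _ _)
      · exact hM₁ _ ⟨hp.1.le, hp.2.le⟩
    · rw [hG₂, indicator_of_notMem hp, abs_zero]
      positivity
  have nG := l2norm_le_add_const_mul hw ma ma le_rfl bG
  have nG₁ := l2norm_le_add_const_mul hw ma₁ ma₂ L.coe_nonneg bG₁
  have nG₂ := l2norm_le_add_const_mul hw ma₂ ma hM₁0 bG₂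
  rw [na] at nG nG₂
  rw [na₁, na₂] at nG₁
  rw [na₂] at nG₂
  -- The test functions for `G` may extend above the strip. Multiplied by the cutoff, they become
  -- test functions inside it, to which the flattened identities apply.
  have cut : ∀ Θ : ℝ × ℝ → ℝ, ContDiff ℝ ∞ Θ → HasCompactSupport Θ → tsupport Θ ⊆ {x | 0 < x.2} →
      ContDiff ℝ ∞ (fun p : ℝ × ℝ => stripCutoff δ p.2 * Θ p) ∧
      HasCompactSupport (fun p : ℝ × ℝ => stripCutoff δ p.2 * Θ p) ∧
      tsupport (fun p : ℝ × ℝ => stripCutoff δ p.2 * Θ p) ⊆ S := by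
    intro Θ hΘ hΘc hΘs
    refine ⟨(hχ.comp contDiff_snd).mul hΘ, hΘc.mul_left, fun p hp => ?_⟩
    have h1 : 0 < p.2 := hΘs (tsupport_mul_subset_right hp)
    have h2 : p ∈ tsupport fun p : ℝ × ℝ => stripCutoff δ p.2 := tsupport_mul_subset_left hp
    have h3 : p ∈ {p : ℝ × ℝ | p.2 ≤ 2 * δ / 3} := by
      refine closure_minimal (fun q hq => ?_) (isClosed_le continuous_snd continuous_const) h2
      by_contra hcon
      exact hq (stripCutoff_eq_zero hδ (not_le.1 hcon).le)
    have h3' : p.2 ≤ 2 * δ / 3 := h3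
    exact ⟨h1, by linarith⟩
  have cutD : ∀ Θ : ℝ × ℝ → ℝ, ContDiff ℝ ∞ Θ → ∀ p v : ℝ × ℝ,
      fderiv ℝ (fun p : ℝ × ℝ => stripCutoff δ p.2 * Θ p) p v =
        stripCutoff δ p.2 * fderiv ℝ Θ p v + Θ p * (deriv (stripCutoff δ) p.2 * v.2) := by
    intro Θ hΘ p v
    have d1 : HasFDerivAt (fun p : ℝ × ℝ => stripCutoff δ p.2)
        (deriv (stripCutoff δ) p.2 • ContinuousLinearMap.snd ℝ ℝ ℝ) p :=
      ((hχ.differentiable (by simp)).differentiableAt (x := p.2)).hasDerivAt.comp_hasFDerivAt p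
        hasFDerivAt_snd
    have d2 : HasFDerivAt (fun p : ℝ × ℝ => stripCutoff δ p.2 * Θ p) _ p :=
      d1.mul ((hΘ.differentiable (by simp)).differentiableAt (x := p)).hasFDerivAt
    rw [d2.fderiv]
    simp
  -- pointwise removal of the truncation to the strip
  have rem : ∀ (Θ : ℝ × ℝ → ℝ), tsupport Θ ⊆ {x | 0 < x.2} → ∀ (u : ℝ × ℝ → ℝ),
      (∀ p : ℝ × ℝ, δ ≤ p.2 → u p = 0) → ∀ θ : ℝ × ℝ → ℝ, (∀ p ∉ tsupport Θ, θ p = 0) →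
      ∀ p, S.indicator u p * θ p = u p * θ p := by
    intro Θ hΘs u hu θ hθ p
    by_cases hp : p ∈ S
    · rw [indicator_of_mem hp]
    rw [indicator_of_notMem hp, zero_mul]
    rcases le_or_gt p.2 0 with h0 | h0
    · rw [hθ p fun hcon => (lt_irrefl _ ((hΘs hcon).trans_le h0)), mul_zero]
    · rcases le_or_gt δ p.2 with h1 | h1
      · rw [hu p h1, zero_mul]
      · exact absurd ⟨h0, h1⟩ hp
  have zD : ∀ (Θ : ℝ × ℝ → ℝ) (v : ℝ × ℝ), ∀ p ∉ tsupport Θ, fderiv ℝ Θ p v = 0 := by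
    intro Θ v p hp
    have : fderiv ℝ Θ p = 0 := by
      by_contra hcon
      exact hp (support_fderiv_subset ℝ hcon)
    rw [this]; rfl
  have c0 : ∀ p : ℝ × ℝ, δ ≤ p.2 → stripCutoff δ p.2 = 0 := fun p hp =>
    stripCutoff_eq_zero hδ (by linarith)
  have c0' : ∀ p : ℝ × ℝ, δ ≤ p.2 → deriv (stripCutoff δ) p.2 = 0 := by
    intro p hp
    have : stripCutoff δ =ᶠ[𝓝 p.2] fun _ => 0 := by
      filter_upwards [lt_mem_nhds (show 2 * δ / 3 < p.2 by linarith)] with y hy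
      exact stripCutoff_eq_zero hδ hy.le
    rw [this.deriv_eq, deriv_const]
  refine ⟨G, G₁, G₂, ⟨?_, ?_, ?_, ?_, ?_, ?_, ?_, ?_, ?_, ?_⟩, ?_, ?_⟩
  · exact (hχm.mul ma).indicator hSm
  · exact (hχm.mul (ma₁.add (hdf.mul ma₂))).indicator hSm
  · exact ((hχm.mul (ma₂.const_mul σ)).add (hχm'.mul ma)).indicator hSm
  · exact fun p hp => indicator_of_notMem (s := S) hp _
  · exact fun p hp => indicator_of_notMem (s := S) hp _
  · exact nG.trans_lt (ENNReal.add_lt_top.2 ⟨hgt, ENNReal.mul_lt_top ENNReal.ofReal_lt_top hgt⟩)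
  · exact nG₁.trans_lt
      (ENNReal.add_lt_top.2 ⟨hgt₁, ENNReal.mul_lt_top ENNReal.ofReal_lt_top hgt₂⟩)
  · exact nG₂.trans_lt
      (ENNReal.add_lt_top.2 ⟨hgt₂, ENNReal.mul_lt_top ENNReal.ofReal_lt_top hgt⟩)
  · intro Θ hΘ hΘc hΘs
    obtain ⟨k1, k2, k3⟩ := cut Θ hΘ hΘc hΘs
    have h := (weak_deriv_comp_graphHomeo hf hσ hΩ ia ia₁ ia₂ h₁ h₂ k1 k2 k3).1
    calc ∫ p, G p * fderiv ℝ Θ p (1, 0) = ∫ p, g (Φ p) *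
          fderiv ℝ (fun p : ℝ × ℝ => stripCutoff δ p.2 * Θ p) p (1, 0) := by
          refine integral_congr_ae (Eventually.of_forall fun p => ?_)
          dsimp only
          rw [hG, rem Θ hΘs _ (fun p hp => by rw [c0 p hp, zero_mul]) _ (zD Θ _), cutD Θ hΘ]
          ring
      _ = _ := by
          rw [h]
          congr 1
          refine integral_congr_ae (Eventually.of_forall fun p => ?_)
          dsimp only
          rw [hG₁, rem Θ hΘs _ (fun p hp => by rw [c0 p hp, zero_mul]) _
            (fun p hp => image_eq_zero_of_notMem_tsupport hp)]
          ring
  · intro Θ hΘ hΘc hΘs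
    obtain ⟨k1, k2, k3⟩ := cut Θ hΘ hΘc hΘs
    have h := (weak_deriv_comp_graphHomeo hf hσ hΩ ia ia₁ ia₂ h₁ h₂ k1 k2 k3).2
    have hint : ∀ {a m : ℝ × ℝ → ℝ}, LocallyIntegrable a → Continuous m → HasCompactSupport m →
        Integrable (fun p => a p * m p) := by
      intro a m ha hm hm0
      have := ha.integrable_smul_left_of_hasCompactSupport hm hm0
      simpa [mul_comm] using this
    have i1 : Integrable fun p => g (Φ p) *
        fderiv ℝ (fun p : ℝ × ℝ => stripCutoff δ p.2 * Θ p) p (0, 1) :=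
      hint ia ((k1.continuous_fderiv (by simp)).clm_apply continuous_const)
        (k2.fderiv_apply (𝕜 := ℝ) (0, 1))
    have i2 : Integrable fun p => g (Φ p) * (deriv (stripCutoff δ) p.2 * Θ p) :=
      hint ia ((hχ'.comp continuous_snd).mul hΘ.continuous) hΘc.mul_left
    have i3 : Integrable fun p => (σ * g₂ (Φ p)) * (stripCutoff δ p.2 * Θ p) := by
      refine ((hint ia₂ k1.continuous k2).const_mul σ).congr (Eventually.of_forall fun p => ?_)
      dsimp only
      ring
    calc ∫ p, G p * fderiv ℝ Θ p (0, 1) = ∫ p, (g (Φ p) *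
          fderiv ℝ (fun p : ℝ × ℝ => stripCutoff δ p.2 * Θ p) p (0, 1) -
            g (Φ p) * (deriv (stripCutoff δ) p.2 * Θ p)) := by
          refine integral_congr_ae (Eventually.of_forall fun p => ?_)
          dsimp only
          rw [hG, rem Θ hΘs _ (fun p hp => by rw [c0 p hp, zero_mul]) _ (zD Θ _), cutD Θ hΘ]
          ring
      _ = -((∫ p, (σ * g₂ (Φ p)) * (stripCutoff δ p.2 * Θ p)) +
            ∫ p, g (Φ p) * (deriv (stripCutoff δ) p.2 * Θ p)) := by
          rw [integral_sub i1 i2, h]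
          ring
      _ = _ := by
          rw [← integral_add i3 i2]
          congr 1
          refine integral_congr_ae (Eventually.of_forall fun p => ?_)
          dsimp only
          rw [hG₂, rem Θ hΘs _ (fun p hp => by rw [c0 p hp, c0' p hp, zero_mul, zero_mul, add_zero])
            _ (fun p hp => image_eq_zero_of_notMem_tsupport hp)]
          ring
  · intro p hp
    have hpS : p ∈ S := ⟨hp.1, by linarith [hp.2]⟩
    rw [hG, indicator_of_mem hpS, stripCutoff_eq_one hδ hp.2.le, one_mul]
  · refine (add_le_add nG₁ nG₂).trans ?_
    set X := l2norm volume (fun x : ℝ × ℝ => ‖w x.1 * g x‖ₑ)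
    set X₁ := l2norm volume (fun x : ℝ × ℝ => ‖w x.1 * g₁ x‖ₑ)
    set X₂ := l2norm volume (fun x : ℝ × ℝ => ‖w x.1 * g₂ x‖ₑ)
    rw [ENNReal.ofReal_add (by positivity) hM₁0, ENNReal.ofReal_add zero_le_one L.coe_nonneg,
      ENNReal.ofReal_one]
    set l := ENNReal.ofReal L
    set m := ENNReal.ofReal M₁
    calc X₁ + l * X₂ + (X₂ + m * X) ≤ X₁ + l * X₂ + (X₂ + m * X) +
          (X + l * X + l * X₁ + m * X₁ + m * X₂) := le_self_add
      _ = _ := by ring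

/-! ### Traces -/

/-- The constant `‖T x - T' x‖` is at most the sum of the two vanishing means, the sets `ball ∩ Ω`
having positive finite measure. No measurability of `T` or `T'` is needed. -/
theorem IsTrace.ae_eq {Ω : Set (ℝ × ℝ)} {f : ℝ → ℝ} {g : ℝ × ℝ → ℝ} {T T' : ℝ → ℝ}
    (hΩ : IsOpen Ω) (hf : ∀ x, (x, f x) ∈ closure Ω)
    (hg : AEStronglyMeasurable g (volume.restrict Ω)) (h : IsTrace Ω f g T)
    (h' : IsTrace Ω f g T') : T =ᵐ[volume] T' := by
  filter_upwards [h, h'] with x hx hx'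
  have hle : ∀ᶠ r : ℝ in 𝓝[>] 0, ‖T x - T' x‖ₑ ≤
      (⨍⁻ y in Metric.ball (x, f x) r ∩ Ω, ‖g y - T x‖ₑ ∂volume) +
        ⨍⁻ y in Metric.ball (x, f x) r ∩ Ω, ‖g y - T' x‖ₑ ∂volume := by
    filter_upwards [self_mem_nhdsWithin] with r hr
    have hr0 : 0 < r := hr
    set S := Metric.ball (x, f x) r ∩ Ω with hS
    have hne : S.Nonempty :=
      mem_closure_iff.1 (hf x) _ Metric.isOpen_ball (Metric.mem_ball_self hr0)
    have hpos : volume S ≠ 0 := ((Metric.isOpen_ball.inter hΩ).measure_pos volume hne).ne'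
    have hfin : volume S ≠ ⊤ :=
      ((measure_mono inter_subset_left).trans_lt Metric.isBounded_ball.measure_lt_top).ne
    have hgS : AEStronglyMeasurable g (volume.restrict S) :=
      hg.mono_measure (Measure.restrict_mono inter_subset_right le_rfl)
    have hgT : AEMeasurable (fun y => ‖g y - T x‖ₑ) (volume.restrict S) :=
      (hgS.sub aestronglyMeasurable_const).enorm
    rw [← setLAverage_const hpos hfin ‖T x - T' x‖ₑ, setLAverage_eq, setLAverage_eq, setLAverage_eq,
      ← ENNReal.add_div, ← lintegral_add_left' hgT]
    gcongr with y
    rw [show T x - T' x = (g y - T' x) - (g y - T x) by ring, add_comm]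
    exact enorm_sub_le
  have hlim := hx.add hx'
  rw [add_zero] at hlim
  have h0 : ‖T x - T' x‖ₑ ≤ 0 := ge_of_tendsto hlim hle
  simpa [sub_eq_zero] using h0

theorem IsTrace.congr_ae {Ω : Set (ℝ × ℝ)} {f : ℝ → ℝ} {g g' : ℝ × ℝ → ℝ} {T : ℝ → ℝ}
    (h : IsTrace Ω f g T) (hg : g =ᵐ[volume.restrict Ω] g') : IsTrace Ω f g' T := by
  filter_upwards [h] with x hx
  refine hx.congr fun r => laverage_congr ?_
  filter_upwards [hg.filter_mono (ae_mono (Measure.restrict_mono inter_subset_right le_rfl))]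
    with y hy
  rw [hy]

theorem locallyIntegrable_of_l2norm_mul_lt_top_line {w : ℝ → ℝ} (hw : Continuous w)
    (hw0 : ∀ x, 0 < w x) {T : ℝ → ℝ} (hT : Measurable T)
    (h : l2norm volume (fun x => ‖w x * T x‖ₑ) < ⊤) : LocallyIntegrable T := by
  have hwm := hw.measurable
  have hm : MemLp (fun x => w x * T x) 2 volume := by
    refine ⟨(Measurable.aestronglyMeasurable (by fun_prop)), ?_⟩
    rwa [eLpNorm_two_eq_l2norm]
  have h1 := hm.locallyIntegrable one_le_two
  rw [← locallyIntegrableOn_univ] at h1 ⊢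
  have hc : Continuous fun x : ℝ => (w x)⁻¹ := hw.inv₀ fun x => (hw0 _).ne'
  refine (h1.continuousOn_mul hc.continuousOn isOpen_univ.isLocallyClosed).congr ?_
  refine Eventually.of_forall fun x => ?_
  have := (hw0 x).ne'
  simp [this]

/-! ### The boundary value of a strip function as a trace on the graph. -/

section Strip

variable {w f : ℝ → ℝ} {L : ℝ≥0} {δ σ : ℝ} {G G₁ G₂ g : ℝ × ℝ → ℝ} {Ω : Set (ℝ × ℝ)}

namespace IsStripSobolev

/-- The oscillation near the boundary is dominated by functions of `x₁` alone, so that Lebesgue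
differentiation on the line suffices. `stripTrace η` applied to `|G₂|` serves here as the integral
of `|G₂|` over `(0, η]`, up to sign. -/
theorem ae_enorm_sub_le (hw : Continuous w) (hw0 : ∀ x, 0 < w x) (hδ : 0 < δ)
    (h : IsStripSobolev w δ G G₁ G₂) (η : ℝ) : ∀ᵐ p : ℝ × ℝ, p.2 ∈ Ioo 0 η → ∀ c : ℝ,
      ‖G p - c‖ₑ ≤ ‖stripTrace δ G₂ p.1 - c‖ₑ + ‖stripTrace η (fun q => |G₂ q|) p.1‖ₑ := by
  have h2 : ∀ᵐ x : ℝ × ℝ, IntegrableOn (fun τ => G₂ (x.1, τ)) (Ioc 0 η) :=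
    Measure.quasiMeasurePreserving_fst.ae (integrableOn_slice hw hw0 h.measurable₂ h.lt_top₂ η)
  filter_upwards [h.ae_eq_stripTrace_add hw hw0 hδ, h2] with p hp hi hpη c
  rw [hp hpη.1, add_sub_right_comm]
  refine (enorm_add_le _ _).trans ?_
  gcongr
  rw [stripTrace, enorm_neg]
  calc ‖∫ τ in Ioc 0 p.2, G₂ (p.1, τ)‖ₑ ≤ ∫⁻ τ in Ioc 0 p.2, ‖G₂ (p.1, τ)‖ₑ :=
        enorm_integral_le_lintegral_enorm _
    _ ≤ ∫⁻ τ in Ioc 0 η, ‖G₂ (p.1, τ)‖ₑ := lintegral_mono_set (Ioc_subset_Ioc_right hpη.2.le)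
    _ = ‖∫ τ in Ioc 0 η, |G₂ (p.1, τ)|‖ₑ := by
        rw [← ofReal_norm, Real.norm_of_nonneg (integral_nonneg fun _ => abs_nonneg _)]
        exact (ofReal_integral_norm_eq_lintegral_enorm hi).symm

theorem ae_tendsto_stripTrace_abs (hw : Continuous w) (hw0 : ∀ x, 0 < w x)
    (h : IsStripSobolev w δ G G₁ G₂) : ∀ᵐ x,
      Tendsto (fun n : ℕ => ‖stripTrace (1 / ((n : ℝ) + 1)) (fun q => |G₂ q|) x‖ₑ) atTop (𝓝 0) := by
  filter_upwards [integrableOn_slice hw hw0 h.measurable₂ h.lt_top₂ δ] with x hi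
  have hI : Integrable fun τ => |G₂ (x, τ)| := by
    refine Integrable.abs ((integrableOn_iff_integrable_of_support_subset fun τ hτ => ?_).1 hi)
    by_contra hcon
    exact hτ (h.eq_zero₂ _ fun h' => hcon ⟨h'.1, h'.2.le⟩)
  have hc := intervalIntegral.continuous_primitive (fun a b => hI.intervalIntegrable (a := a)
    (b := b)) 0
  have h1 := (hc.tendsto 0).comp (tendsto_one_div_add_atTop_nhds_zero_nat (𝕜 := ℝ))
  rw [intervalIntegral.integral_same] at h1
  have h2 := h1.enorm
  rw [enorm_zero] at h2
  refine h2.congr fun n => ?_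
  simp only [Function.comp_apply]
  rw [stripTrace, enorm_neg, intervalIntegral.integral_of_le (by positivity)]

/-- The boundary value of a strip function is the trace of the corresponding function on the
domain. -/
theorem isTrace_stripTrace (hw : Continuous w) (hw0 : ∀ x, 0 < w x) (hδ : 0 < δ)
    (h : IsStripSobolev w δ G G₁ G₂) (hf : LipschitzWith L f) (hσ : σ * σ = 1)
    (hside : ∀ x : ℝ × ℝ, σ * (x.2 - f x.1) ∈ Ioo 0 δ → x ∈ Ω)
    (hside' : ∀ x ∈ Ω, |x.2 - f x.1| < δ → 0 < σ * (x.2 - f x.1))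
    (hG : ∀ p : ℝ × ℝ, p.2 ∈ Ioo 0 (δ / 3) → G p = g (graphHomeo f hf.continuous σ hσ p)) :
    IsTrace Ω f g (stripTrace δ G₂) := by
  set Φ := graphHomeo f hf.continuous σ hσ with hΦ
  set T := stripTrace δ G₂ with hT
  have hTm : Measurable T := measurable_stripTrace δ h.measurable₂
  set u : ℕ → ℝ → ℝ := fun n => stripTrace (1 / ((n : ℝ) + 1)) (fun q => |G₂ q|) with hu
  have hG₂m : Measurable fun q => |G₂ q| := h.measurable₂.abs
  have hum : ∀ n, Measurable (u n) := fun n => measurable_stripTrace _ hG₂m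
  have hσ1 : |σ| = 1 := by rcases mul_self_eq_one_iff.1 hσ with rfl | rfl <;> simp
  have hmp := measurePreserving_graphHomeo f hf.continuous σ hσ
  have hemb := Φ.measurableEmbedding
  have hTi : LocallyIntegrable T := locallyIntegrable_of_l2norm_mul_lt_top_line hw hw0 hTm
    ((l2norm_mul_stripTrace_le hw hδ.le h.measurable₂).trans_lt
      (ENNReal.mul_lt_top ENNReal.ofReal_lt_top h.lt_top₂))
  have hui : ∀ n, LocallyIntegrable (u n) := fun n => by
    refine locallyIntegrable_of_l2norm_mul_lt_top_line hw hw0 (hum n)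
      ((l2norm_mul_stripTrace_le hw (by positivity) hG₂m).trans_lt
      (ENNReal.mul_lt_top ENNReal.ofReal_lt_top ?_))
    refine lt_of_le_of_lt (le_of_eq ?_) h.lt_top₂
    congr 1
    funext x
    rw [enorm_mul, enorm_mul, ← Real.norm_eq_abs, enorm_norm]
  have hLpos : (0 : ℝ) < 1 + L := by positivity
  -- The point `x₀` is a Lebesgue point of `T` and of all the countably many `u n`.
  filter_upwards [(Besicovitch.vitaliFamily volume).ae_tendsto_lintegral_enorm_sub_div hTi,
    ae_all_iff.2 fun n =>
      (Besicovitch.vitaliFamily volume).ae_tendsto_lintegral_enorm_sub_div (hui n),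
    h.ae_tendsto_stripTrace_abs hw hw0] with x₀ hxT hxu hx0
  have hxT' := hxT.comp (Besicovitch.tendsto_filterAt volume x₀)
  have hxu' := fun n => (hxu n).comp (Besicovitch.tendsto_filterAt volume x₀)
  simp only [Function.comp_def] at hxT' hxu'
  -- the volume of the half-balls
  have hvol : ∀ r, 0 < r → (1 + L) * r < δ →
      ENNReal.ofReal (r ^ 2 / (2 * (1 + L) ^ 2)) ≤ volume (Metric.ball (x₀, f x₀) r ∩ Ω) := by
    intro r hr hrδ
    -- Balls of the plane are squares here, the metric being the maximum metric. A box of half-width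
    -- and height `s` is sheared into the ball because `L s + s = r / 2`, and its area `2 s²` is the
    -- asserted lower bound.
    set s := r / (2 * (1 + L)) with hs
    have hs0 : 0 < s := by positivity
    have hsr : (1 + L) * s = r / 2 := by rw [hs]; field_simp
    have hL0 : (0 : ℝ) ≤ L := L.coe_nonneg
    have hss : s ≤ r / 2 := by nlinarith
    have hsub : Metric.closedBall x₀ s ×ˢ Ioo 0 s ⊆ Φ ⁻¹' (Metric.ball (x₀, f x₀) r ∩ Ω) := by
      rintro p ⟨hp1, hp2⟩
      have hp1' : |p.1 - x₀| ≤ s := hp1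
      refine ⟨?_, ?_⟩
      · rw [Metric.mem_ball, Prod.dist_eq, max_lt_iff, hΦ, graphHomeo_apply]
        refine ⟨?_, ?_⟩
        · rw [Real.dist_eq]
          dsimp only
          linarith
        · rw [Real.dist_eq]
          dsimp only
          have h1 : |f p.1 - f x₀| ≤ L * s :=
            (hf.dist_le_mul p.1 x₀).trans (by gcongr; exact hp1')
          have h2 : |σ * p.2| ≤ s := by
            rw [abs_mul, hσ1, one_mul, abs_of_pos hp2.1]
            exact hp2.2.le
          calc |f p.1 + σ * p.2 - f x₀| = |(f p.1 - f x₀) + σ * p.2| := by ring_nf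
            _ ≤ |f p.1 - f x₀| + |σ * p.2| := abs_add_le _ _
            _ ≤ L * s + s := add_le_add h1 h2
            _ < r := by linarith
      · refine hside _ ?_
        rw [hΦ, graphHomeo_apply]
        dsimp only
        rw [add_sub_cancel_left, ← mul_assoc, hσ, one_mul]
        refine ⟨hp2.1, hp2.2.trans_le ?_⟩
        nlinarith
    rw [← hmp.measure_preimage_equiv (f := Φ.toMeasurableEquiv)]
    refine le_trans (le_of_eq ?_) (measure_mono hsub)
    rw [Measure.volume_eq_prod, Measure.prod_prod, Real.volume_closedBall, Real.volume_Ioo,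
      ← ENNReal.ofReal_mul (by positivity)]
    congr 1
    rw [hs]
    field_simp
    ring
  -- the integral over the half-balls
  have hint : ∀ (n : ℕ) r, 0 < r → (1 + L) * r < δ / 3 → (1 + L) * r < 1 / ((n : ℝ) + 1) →
      ∫⁻ y in Metric.ball (x₀, f x₀) r ∩ Ω, ‖g y - T x₀‖ₑ ≤
        ENNReal.ofReal ((1 + L) * r) * ((∫⁻ x in Metric.closedBall x₀ r, ‖T x - T x₀‖ₑ) +
          ∫⁻ x in Metric.closedBall x₀ r, ‖u n x‖ₑ) := by
    intro n r hr hrδ hrn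
    have hsub : Φ ⁻¹' (Metric.ball (x₀, f x₀) r ∩ Ω) ⊆
        Metric.closedBall x₀ r ×ˢ Ioc 0 ((1 + L) * r) := by
      rintro p ⟨hp1, hp2⟩
      rw [Metric.mem_ball, Prod.dist_eq, max_lt_iff, hΦ, graphHomeo_apply] at hp1
      dsimp only at hp1
      have h1 : |f p.1 - f x₀| ≤ L * r :=
        (hf.dist_le_mul p.1 x₀).trans (by gcongr; exact hp1.1.le)
      have h2 : |p.2| < (1 + L) * r := by
        have e : |p.2| = |σ * p.2| := by rw [abs_mul, hσ1, one_mul]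
        rw [e]
        calc |σ * p.2| = |(f p.1 + σ * p.2 - f x₀) - (f p.1 - f x₀)| := by ring_nf
          _ ≤ |f p.1 + σ * p.2 - f x₀| + |f p.1 - f x₀| := abs_sub _ _
          _ < r + L * r := add_lt_add_of_lt_of_le hp1.2 h1
          _ = _ := by ring
      have h3 := hside' _ hp2
      rw [hΦ, graphHomeo_apply] at h3
      dsimp only at h3
      rw [add_sub_cancel_left, abs_mul, hσ1, one_mul, ← mul_assoc, hσ, one_mul] at h3
      exact ⟨hp1.1.le, h3 (h2.trans (by linarith)), (abs_lt.1 h2).2.le⟩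
    have hmT : Measurable fun x => ‖T x - T x₀‖ₑ := by fun_prop
    have hmu : Measurable fun x => ‖u n x‖ₑ := (hum n).enorm
    have hms : Measurable fun p : ℝ × ℝ => ‖T p.1 - T x₀‖ₑ + ‖u n p.1‖ₑ :=
      (hmT.comp measurable_fst).add (hmu.comp measurable_fst)
    calc ∫⁻ y in Metric.ball (x₀, f x₀) r ∩ Ω, ‖g y - T x₀‖ₑ
        = ∫⁻ p in Φ ⁻¹' (Metric.ball (x₀, f x₀) r ∩ Ω), ‖g (Φ p) - T x₀‖ₑ :=
          (hmp.setLIntegral_comp_preimage_emb hemb _ _).symm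
      _ ≤ ∫⁻ p in Metric.closedBall x₀ r ×ˢ Ioc 0 ((1 + L) * r), ‖g (Φ p) - T x₀‖ₑ :=
          lintegral_mono_set hsub
      _ ≤ ∫⁻ p in Metric.closedBall x₀ r ×ˢ Ioc 0 ((1 + L) * r),
            (‖T p.1 - T x₀‖ₑ + ‖u n p.1‖ₑ) := by
          refine setLIntegral_mono_ae hms.aemeasurable ?_
          filter_upwards [h.ae_enorm_sub_le hw hw0 hδ (1 / ((n : ℝ) + 1))] with p hp hpQ
          have hp2 : p.2 ∈ Ioc 0 ((1 + L) * r) := hpQ.2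
          rw [← hG p ⟨hp2.1, hp2.2.trans_lt hrδ⟩]
          exact hp ⟨hp2.1, hp2.2.trans_lt hrn⟩ _
      _ = _ := by
          rw [Measure.volume_eq_prod, ← Measure.prod_restrict,
            lintegral_prod _ hms.aemeasurable]
          simp only [lintegral_const, Measure.restrict_apply MeasurableSet.univ, univ_inter,
            Real.volume_Ioc, sub_zero]
          have hmTu : Measurable fun x => ‖T x - T x₀‖ₑ + ‖u n x‖ₑ := hmT.add hmu
          rw [lintegral_mul_const _ hmTu, lintegral_add_left hmT, mul_comm]
  -- The ratio of the area `2 r · (1 + L) r` of the enclosing box to the lower bound `r² / (2 (1 +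
  -- L)²)`.
  set κ : ℝ≥0∞ := ENNReal.ofReal (4 * (1 + L) ^ 3) with hκ
  have hκ0 : κ ≠ 0 := by
    rw [hκ, Ne, ENNReal.ofReal_eq_zero, not_le]
    positivity
  have havg : ∀ (n : ℕ) r, 0 < r → (1 + L) * r < δ / 3 → (1 + L) * r < 1 / ((n : ℝ) + 1) →
      ⨍⁻ y in Metric.ball (x₀, f x₀) r ∩ Ω, ‖g y - T x₀‖ₑ ∂volume ≤
        κ * ((∫⁻ x in Metric.closedBall x₀ r, ‖T x - T x₀‖ₑ) / volume (Metric.closedBall x₀ r) +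
          (∫⁻ x in Metric.closedBall x₀ r, ‖u n x - u n x₀‖ₑ) /
            volume (Metric.closedBall x₀ r)) + κ * ‖u n x₀‖ₑ := by
    intro n r hr hrδ hrn
    have hV : volume (Metric.closedBall x₀ r) = ENNReal.ofReal (2 * r) := Real.volume_closedBall ..
    have hV0 : ENNReal.ofReal (2 * r) ≠ 0 := by
      rw [Ne, ENNReal.ofReal_eq_zero, not_le]
      positivity
    have hu2 : ∫⁻ x in Metric.closedBall x₀ r, ‖u n x‖ₑ ≤
        (∫⁻ x in Metric.closedBall x₀ r, ‖u n x - u n x₀‖ₑ) +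
          ‖u n x₀‖ₑ * ENNReal.ofReal (2 * r) := by
      rw [← hV, ← setLIntegral_const, ← lintegral_add_right _ measurable_const]
      refine lintegral_mono fun x => ?_
      simpa using enorm_add_le (u n x - u n x₀) (u n x₀)
    set I₁ := ∫⁻ x in Metric.closedBall x₀ r, ‖T x - T x₀‖ₑ
    set I₂ := ∫⁻ x in Metric.closedBall x₀ r, ‖u n x - u n x₀‖ₑ
    rw [setLAverage_eq, hV]
    have hvr := hvol r hr (by linarith)
    calc _ ≤ ENNReal.ofReal ((1 + L) * r) * (I₁ + (I₂ + ‖u n x₀‖ₑ * ENNReal.ofReal (2 * r))) /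
          ENNReal.ofReal (r ^ 2 / (2 * (1 + L) ^ 2)) := by
          gcongr
          refine (hint n r hr hrδ hrn).trans ?_
          gcongr
      _ = κ * ((I₁ + (I₂ + ‖u n x₀‖ₑ * ENNReal.ofReal (2 * r))) / ENNReal.ofReal (2 * r)) := by
          have e : ENNReal.ofReal ((1 + L) * r) =
              κ * ENNReal.ofReal (r ^ 2 / (2 * (1 + L) ^ 2)) / ENNReal.ofReal (2 * r) := by
            rw [hκ, ← ENNReal.ofReal_mul (by positivity),
              ← ENNReal.ofReal_div_of_pos (by positivity)]
            congr 1
            field_simp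
            ring
          have hc0 : ENNReal.ofReal (r ^ 2 / (2 * (1 + L) ^ 2)) ≠ 0 := by
            rw [Ne, ENNReal.ofReal_eq_zero, not_le]
            positivity
          have hcT : ENNReal.ofReal (r ^ 2 / (2 * (1 + L) ^ 2)) ≠ ⊤ := ENNReal.ofReal_ne_top
          rw [e]
          generalize ENNReal.ofReal (r ^ 2 / (2 * (1 + L) ^ 2)) = c at hc0 hcT ⊢
          simp only [div_eq_mul_inv]
          calc _ = κ * ((I₁ + (I₂ + ‖u n x₀‖ₑ * ENNReal.ofReal (2 * r))) *
                (ENNReal.ofReal (2 * r))⁻¹) * (c * c⁻¹) := by ring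
            _ = _ := by rw [ENNReal.mul_inv_cancel hc0 hcT, mul_one]
      _ = _ := by
          rw [← add_assoc, ENNReal.add_div, ENNReal.mul_div_cancel_right hV0 ENNReal.ofReal_ne_top,
            ENNReal.add_div, mul_add]
  -- `n` is fixed so that `κ ‖u n x₀‖ ≤ ε / 2`; the means at this `n` are then made small by
  -- shrinking `r`.
  refine ENNReal.tendsto_nhds_zero.2 fun ε hε => ?_
  have hε2 : 0 < ε / 2 := ENNReal.half_pos hε.ne'
  have hun : Tendsto (fun n => κ * ‖u n x₀‖ₑ) atTop (𝓝 0) := by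
    have := ENNReal.Tendsto.const_mul hx0 (Or.inr (b := κ ≠ ⊤) ENNReal.ofReal_ne_top)
    rwa [mul_zero] at this
  obtain ⟨n, hn⟩ := (ENNReal.tendsto_nhds_zero.1 hun (ε / 2) hε2).exists
  have hsum := ENNReal.Tendsto.const_mul (hxT'.add (hxu' n))
    (Or.inr (b := κ ≠ ⊤) ENNReal.ofReal_ne_top)
  rw [add_zero, mul_zero] at hsum
  have hsmall : ∀ c : ℝ, 0 < c → ∀ᶠ r : ℝ in 𝓝[>] 0, (1 + L) * r < c := by
    intro c hc
    have : Tendsto (fun r : ℝ => (1 + L) * r) (𝓝[>] 0) (𝓝 ((1 + L) * 0)) :=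
      ((continuous_const.mul continuous_id).tendsto 0).mono_left nhdsWithin_le_nhds
    rw [mul_zero] at this
    exact this.eventually (gt_mem_nhds hc)
  filter_upwards [self_mem_nhdsWithin, hsmall (δ / 3) (by positivity),
    hsmall (1 / ((n : ℝ) + 1)) (by positivity),
    ENNReal.tendsto_nhds_zero.1 hsum (ε / 2) hε2] with r hr hr1 hr2 hr3
  refine (havg n r hr hr1 hr2).trans ?_
  rw [← ENNReal.add_halves ε]
  exact add_le_add hr3 hn

end IsStripSobolev

end Strip

/-! ### Representation of the fractional derivative by duality -/

namespace IsTemperedWeight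

variable {A : ℝ} {N : ℕ} {w : ℝ → ℝ}

/-- The tempered distribution given by a function in a weighted `L²` space. -/
theorem exists_isGivenBy (hw : IsTemperedWeight A N w) {T : ℝ → ℝ} (hT : Measurable T)
    (hT2 : l2norm volume (fun x => ‖w x * T x‖ₑ) < ⊤) :
    ∃ U : 𝓢'(ℝ, ℂ), IsGivenBy U (fun x => (T x : ℂ)) := by
  have hwm := hw.continuous.measurable
  have hm : MemLp (fun x => ((w x * T x : ℝ) : ℂ)) 2 volume := by
    refine ⟨(Complex.measurable_ofReal.comp (hwm.mul hT)).aestronglyMeasurable, ?_⟩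
    rw [eLpNorm_two_eq_l2norm]
    refine lt_of_le_of_lt (le_of_eq ?_) hT2
    congr 1
    funext x
    rw [← ofReal_norm, ← ofReal_norm, Complex.norm_real]
  refine ⟨TemperedDistribution.smulLeftCLM ℂ (fun x => ((w x)⁻¹ : ℂ))
    (Lp.toTemperedDistribution (hm.toLp _)), fun φ => ⟨?_, ?_⟩⟩
  · refine (hw.integrable_mul_schwartz hT hT2 φ).congr (Eventually.of_forall fun x => ?_)
    exact mul_comm _ _
  · rw [TemperedDistribution.smulLeftCLM_apply_apply, Lp.toTemperedDistribution_apply]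
    refine integral_congr_ae ?_
    filter_upwards [hm.coeFn_toLp] with x hx
    have h0 : (w x : ℂ) ≠ 0 := by exact_mod_cast (hw.pos x).ne'
    rw [hx, SchwartzMap.smulLeftCLM_apply_apply hw.growth_inv_ofReal]
    push_cast
    simp only [smul_eq_mul]
    field_simp

/-- The functional `v ↦ ⟨T, (1 - ∂²)^(1/4)(w v)⟩` is bounded in the `L²` norm on the dense Schwartz
space. It extends and is represented by some `H` in `L²` of norm at most `B`; then `k = w⁻¹ H`. -/
theorem exists_isFracDeriv (hw : IsTemperedWeight A N w) {T T' : ℝ → ℝ} (hT : Measurable T)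
    (hT2 : l2norm volume (fun x => ‖w x * T x‖ₑ) < ⊤) (hT' : T' =ᵐ[volume] T) {B : ℝ≥0∞}
    (hB : B < ⊤)
    (h : ∀ v : 𝓢(ℝ, ℂ), ‖∫ x, (T x : ℂ) * symbolOp (fun ξ => (quarterSymbol ξ : ℂ))
      (SchwartzMap.smulLeftCLM ℂ (fun x => (w x : ℂ)) v) x‖ₑ ≤ B * l2norm volume (fun x => ‖v x‖ₑ)) :
    ∃ k : ℝ → ℂ, IsFracDeriv (1 / 2) (fun x => (T' x : ℂ)) k ∧
      MemLp (fun x => (w x : ℂ) * k x) 2 volume ∧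
      eLpNorm (fun x => (w x : ℂ) * k x) 2 volume ≤ B := by
  obtain ⟨U, hU⟩ := hw.exists_isGivenBy hT hT2
  let Q : 𝓢(ℝ, ℂ) →L[ℂ] 𝓢(ℝ, ℂ) := symbolOp (fun ξ => (quarterSymbol ξ : ℂ)) ∘L
    SchwartzMap.smulLeftCLM ℂ (fun x => (w x : ℂ))
  let F : 𝓢(ℝ, ℂ) →ₗ[ℂ] ℂ :=
    { toFun := fun v => U (Q v)
      map_add' := fun a b => by rw [map_add, map_add]
      map_smul' := fun c a => by rw [map_smul, map_smul, RingHom.id_apply] }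
  have hF : ∀ v, F v = ∫ x, (T x : ℂ) * Q v x := by
    intro v
    rw [show F v = U (Q v) from rfl, (hU (Q v)).2]
    simp_rw [mul_comm]
  let E : 𝓢(ℝ, ℂ) →ₗ[ℂ] Lp ℂ 2 (volume : Measure ℝ) :=
    (SchwartzMap.toLpCLM ℂ ℂ 2 (volume : Measure ℝ)).toLinearMap
  have hEdense : DenseRange E := by
    have := SchwartzMap.denseRange_toLpCLM (E := ℝ) (F := ℂ) (p := 2) (μ := volume) (by simp)
    exact this
  have hEn : ∀ v, l2norm volume (fun x => ‖v x‖ₑ) = ENNReal.ofReal ‖E v‖ := by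
    intro v
    have e : E v = v.toLp 2 volume := rfl
    rw [e, SchwartzMap.norm_toLp, ENNReal.ofReal_toReal (v.memLp 2 volume).2.ne,
      eLpNorm_two_eq_l2norm]
  have hbound : ∀ v, ‖F v‖ ≤ B.toReal * ‖E v‖ := by
    intro v
    have h1 := h v
    rw [show (∫ x, (T x : ℂ) * symbolOp (fun ξ => (quarterSymbol ξ : ℂ))
      (SchwartzMap.smulLeftCLM ℂ (fun x => (w x : ℂ)) v) x) = F v from (hF v).symm, hEn,
      ← ENNReal.ofReal_toReal hB.ne, ← ENNReal.ofReal_mul ENNReal.toReal_nonneg,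
      ← ofReal_norm] at h1
    exact (ENNReal.ofReal_le_ofReal_iff (by positivity)).1 h1
  let ℓ := F.extendOfNorm E
  have hℓ : ∀ v, ℓ (E v) = F v := LinearMap.extendOfNorm_eq hEdense ⟨_, hbound⟩
  have hℓn : ‖ℓ‖ ≤ B.toReal := LinearMap.opNorm_extendOfNorm_le hEdense ENNReal.toReal_nonneg hbound
  let K : Lp ℂ 2 (volume : Measure ℝ) := (InnerProductSpace.toDual ℂ _).symm ℓ
  have hK : ∀ u, inner ℂ K u = ℓ u := fun u => InnerProductSpace.toDual_symm_apply
  have hKn : ‖K‖ ≤ B.toReal := by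
    rw [show ‖K‖ = ‖ℓ‖ from LinearIsometryEquiv.norm_map _ _]
    exact hℓn
  -- The pairing with test functions is bilinear, whereas the inner product is conjugate-linear in
  -- its first argument.
  let H : ℝ → ℂ := fun x => (starRingEnd ℂ) (K x)
  have hHm : MemLp H 2 volume := (Lp.memLp K).star
  have hHn : eLpNorm H 2 volume ≤ B := by
    have e : eLpNorm H 2 volume = eLpNorm K 2 volume :=
      eLpNorm_congr_norm_ae (Eventually.of_forall fun x => by simp [H])
    rw [e, ← ENNReal.ofReal_toReal (Lp.memLp K).2.ne, ← Lp.norm_def, ← ENNReal.ofReal_toReal hB.ne]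
    exact ENNReal.ofReal_le_ofReal hKn
  have hwne : ∀ x, (w x : ℂ) ≠ 0 := fun x => by exact_mod_cast (hw.pos x).ne'
  have hwH : (fun x => (w x : ℂ) * (((w x)⁻¹ : ℂ) * H x)) = H := by
    funext x
    rw [← mul_assoc, mul_inv_cancel₀ (hwne x), one_mul]
  refine ⟨fun x => ((w x)⁻¹ : ℂ) * H x, ⟨U, fun φ => ?_, fun φ => ?_⟩, ?_, ?_⟩
  · have e : (fun x => φ x * (T x : ℂ)) =ᵐ[volume] fun x => φ x * (T' x : ℂ) := by
      filter_upwards [hT'] with x hx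
      rw [hx]
    exact ⟨(hU φ).1.congr e, (hU φ).2.trans (integral_congr_ae e)⟩
  · set v := SchwartzMap.smulLeftCLM ℂ (fun x => ((w x)⁻¹ : ℂ)) φ with hv
    have hvx : ∀ x, v x = ((w x)⁻¹ : ℂ) * φ x := fun x => by
      rw [hv, SchwartzMap.smulLeftCLM_apply_apply hw.growth_inv_ofReal, smul_eq_mul]
    have e1 : fracDeriv (1 / 2) U φ = F v := by
      have : Q v = symbolOp (fun ξ => (quarterSymbol ξ : ℂ)) φ := by
        change symbolOp _ (SchwartzMap.smulLeftCLM ℂ (fun x => (w x : ℂ)) v) = _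
        rw [hv, hw.smulLeftCLM_smulLeftCLM_inv]
      change _ = U (Q v)
      rw [this]
      -- The multiplier on distributions is the transpose of `symbolOp`, and the symbol of
      -- `fracDeriv (1 / 2)` unfolds to `quarterSymbol`, with the exponent in the form `1 / 2 / 2`.
      rfl
    have hint : Integrable fun x => v x * H x := (v.memLp 2 volume).integrable_mul hHm
    constructor
    · refine hint.congr (Eventually.of_forall fun x => ?_)
      dsimp only
      rw [hvx]
      ring
    · rw [e1, ← hℓ, ← hK, L2.inner_def]
      refine integral_congr_ae ?_
      filter_upwards [v.coeFn_toLp 2 volume] with x hx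
      have e : (E v : ℝ → ℂ) x = v x := hx
      rw [e, hvx, RCLike.inner_apply]
      simp only [H]
      ring
  · rwa [hwH]
  · rwa [hwH]

end IsTemperedWeight

/-! ### The trace theorem -/

/-- A measurable representative on the whole plane, vanishing off `Ω`, turns integrals over `Ω` into
plane integrals and makes every slice measurable. -/
theorem exists_measurable_zero_extension {Ω : Set (ℝ × ℝ)} (hΩ : MeasurableSet Ω)
    {g : ℝ × ℝ → ℝ} (hg : AEStronglyMeasurable g (volume.restrict Ω)) :
    ∃ g' : ℝ × ℝ → ℝ, Measurable g' ∧ (∀ x ∉ Ω, g' x = 0) ∧ g =ᵐ[volume.restrict Ω] g' := by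
  refine ⟨Ω.indicator (hg.mk g), hg.stronglyMeasurable_mk.measurable.indicator hΩ,
    fun x hx => indicator_of_notMem hx _, ?_⟩
  filter_upwards [hg.ae_eq_mk, ae_restrict_mem hΩ] with x hx hxΩ
  rw [indicator_of_mem hxΩ, hx]

theorem setIntegral_mul_eq_integral_mul {Ω : Set (ℝ × ℝ)} {g g' : ℝ × ℝ → ℝ}
    (h0 : ∀ x ∉ Ω, g' x = 0) (h : g =ᵐ[volume.restrict Ω] g') (D : ℝ × ℝ → ℝ) :
    ∫ x in Ω, g x * D x = ∫ x, g' x * D x := by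
  rw [← setIntegral_eq_integral_of_forall_compl_eq_zero (s := Ω) (f := fun x => g' x * D x)
    (fun x hx => by rw [h0 x hx, zero_mul])]
  refine integral_congr_ae ?_
  filter_upwards [h] with x hx
  rw [hx]

theorem eLpNorm_restrict_eq_l2norm {Ω : Set (ℝ × ℝ)} (hΩ : MeasurableSet Ω) {w : ℝ → ℝ}
    {g g' : ℝ × ℝ → ℝ} (h0 : ∀ x ∉ Ω, g' x = 0) (h : g =ᵐ[volume.restrict Ω] g') :
    eLpNorm (fun x => w x.1 * g x) 2 (volume.restrict Ω) =
      l2norm volume (fun x : ℝ × ℝ => ‖w x.1 * g' x‖ₑ) := by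
  have e : (fun x => w x.1 * g x) =ᵐ[volume.restrict Ω] fun x => w x.1 * g' x := by
    filter_upwards [h] with x hx
    rw [hx]
  have e' : Ω.indicator (fun x => w x.1 * g' x) = fun x => w x.1 * g' x := by
    refine indicator_eq_self.2 fun x hx => ?_
    by_contra hcon
    exact hx (by simp only [h0 x hcon, mul_zero])
  rw [eLpNorm_congr_ae e, ← eLpNorm_indicator_eq_eLpNorm_restrict hΩ, e', eLpNorm_two_eq_l2norm]

theorem mainTheorem3 (μ ν : ℝ) (L : ℝ≥0) (δ : ℝ) (hδ : 0 < δ) :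
    ∃ C : ℝ, 0 < C ∧
      ∀ (t : ℝ) (f : ℝ → ℝ), LipschitzWith L f →
      ∀ Ω : Set (ℝ × ℝ), IsGraphDomain f δ Ω →
      ∀ g g₁ g₂ : ℝ × ℝ → ℝ,
        HasWeakDirDeriv Ω (1, 0) g g₁ → HasWeakDirDeriv Ω (0, 1) g g₂ →
        MemLp (fun x => weight μ ν t x.1 * g x) 2 (volume.restrict Ω) →
        MemLp (fun x => weight μ ν t x.1 * g₁ x) 2 (volume.restrict Ω) →
        MemLp (fun x => weight μ ν t x.1 * g₂ x) 2 (volume.restrict Ω) →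
        (∃ T : ℝ → ℝ, IsTrace Ω f g T) ∧
        ∀ T : ℝ → ℝ, IsTrace Ω f g T →
          ∃ h : ℝ → ℂ, IsFracDeriv (1 / 2) (fun x₁ => (T x₁ : ℂ)) h ∧
            MemLp (fun x₁ => (weight μ ν t x₁ : ℂ) * h x₁) 2 volume ∧
            eLpNorm (fun x₁ => (weight μ ν t x₁ : ℂ) * h x₁) 2 volume ≤
              ENNReal.ofReal C *
                (eLpNorm (fun x => weight μ ν t x.1 * g x) 2 (volume.restrict Ω) +
                  eLpNorm (fun x => weight μ ν t x.1 * g₁ x) 2 (volume.restrict Ω) +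
                  eLpNorm (fun x => weight μ ν t x.1 * g₂ x) 2 (volume.restrict Ω)) := by
  obtain ⟨A, N, hA, hw⟩ := exists_isTemperedWeight_weight μ ν
  obtain ⟨C, hC, hest⟩ := exists_enorm_integral_stripTrace_le hA N hδ
  obtain ⟨M, hM, hflat⟩ := exists_isStripSobolev hδ L
  refine ⟨C * M, mul_pos hC hM, ?_⟩
  intro t f hf Ω hΩ g g₁ g₂ hg₁ hg₂ hm hm₁ hm₂
  replace hw := hw t
  set w := weight μ ν t
  obtain ⟨σ, hσ, hside, hside'⟩ := hΩ.exists_side hf.continuous hδ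
  have hΩo : IsOpen Ω := hΩ.1
  have hΩm := hΩo.measurableSet
  obtain ⟨hgl, hgl₁, hweak₁⟩ := hg₁
  obtain ⟨-, hgl₂, hweak₂⟩ := hg₂
  obtain ⟨a, ha, ha0, hga⟩ := exists_measurable_zero_extension hΩm hgl.aestronglyMeasurable
  obtain ⟨a₁, ha₁, ha0₁, hga₁⟩ := exists_measurable_zero_extension hΩm hgl₁.aestronglyMeasurable
  obtain ⟨a₂, ha₂, ha0₂, hga₂⟩ := exists_measurable_zero_extension hΩm hgl₂.aestronglyMeasurable
  have n := eLpNorm_restrict_eq_l2norm (w := w) hΩm ha0 hga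
  have n₁ := eLpNorm_restrict_eq_l2norm (w := w) hΩm ha0₁ hga₁
  have n₂ := eLpNorm_restrict_eq_l2norm (w := w) hΩm ha0₂ hga₂
  have f0 := hm.2
  have f₁ := hm₁.2
  have f₂ := hm₂.2
  rw [n] at f0
  rw [n₁] at f₁
  rw [n₂] at f₂
  obtain ⟨G, G₁, G₂, hS, hGa, hle⟩ := hflat w f hf σ hσ Ω a a₁ a₂ hw.continuous hw.pos hside
    ha ha₁ ha₂ f0 f₁ f₂
    (fun φ h1 h2 h3 => by
      rw [← setIntegral_mul_eq_integral_mul ha0 hga, ← setIntegral_mul_eq_integral_mul ha0₁ hga₁]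
      exact hweak₁ φ h1 h2 h3)
    (fun φ h1 h2 h3 => by
      rw [← setIntegral_mul_eq_integral_mul ha0 hga, ← setIntegral_mul_eq_integral_mul ha0₂ hga₂]
      exact hweak₂ φ h1 h2 h3)
  have htr : IsTrace Ω f g (stripTrace δ G₂) :=
    (hS.isTrace_stripTrace hw.continuous hw.pos hδ hf hσ hside hside' hGa).congr_ae hga.symm
  refine ⟨⟨_, htr⟩, fun T hT => ?_⟩
  have hgr : ∀ x, (x, f x) ∈ closure Ω := by
    intro x
    refine frontier_subset_closure ?_
    rcases hΩ.2.2 with h | ⟨b, -, h⟩ <;> rw [h]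
    · rfl
    · exact Or.inl rfl
  -- Uniqueness reduces an arbitrary trace to the explicit boundary value, which is measurable and
  -- for which the dual estimate is available.
  have hTT := hT.ae_eq hΩo hgr hgl.aestronglyMeasurable htr
  have hTm := measurable_stripTrace δ hS.measurable₂
  have hT2 : l2norm volume (fun x => ‖w x * stripTrace δ G₂ x‖ₑ) < ⊤ :=
    (IsStripSobolev.l2norm_mul_stripTrace_le hw.continuous hδ.le hS.measurable₂).trans_lt
      (ENNReal.mul_lt_top ENNReal.ofReal_lt_top hS.lt_top₂)
  rw [n, n₁, n₂]
  refine hw.exists_isFracDeriv hTm hT2 hTT (ENNReal.mul_lt_top ENNReal.ofReal_lt_top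
    (ENNReal.add_lt_top.2 ⟨ENNReal.add_lt_top.2 ⟨f0, f₁⟩, f₂⟩)) fun v => ?_
  refine (hest w G G₁ G₂ hw hS v).trans ?_
  rw [ENNReal.ofReal_mul hC.le, mul_assoc (ENNReal.ofReal C) (ENNReal.ofReal M)]
  gcongr
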